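/- **Setting.** A *unitary representation of $\mathfrak{su}(1,1)$* on a complex Hilbert space $\mathcal H$ is a triple $(E_0,E_+,E_-)$ of skew-adjoint operators whose common domain $\mathcal D^\infty$ of smooth vectors (the largest subspace contained in the three domains and invariant under the three operators) is dense, and which satisfies $[E_0,E_\pm]=\pm2E_\pm$ and $[E_+,E_-]=E_0$ on $\mathcal D^\infty$. It is *irreducible* if $\mathcal H\neq0$ and no closed subspace other than $0$ and $\mathcal H$ reduces the three operators. Put $L_0=i(E_--E_+)$ and $L_\pm=\frac12(E_0\pm i(E_++E_-))$ (on the natural domains). An irreducible unitary representation is of *lowest-weight-type* if, on $\mathcal D^\infty$, $\ker L_+=0$ and $\dim\ker L_-=1$; its *lowest weight* is the number $\lambda$ with $L_0v=\lambda v$ for $v\in\ker L_-$. On $L^2(\mathbb R^+)$, $\mathbb R^+=(0,\infty)$, let $Q$ be multiplication by $x$ and $P=-i\,d/dx$. Let $E_+=iQ$ and $E_0=i(PQ+QP)=2x\frac{d}{dx}+1$ on their maximal domains (for $E_0$: all locally absolutely continuous $f\in L^2(\mathbb R^+)$ with $xf'\in L^2(\mathbb R^+)$). For $k>-\frac12$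 let $\tilde E_{-,k}=-i(PQP+k^2Q^{-1})$ on the space of those $f=x^kf_0\in L^2(\mathbb R^+)\cap C^1(\mathbb R^+)$ with $xf'$ locally absolutely continuous such that $(PQP+k^2Q^{-1})f=-(2k+1)x^kf_0'-x^{k+1}f_0''\in L^2(\mathbb R^+)$, $f_0$ is bounded near $0$, $x^{2k+1}f_0'(x)\to0$ as $x\to0$, and $f(x)\to0$ as $x\to\infty$. **Theorem.** (1) For each $k>-\frac12$ the operator $\tilde E_{-,k}$ has exactly one skew-adjoint extension $E_{-,k}$, and $iE_{-,k}$ is the Friedrichs extension of $i\tilde E_{-,k}$. The triple $(E_0,E_+,E_{-,k})$ is an irreducible unitary representation of $\mathfrak{su}(1,1)$ of lowest-weight-type, with lowest weight $\lambda=2k+1$. (2) The lowest weight of each irreducible unitary representation of lowest-weight-type is $2k+1$ for exactly one $k>-\frac12$, and the representation is unitarily equivalent to $(E_0,E_+,E_{-,k})$. (3) In the representation $(E_0,E_+,E_{-,k})$ the functions $$|n\rangle(x)=\sqrt{\tfrac{2^{2k+1}\,n!}{\Gamma(n+2k+1)}}\;e^{-x}x^kS_n^{2k}(2x),\qquad S_n^l(x)=\sum_{m=0}^n\frac{(-1)^m}{(n-m)!}\frac{\Gamma(n+l+1)\,x^m}{\Gamma(m+l+1)\,m!},\qquad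 n\ge0,$$ form an orthonormal basis of $L^2(\mathbb R^+)$ with $L_0|n\rangle=(\lambda+2n)|n\rangle$, $L_+|n\rangle=\sqrt{(n+1)(\lambda+n)}\,|n+1\rangle$, $L_-|0\rangle=0$ and $L_-|n+1\rangle=-\sqrt{(n+1)(\lambda+n)}\,|n\rangle$. (4) In this representation, $a=\frac12L_+^{-1}(L_0-\lambda)$ extends to a bounded operator on $L^2(\mathbb R^+)$ (with $af\in\mathcal D(L_+)$ and $L_+af=\frac12(L_0-\lambda)f$ for $f\in\mathcal D(L_0)$), $a-1$ is injective, and $-i(a+1)(a-1)^{-1}$ is defined on the linear span of $\{|n\rangle\}_{n\ge 0}$. Let $A$ be the closure of the operator $-i(a+1)(a-1)^{-1}$ with that span as domain. For $\operatorname{Im}\eta>0$ the affine coherent state $$|\eta\rangle_A(x)=\sqrt{\tfrac{(2\operatorname{Im}\eta)^{2k+1}}{\Gamma(2k+1)}}\;x^ke^{i\eta x}$$ is a unit vector of $L^2(\mathbb R^+)$ with $A|\eta\rangle_A=\eta|\eta\rangle_A$; and if $Af=\eta f$ with $f\ne0$ then $\operatorname{Im}\eta>0$ and $f$ is a scalar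 multiple of $|\eta\rangle_A$. -/

import Mathlib

universe u

noncomputable section

namespace SU11

open MeasureTheory Filter Topology Set Asymptotics

/-! ## Abstract representations of `su(1,1)` by unbounded operators -/

section Abstract

variable {H : Type*} [NormedAddCommGroup H] [InnerProductSpace ℂ H]

/-- A densely defined operator `E` with `E* = -E` (equality of operators, domains included). -/
def IsSkewAdjoint [CompleteSpace H] (E : H →ₗ.[ℂ] H) : Prop :=
  Dense (E.domain : Set H) ∧ E.adjoint = -E

/-- The domain of smooth vectors of a triple of operators: the largest subspace contained in all
three domains and mapped into itself by all three operators (equivalently, the set of vectors to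
which every finite word in the three operators can be applied). -/
def smoothDomain (E0 Ep Em : H →ₗ.[ℂ] H) : Submodule ℂ H :=
  sSup {D : Submodule ℂ H | ∀ E ∈ ({E0, Ep, Em} : Set (H →ₗ.[ℂ] H)),
    ∀ x ∈ D, ∃ y ∈ D, (x, y) ∈ E.graph}

/-- The relation `[X, Y] = Z` on the subspace `D`: `X Y x - Y X x = Z x` for all `x ∈ D`. -/
def CommutatorEqOn (D : Submodule ℂ H) (X Y Z : H →ₗ.[ℂ] H) : Prop :=
  ∀ x ∈ D, ∃ y xy z yx : H, (x, y) ∈ Y.graph ∧ (y, xy) ∈ X.graph ∧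
    (x, z) ∈ X.graph ∧ (z, yx) ∈ Y.graph ∧ (x, xy - yx) ∈ Z.graph

/-- A unitary representation of the Lie algebra `su(1,1)`: a triple of skew-adjoint operators
satisfying `[E₀, E±] = ±2 E±` and `[E₊, E₋] = E₀` on their (dense) common domain of smooth
vectors. -/
structure IsUnitaryRep [CompleteSpace H] (E0 Ep Em : H →ₗ.[ℂ] H) : Prop where
  skew_zero : IsSkewAdjoint E0
  skew_plus : IsSkewAdjoint Ep
  skew_minus : IsSkewAdjoint Em
  dense_smooth : Dense (smoothDomain E0 Ep Em : Set H)
  comm_zero_plus : CommutatorEqOn (smoothDomain E0 Ep Em) E0 Ep ((2 : ℂ) • Ep)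
  comm_zero_minus : CommutatorEqOn (smoothDomain E0 Ep Em) E0 Em ((-2 : ℂ) • Em)
  comm_plus_minus : CommutatorEqOn (smoothDomain E0 Ep Em) Ep Em E0

/-- The closed subspace `K` reduces `E`: the orthogonal projection `P` onto `K` satisfies
`P E ⊆ E P`. -/
def Reduces (K : Submodule ℂ H) [K.HasOrthogonalProjection] (E : H →ₗ.[ℂ] H) : Prop :=
  ∀ x y : H, (x, y) ∈ E.graph → (K.starProjection x, K.starProjection y) ∈ E.graph

/-- Irreducibility: the space is non-zero and no closed subspace other than `0` and the whole
space reduces all three operators. -/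
def IsIrreducible (E0 Ep Em : H →ₗ.[ℂ] H) : Prop :=
  Nontrivial H ∧ ∀ (K : Submodule ℂ H) [K.HasOrthogonalProjection],
    Reduces K E0 → Reduces K Ep → Reduces K Em → K = ⊥ ∨ K = ⊤

/-- `L₀ = i (E₋ - E₊)` on the natural domain. -/
def opL0 (Ep Em : H →ₗ.[ℂ] H) : H →ₗ.[ℂ] H := Complex.I • (Em - Ep)

/-- `L₊ = (E₀ + i (E₊ + E₋)) / 2` on the natural domain. -/
def opLp (E0 Ep Em : H →ₗ.[ℂ] H) : H →ₗ.[ℂ] H :=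
  (1 / 2 : ℂ) • (E0 + Complex.I • (Ep + Em))

/-- `L₋ = (E₀ - i (E₊ + E₋)) / 2` on the natural domain. -/
def opLm (E0 Ep Em : H →ₗ.[ℂ] H) : H →ₗ.[ℂ] H :=
  (1 / 2 : ℂ) • (E0 - Complex.I • (Ep + Em))

/-- The kernel of the operator `T` among the vectors of the subspace `D`. -/
def kerOn (D : Submodule ℂ H) (T : H →ₗ.[ℂ] H) : Submodule ℂ H :=
  D ⊓ (LinearMap.ker T.toFun).map T.domain.subtype

/-- An irreducible unitary representation of `su(1,1)` of lowest-weight-type: on smooth vectors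
`dim ker L₊ = 0` and `dim ker L₋ = 1`. -/
structure IsLowestWeightIrrep [CompleteSpace H] (E0 Ep Em : H →ₗ.[ℂ] H) : Prop where
  rep : IsUnitaryRep E0 Ep Em
  irreducible : IsIrreducible E0 Ep Em
  ker_plus : kerOn (smoothDomain E0 Ep Em) (opLp E0 Ep Em) = ⊥
  ker_minus : Module.finrank ℂ (kerOn (smoothDomain E0 Ep Em) (opLm E0 Ep Em)) = 1

/-- `lam` is the lowest weight: a non-zero vector of `ker L₋` satisfies `L₀ v = lam v`. -/
def HasLowestWeight (E0 Ep Em : H →ₗ.[ℂ] H) (lam : ℝ) : Prop :=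
  ∃ v ∈ kerOn (smoothDomain E0 Ep Em) (opLm E0 Ep Em), v ≠ 0 ∧
    (v, (lam : ℂ) • v) ∈ (opL0 Ep Em).graph

/-- An orthonormal weight basis for the lowest weight `lam`:
`L₀ |n⟩ = (lam + 2n) |n⟩`, `L₊ |n⟩ = √((n+1)(lam+n)) |n+1⟩`, `L₋ |0⟩ = 0` and
`L₋ |n+1⟩ = -√((n+1)(lam+n)) |n⟩`. -/
structure IsWeightBasis (E0 Ep Em : H →ₗ.[ℂ] H) (lam : ℝ) (b : HilbertBasis ℕ ℂ H) : Prop where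
  L0_apply : ∀ n : ℕ, (b n, ((lam + 2 * n : ℝ) : ℂ) • b n) ∈ (opL0 Ep Em).graph
  Lp_apply : ∀ n : ℕ,
    (b n, ((Real.sqrt ((n + 1) * (lam + n)) : ℝ) : ℂ) • b (n + 1)) ∈ (opLp E0 Ep Em).graph
  Lm_zero : (b 0, 0) ∈ (opLm E0 Ep Em).graph
  Lm_succ : ∀ n : ℕ,
    (b (n + 1), -((Real.sqrt ((n + 1) * (lam + n)) : ℝ) : ℂ) • b n) ∈ (opLm E0 Ep Em).graph

/-- `a` is the `su(1,1)`-annihilation operator `a = (1/2) L₊⁻¹ (L₀ - lam)`: a bounded operator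
which maps the domain of `L₀` into that of `L₊` and satisfies `L₊ a f = (1/2) (L₀ f - lam f)`. -/
def IsAnnihilationOperator (E0 Ep Em : H →ₗ.[ℂ] H) (lam : ℝ) (a : H →L[ℂ] H) : Prop :=
  ∀ f g : H, (f, g) ∈ (opL0 Ep Em).graph →
    (a f, (1 / 2 : ℂ) • (g - (lam : ℂ) • f)) ∈ (opLp E0 Ep Em).graph

/-- The graph of `-i (a + 1) (a - 1)⁻¹` on the domain `W`. -/
def cayleyGraph (a : H →L[ℂ] H) (W : Submodule ℂ H) : Submodule ℂ (H × H) where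
  carrier := {p | p.1 ∈ W ∧ ∃ v : H, a v - v = p.1 ∧ p.2 = -Complex.I • (a v + v)}
  zero_mem' := ⟨W.zero_mem, 0, by simp, by simp⟩
  add_mem' := by
    rintro ⟨p1, p2⟩ ⟨q1, q2⟩ ⟨hp, v, hv, hv'⟩ ⟨hq, w, hw, hw'⟩
    refine ⟨W.add_mem hp hq, v + w, ?_, ?_⟩
    · simp only at hv hw
      simp only [map_add, Prod.mk_add_mk, ← hv, ← hw]
      abel
    · simp only at hv' hw'
      simp only [map_add, Prod.mk_add_mk, hv', hw', ← smul_add]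
      congr 1
      abel
  smul_mem' := by
    rintro c ⟨p1, p2⟩ ⟨hp, v, hv, hv'⟩
    refine ⟨W.smul_mem c hp, c • v, ?_, ?_⟩
    · simp only at hv
      simp only [map_smul, Prod.smul_mk, ← hv, smul_sub]
    · simp only at hv'
      simp only [map_smul, Prod.smul_mk, hv', ← smul_add]
      rw [smul_comm]

/-- `A` is the closure of the operator `-i (a + 1) (a - 1)⁻¹` whose domain is the span of the
weight basis `b`. -/
def IsOperatorA (b : HilbertBasis ℕ ℂ H) (a : H →L[ℂ] H) (A : H →ₗ.[ℂ] H) : Prop :=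
  Function.Injective (fun v : H => a v - v) ∧
    Submodule.span ℂ (range b) ≤ (cayleyGraph a (Submodule.span ℂ (range b))).map
      (LinearMap.fst ℂ H H) ∧
    A.graph = (cayleyGraph a (Submodule.span ℂ (range b))).topologicalClosure

/-- `S` is the Friedrichs extension of `T`: `T` is densely defined, symmetric and bounded from
below, and `S` is a self-adjoint extension of `T` with domain inside the form domain of `T`, i.e.
each vector of the domain of `S` is the limit of a sequence in the domain of `T` that is Cauchy
for the quadratic form of `T`. -/
def IsFriedrichsExtension [CompleteSpace H] (T S : H →ₗ.[ℂ] H) : Prop :=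
  Dense (T.domain : Set H) ∧ T.IsFormalAdjoint T ∧
    (∃ c : ℝ, ∀ x : T.domain, c * ‖(x : H)‖ ^ 2 ≤ (inner ℂ (x : H) (T x)).re) ∧
    T ≤ S ∧ IsSelfAdjoint S ∧
    ∀ x ∈ S.domain, ∃ u : ℕ → T.domain, Tendsto (fun n => (u n : H)) atTop (𝓝 x) ∧
      Tendsto (fun p : ℕ × ℕ => (inner ℂ ((u p.1 - u p.2 : T.domain) : H)
        (T (u p.1 - u p.2))).re) atTop (𝓝 0)

/-- The unitary map `U` carries the operator `E` exactly onto `E'`, domains included. -/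
def Intertwines {H' : Type*} [NormedAddCommGroup H'] [InnerProductSpace ℂ H']
    (U : H ≃ₗᵢ[ℂ] H') (E : H →ₗ.[ℂ] H) (E' : H' →ₗ.[ℂ] H') : Prop :=
  ∀ x y : H, (x, y) ∈ E.graph ↔ (U x, U y) ∈ E'.graph

end Abstract

/-! ## The operators on `L²(ℝ⁺)` -/

/-- Lebesgue measure on the half-line `ℝ⁺ = (0, ∞)`. -/
abbrev posMeasure : Measure ℝ := volume.restrict (Ioi (0 : ℝ))

/-- The Hilbert space `L²(ℝ⁺)`. -/
abbrev L2Pos : Type := Lp ℂ 2 posMeasure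

/-- On `(0, ∞)` the function `F` is locally absolutely continuous with (almost everywhere)
derivative `h`: `h` is locally integrable and `F b - F a = ∫ₐᵇ h`. -/
def IsPrimitive (F h : ℝ → ℂ) : Prop :=
  LocallyIntegrableOn h (Ioi (0 : ℝ)) ∧
    ∀ a b : ℝ, 0 < a → 0 < b → F b - F a = ∫ x in a..b, h x

theorem IsPrimitive.intervalIntegrable {F h : ℝ → ℂ} (hF : IsPrimitive F h) {a b : ℝ}
    (ha : 0 < a) (hb : 0 < b) : IntervalIntegrable h volume a b := by
  have hsub : uIcc a b ⊆ Ioi (0 : ℝ) := fun x hx => lt_of_lt_of_le (lt_min ha hb) hx.1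
  exact (hF.1.integrableOn_compact_subset hsub isCompact_uIcc).intervalIntegrable

theorem IsPrimitive.zero : IsPrimitive 0 0 :=
  ⟨by exact (integrableOn_zero).locallyIntegrableOn, fun a b _ _ => by simp⟩

theorem IsPrimitive.add {F h G j : ℝ → ℂ} (hF : IsPrimitive F h) (hG : IsPrimitive G j) :
    IsPrimitive (F + G) (h + j) := by
  refine ⟨hF.1.add hG.1, fun a b ha hb => ?_⟩
  have := intervalIntegral.integral_add (hF.intervalIntegrable ha hb)
    (hG.intervalIntegrable ha hb)
  simp only [Pi.add_apply]
  rw [this, ← hF.2 a b ha hb, ← hG.2 a b ha hb]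
  ring

theorem IsPrimitive.smul {F h : ℝ → ℂ} (c : ℂ) (hF : IsPrimitive F h) :
    IsPrimitive (c • F) (c • h) := by
  refine ⟨hF.1.smul c, fun a b ha hb => ?_⟩
  simp only [Pi.smul_apply]
  rw [intervalIntegral.integral_smul, ← hF.2 a b ha hb, smul_sub]

theorem IsPrimitive.continuousOn {F h : ℝ → ℂ} (hF : IsPrimitive F h) :
    ContinuousOn F (Ioi (0 : ℝ)) := by
  intro x hx
  have hx0 : (0 : ℝ) < x := hx
  have hx2 : (0 : ℝ) < x / 2 := by linarith
  have hI := hF.intervalIntegrable hx2 (show (0 : ℝ) < 2 * x by linarith)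
  have hc := intervalIntegral.continuousOn_primitive_interval' hI
    (left_mem_uIcc : x / 2 ∈ uIcc (x / 2) (2 * x))
  have hn : uIcc (x / 2) (2 * x) ∈ 𝓝 x := by
    rw [uIcc_of_le (by linarith)]
    exact Icc_mem_nhds (by linarith) (by linarith)
  have h1 : ContinuousAt (fun y => F (x / 2) + ∫ t in (x / 2)..y, h t) x :=
    continuousAt_const.add (hc.continuousAt hn)
  refine (h1.congr ?_).continuousWithinAt
  filter_upwards [Ioi_mem_nhds hx0] with y hy
  rw [← hF.2 _ _ hx2 hy]
  ring

theorem IsPrimitive.ae_zero {F h : ℝ → ℂ} (hF : IsPrimitive F h)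
    (h0 : ∀ x, 0 < x → F x = 0) : h =ᵐ[posMeasure] 0 := by
  have key : ∀ n : ℕ, ∀ᵐ x : ℝ, x ∈ Ioo (1 / ((n : ℝ) + 1)) ((n : ℝ) + 1) → h x = 0 := by
    intro n
    have hn1 : (0 : ℝ) < 1 / ((n : ℝ) + 1) := by positivity
    have hn2 : (0 : ℝ) < (n : ℝ) + 1 := by positivity
    filter_upwards [(hF.intervalIntegrable hn1 hn2).ae_hasDerivAt_integral] with x hx hxm
    have hle : 1 / ((n : ℝ) + 1) ≤ (n : ℝ) + 1 := (hxm.1.trans hxm.2).le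
    have hd := hx (by rw [uIcc_of_le hle]; exact Ioo_subset_Icc_self hxm) _ left_mem_uIcc
    have hx0 : 0 < x := hn1.trans hxm.1
    have hz : (fun y => ∫ t in (1 / ((n : ℝ) + 1))..y, h t) =ᶠ[𝓝 x] fun _ => (0 : ℂ) := by
      filter_upwards [Ioi_mem_nhds hx0] with y hy
      rw [← hF.2 _ _ hn1 hy, h0 _ hy, h0 _ hn1, sub_zero]
    exact hd.unique ((hasDerivAt_const x (0 : ℂ)).congr_of_eventuallyEq hz)
  rw [← ae_all_iff] at key
  rw [EventuallyEq, ae_restrict_iff' measurableSet_Ioi]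
  filter_upwards [key] with x hx hx0
  have hx0' : (0 : ℝ) < x := hx0
  obtain ⟨n, hn⟩ := exists_nat_gt (max x (1 / x))
  have hn1 : x < (n : ℝ) + 1 := by linarith [le_max_left x (1 / x)]
  have hn2 : 1 / x < (n : ℝ) + 1 := by linarith [le_max_right x (1 / x)]
  exact hx n ⟨(one_div_lt hx0' (by positivity)).1 hn2, hn1⟩

theorem eq_zero_of_ae_zero {F : ℝ → ℂ} (hc : ContinuousOn F (Ioi (0 : ℝ)))
    (h0 : F =ᵐ[posMeasure] 0) : ∀ x, 0 < x → F x = 0 := by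
  have h : EqOn F (fun _ => (0 : ℂ)) (Ioi 0) :=
    Measure.eqOn_open_of_ae_eq h0 isOpen_Ioi hc continuousOn_const
  exact fun x hx => h hx

/-- The graph of `E₀ = i (P Q + Q P)` with `P = -i d/dx` and `Q` multiplication by `x`: all pairs
`(f, g)` such that `f` has a locally absolutely continuous representative `F`, with derivative
`F'`, and `g = i (-i (x F)' + x (-i F'))`, where `(x F)' = F + x F'`. -/
def graphE0 : Submodule ℂ (L2Pos × L2Pos) where
  carrier := {p | ∃ F F' : ℝ → ℂ, IsPrimitive F F' ∧ p.1 =ᵐ[posMeasure] F ∧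
    p.2 =ᵐ[posMeasure] fun x =>
      Complex.I * (-Complex.I * (F x + x * F' x) + x * (-Complex.I * F' x))}
  zero_mem' := ⟨0, 0, IsPrimitive.zero, Lp.coeFn_zero _ _ _, by
    refine (Lp.coeFn_zero _ _ _).trans (Eventually.of_forall fun x => ?_)
    simp⟩
  add_mem' := by
    rintro ⟨f, g⟩ ⟨u, v⟩ ⟨F, F', hF, hf, hg⟩ ⟨U, U', hU, hu, hv⟩
    refine ⟨F + U, F' + U', hF.add hU, ?_, ?_⟩
    · exact (Lp.coeFn_add f u).trans (hf.add hu)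
    · filter_upwards [Lp.coeFn_add g v, hg, hv] with x h1 h2 h3
      simp only [Prod.mk_add_mk, Pi.add_apply] at h1 h2 h3 ⊢
      rw [h1, h2, h3]
      ring
  smul_mem' := by
    rintro c ⟨f, g⟩ ⟨F, F', hF, hf, hg⟩
    refine ⟨c • F, c • F', hF.smul c, ?_, ?_⟩
    · filter_upwards [Lp.coeFn_smul c f, hf] with x h1 h2
      simp only [Prod.smul_mk, Pi.smul_apply] at h1 h2 ⊢
      rw [h1, h2]
    · filter_upwards [Lp.coeFn_smul c g, hg] with x h1 h2
      simp only [Prod.smul_mk, Pi.smul_apply, smul_eq_mul] at h1 h2 ⊢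
      rw [h1, h2]
      ring

theorem graphE0_single (p : L2Pos × L2Pos) (hp : p ∈ graphE0) (h0 : p.1 = 0) : p.2 = 0 := by
  obtain ⟨F, F', hF, hf, hg⟩ := hp
  have hF0 : F =ᵐ[posMeasure] 0 := by
    rw [h0] at hf
    exact hf.symm.trans (Lp.coeFn_zero _ _ _)
  have hz := eq_zero_of_ae_zero hF.continuousOn hF0
  rw [Lp.eq_zero_iff_ae_eq_zero]
  filter_upwards [hg, hF0, hF.ae_zero hz] with x h1 h2 h3
  rw [h1, h2, h3]
  simp

/-- The operator `E₀ = i (P Q + Q P)` on `L²(ℝ⁺)`. -/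
def concreteE0 : L2Pos →ₗ.[ℂ] L2Pos := graphE0.toLinearPMap

theorem concreteE0_graph : concreteE0.graph = graphE0 :=
  Submodule.toLinearPMap_graph_eq _ graphE0_single

/-- The graph of `E₊ = i Q`, on the maximal domain of the multiplication operator. -/
def graphEp : Submodule ℂ (L2Pos × L2Pos) where
  carrier := {p | p.2 =ᵐ[posMeasure] fun x => Complex.I * (x * (p.1 : ℝ → ℂ) x)}
  zero_mem' := by
    show ((0 : L2Pos) : ℝ → ℂ) =ᵐ[posMeasure]
      fun x => Complex.I * (x * ((0 : L2Pos) : ℝ → ℂ) x)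
    filter_upwards [Lp.coeFn_zero ℂ 2 posMeasure] with x hx
    rw [hx]
    simp
  add_mem' := by
    rintro ⟨f, g⟩ ⟨u, v⟩ hg hv
    simp only [mem_ofPred_eq, Prod.mk_add_mk] at hg hv ⊢
    filter_upwards [Lp.coeFn_add f u, Lp.coeFn_add g v, hg, hv] with x h1 h2 h3 h4
    simp only [Pi.add_apply] at h1 h2
    rw [h1, h2, h3, h4]
    ring
  smul_mem' := by
    rintro c ⟨f, g⟩ hg
    simp only [mem_ofPred_eq, Prod.smul_mk] at hg ⊢
    filter_upwards [Lp.coeFn_smul c f, Lp.coeFn_smul c g, hg] with x h1 h2 h3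
    simp only [Pi.smul_apply, smul_eq_mul] at h1 h2
    rw [h1, h2, h3]
    ring

theorem graphEp_single (p : L2Pos × L2Pos) (hp : p ∈ graphEp) (h0 : p.1 = 0) : p.2 = 0 := by
  have hp' : p.2 =ᵐ[posMeasure] fun x => Complex.I * (x * (p.1 : ℝ → ℂ) x) := hp
  rw [h0] at hp'
  rw [Lp.eq_zero_iff_ae_eq_zero]
  filter_upwards [hp', Lp.coeFn_zero ℂ 2 posMeasure] with x h1 h2
  rw [h1, h2]
  simp

/-- The operator `E₊ = i Q` on `L²(ℝ⁺)`. -/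
def concreteEp : L2Pos →ₗ.[ℂ] L2Pos := graphEp.toLinearPMap

theorem concreteEp_graph : concreteEp.graph = graphEp :=
  Submodule.toLinearPMap_graph_eq _ graphEp_single

/-- The graph of `-i (P Q P + k² Q⁻¹)` on its initial domain. A pair `(f, g)` belongs to it when
`f` has a `C¹` representative `F` on `(0, ∞)` such that
* `x F'` is locally absolutely continuous with derivative `h`, so `P Q P F = -(x F')' = -h`, and
  `g = -i (-h + k² F / x)` (in particular this function is square integrable);
* writing `F = x^k F₀`, the function `F₀` is bounded near `0`, and
  `x^(2k+1) F₀'(x) = x^k (x F' - k F)` tends to `0` as `x → 0`;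
* `F x → 0` as `x → ∞`.

(The vanishing of `x^(2k+1) F₀'` at `0` follows from the other conditions if `k ≥ 0`; for
`-1/2 < k < 0` it excludes the behaviour `x^(-k)` at `0`.) -/
def graphPreEm (k : ℝ) : Submodule ℂ (L2Pos × L2Pos) where
  carrier := {p | ∃ F F' h : ℝ → ℂ, (∀ x, 0 < x → HasDerivAt F (F' x) x) ∧
    IsPrimitive (fun x => x * F' x) h ∧ p.1 =ᵐ[posMeasure] F ∧
    (p.2 =ᵐ[posMeasure] fun x => -Complex.I * (-h x + (k : ℂ) ^ 2 * F x / x)) ∧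
    (F =O[𝓝[>] 0] fun x : ℝ => x ^ k) ∧
    ((fun x : ℝ => x * F' x - k * F x) =o[𝓝[>] 0] fun x : ℝ => x ^ (-k)) ∧
    Tendsto F atTop (𝓝 0)}
  zero_mem' := by
    refine ⟨0, 0, 0, fun x _ => hasDerivAt_const x (0 : ℂ), ?_, Lp.coeFn_zero _ _ _, ?_,
      isBigO_zero _ _, ?_, tendsto_const_nhds⟩
    · convert IsPrimitive.zero using 1
      funext x
      simp
    · refine (Lp.coeFn_zero _ _ _).trans (Eventually.of_forall fun x => ?_)
      simp
    · simp
  add_mem' := by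
    rintro ⟨f, g⟩ ⟨u, v⟩ ⟨F, F', h, hF, hh, hf, hg, h1, h2, h3⟩ ⟨U, U', j, hU, hj, hu, hv, j1, j2,
      j3⟩
    refine ⟨F + U, F' + U', h + j, fun x hx => (hF x hx).add (hU x hx), ?_,
      (Lp.coeFn_add f u).trans (hf.add hu), ?_, h1.add j1, ?_, ?_⟩
    · convert hh.add hj using 1
      funext x
      simp only [Pi.add_apply]
      ring
    · filter_upwards [Lp.coeFn_add g v, hg, hv] with x e1 e2 e3
      simp only [Prod.mk_add_mk, Pi.add_apply] at e1 e2 e3 ⊢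
      rw [e1, e2, e3]
      ring
    · refine (h2.add j2).congr_left fun x => ?_
      simp only [Pi.add_apply]
      ring
    · have h4 := h3.add j3
      rw [add_zero] at h4
      exact h4
  smul_mem' := by
    rintro c ⟨f, g⟩ ⟨F, F', h, hF, hh, hf, hg, h1, h2, h3⟩
    refine ⟨c • F, c • F', c • h, fun x hx => (hF x hx).const_smul c, ?_, ?_, ?_,
      h1.const_smul_left c, ?_, ?_⟩
    · convert hh.smul c using 1
      funext x
      simp only [Pi.smul_apply, smul_eq_mul]
      ring
    · filter_upwards [Lp.coeFn_smul c f, hf] with x e1 e2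
      simp only [Prod.smul_mk, Pi.smul_apply] at e1 e2 ⊢
      rw [e1, e2]
    · filter_upwards [Lp.coeFn_smul c g, hg] with x e1 e2
      simp only [Prod.smul_mk, Pi.smul_apply, smul_eq_mul] at e1 e2 ⊢
      rw [e1, e2]
      ring
    · refine (h2.const_mul_left c).congr_left fun x => ?_
      simp only [Pi.smul_apply, smul_eq_mul]
      ring
    · have h4 := h3.const_smul c
      rw [smul_zero] at h4
      exact h4

theorem graphPreEm_single (k : ℝ) (p : L2Pos × L2Pos) (hp : p ∈ graphPreEm k) (h0 : p.1 = 0) :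
    p.2 = 0 := by
  obtain ⟨F, F', h, hF, hh, hf, hg, -, -, -⟩ := hp
  have hF0 : F =ᵐ[posMeasure] 0 := by
    rw [h0] at hf
    exact hf.symm.trans (Lp.coeFn_zero _ _ _)
  have hz := eq_zero_of_ae_zero (fun x hx => (hF x hx).continuousAt.continuousWithinAt) hF0
  have hz' : ∀ x : ℝ, 0 < x → (x : ℂ) * F' x = 0 := by
    intro x hx
    have : F =ᶠ[𝓝 x] fun _ => (0 : ℂ) := by
      filter_upwards [Ioi_mem_nhds hx] with y hy using hz y hy
    rw [(hF x hx).unique ((hasDerivAt_const x (0 : ℂ)).congr_of_eventuallyEq this), mul_zero]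
  rw [Lp.eq_zero_iff_ae_eq_zero]
  filter_upwards [hg, hF0, hh.ae_zero hz'] with x h1 h2 h3
  rw [h1, h2, h3]
  simp

/-- The operator `-i (P Q P + k² Q⁻¹)` on its initial domain. -/
def preEm (k : ℝ) : L2Pos →ₗ.[ℂ] L2Pos := (graphPreEm k).toLinearPMap

theorem preEm_graph (k : ℝ) : (preEm k).graph = graphPreEm k :=
  Submodule.toLinearPMap_graph_eq _ (graphPreEm_single k)

/-- The Sonine (associated Laguerre) polynomial
`S_n^l(x) = ∑_{m=0}^n (-1)^m / (n-m)! * Γ(n+l+1) x^m / (Γ(m+l+1) m!)`. -/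
def sonine (n : ℕ) (l x : ℝ) : ℝ :=
  ∑ m ∈ Finset.range (n + 1), (-1) ^ m / ((n - m).factorial : ℝ) *
    (Real.Gamma (n + l + 1) * x ^ m / (Real.Gamma (m + l + 1) * (m.factorial : ℝ)))

/-- The normalised Laguerre function
`√(2^(2k+1) n! / Γ(n+2k+1)) e^(-x) x^k S_n^{2k}(2x)`. -/
def laguerreFun (k : ℝ) (n : ℕ) (x : ℝ) : ℝ :=
  Real.sqrt (2 ^ (2 * k + 1) * (n.factorial : ℝ) / Real.Gamma (n + 2 * k + 1)) *
    Real.exp (-x) * x ^ k * sonine n (2 * k) (2 * x)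

/-- The affine coherent state `√((2 Im η)^(2k+1) / Γ(2k+1)) x^k e^(iηx)`. -/
def affineCoherentState (k : ℝ) (η : ℂ) (x : ℝ) : ℂ :=
  (Real.sqrt ((2 * η.im) ^ (2 * k + 1) / Real.Gamma (2 * k + 1)) : ℂ) * ((x ^ k : ℝ) : ℂ) *
    Complex.exp (Complex.I * η * x)

end SU11

end

/-!
# Lowest weight representations of `su(1,1)` on `L²(ℝ⁺)`

In an orthonormal basis `b n` of weight vectors, with `L₀ (b n) = (λ + 2 n) b n` and
`L₊ (b n) = √((n + 1)(λ + n)) b (n + 1)` and `L₋` formally equal to `-L₊*`, each of the operators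
`E₀`, `E₊`, `E₋` is given by the tridiagonal matrix of a combination `α L₊ + β L₀ + conj α L₋` with
imaginary `β`. Such a matrix has entries of linear growth, and this decides all functional-analytic questions. Multiplying the expansion of a vector by
the cut-off weights `1 - n / N` commutes with the matrix up to an error which is bounded uniformly
in `N` and tends to zero on each basis vector, hence tends to zero strongly. So the finite
combinations of the `b n` are a core of the maximal operator of the matrix
(`exists_tendsto_of_ladder`). It follows that the maximal operator is skew-adjoint and that a closed
operator which contains the matrix and is formally skew-adjoint to it *is* the maximal operator
(`graph_eq_ladderGraph`).

A triple of maximal operators of this kind (`IsLadderTriple`) is therefore determined up to unitary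
equivalence by `λ`, and its representation-theoretic properties are computations with coefficients.
Moreover `i E₋ = (L₀ + L₊ - L₋) / 2` is nonnegative, first on finite combinations and then, by the
core property, on its domain (`form_nonneg`). Conversely, in an irreducible representation of
lowest-weight-type the orbit of a lowest weight vector under `L₊` is such a basis: the core property
holds on the closed span of an orthonormal sequence as well, so that this span reduces the three
operators and is the whole space (`IsLowestWeightIrrep.exists_ladderTriple`).

The operator `a` is the weighted backward shift `b (n + 1) ↦ √((n + 1) / (λ + n)) b n`. Its
eigenvalues lie in the open unit disc, because the coefficients of an eigenvector for `|z| ≥ 1` are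
not square summable, and its eigenspaces are at most one-dimensional
(`norm_lt_one_of_eigenvector`, `eigenvector_unique`). The operator `A` is the Cayley transform of
`a`, whose eigenvectors are those of `a` with the eigenvalue moved from the upper half-plane to the
disc (`cayley_eigenvector_iff`).

On `L²(ℝ⁺)` everything is expressed through the functions `x^k p(x) e^{iηx}` with `p` a polynomial
and `Im η > 0`. With `η = i` they contain the Laguerre functions, and `E₀`, `E₊` and `P Q P + k² Q⁻¹`
act on them through operations on `p`. To recognise the concrete operators as the maximal operators
of the matrices it suffices to integrate by parts against a *single* such function
(`inner_weightVec_graphE0`, `inner_weightVec_graphPreEm`), where the explicit decay of one factor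
controls the boundary terms. The Laguerre functions are complete because a function with exponential
decay is determined by its moments (`ae_eq_zero_of_moments`, `eq_zero_of_inner_weightVec`). Finally
`x^k e^{iηx}` solves `(L₀ - λ) / 2 = (η - i) / (η + i) L₊` (`exists_coherent_images`), so that it is
an eigenvector of `a` to `(η - i) / (η + i)` and of `A` to `η`.
-/

noncomputable section

namespace SU11

open MeasureTheory Filter Topology Set Asymptotics

/-! ### Graphs of partially defined operators -/

section Graphs

variable {H : Type*} [NormedAddCommGroup H] [InnerProductSpace ℂ H]

theorem mem_graph_iff_exists {E : H →ₗ.[ℂ] H} {x y : H} :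
    (x, y) ∈ E.graph ↔ ∃ hx : x ∈ E.domain, E ⟨x, hx⟩ = y := by
  rw [LinearPMap.mem_graph_iff]
  constructor
  · rintro ⟨z, hz, hy⟩
    dsimp only at hz hy
    subst hz
    exact ⟨z.2, hy⟩
  · rintro ⟨hx, hy⟩
    exact ⟨⟨x, hx⟩, rfl, hy⟩

theorem mem_graph_add {A B : H →ₗ.[ℂ] H} {x y : H} :
    (x, y) ∈ (A + B).graph ↔ ∃ a b, (x, a) ∈ A.graph ∧ (x, b) ∈ B.graph ∧ y = a + b := by
  constructor
  · intro h
    obtain ⟨hx, rfl⟩ := mem_graph_iff_exists.1 h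
    exact ⟨_, _, A.mem_graph ⟨x, hx.1⟩, B.mem_graph ⟨x, hx.2⟩, rfl⟩
  · rintro ⟨a, b, ha, hb, rfl⟩
    obtain ⟨hxa, rfl⟩ := mem_graph_iff_exists.1 ha
    obtain ⟨hxb, rfl⟩ := mem_graph_iff_exists.1 hb
    exact mem_graph_iff_exists.2 ⟨⟨hxa, hxb⟩, rfl⟩

theorem mem_graph_sub {A B : H →ₗ.[ℂ] H} {x y : H} :
    (x, y) ∈ (A - B).graph ↔ ∃ a b, (x, a) ∈ A.graph ∧ (x, b) ∈ B.graph ∧ y = a - b := by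
  constructor
  · intro h
    obtain ⟨hx, rfl⟩ := mem_graph_iff_exists.1 h
    exact ⟨_, _, A.mem_graph ⟨x, hx.1⟩, B.mem_graph ⟨x, hx.2⟩, rfl⟩
  · rintro ⟨a, b, ha, hb, rfl⟩
    obtain ⟨hxa, rfl⟩ := mem_graph_iff_exists.1 ha
    obtain ⟨hxb, rfl⟩ := mem_graph_iff_exists.1 hb
    exact mem_graph_iff_exists.2 ⟨⟨hxa, hxb⟩, rfl⟩

theorem mem_graph_smul {c : ℂ} {A : H →ₗ.[ℂ] H} {x y : H} :
    (x, y) ∈ (c • A).graph ↔ ∃ a, (x, a) ∈ A.graph ∧ y = c • a := by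
  constructor
  · intro h
    obtain ⟨hx, rfl⟩ := mem_graph_iff_exists.1 h
    exact ⟨_, A.mem_graph ⟨x, hx⟩, rfl⟩
  · rintro ⟨a, ha, rfl⟩
    obtain ⟨hxa, rfl⟩ := mem_graph_iff_exists.1 ha
    exact mem_graph_iff_exists.2 ⟨hxa, rfl⟩

theorem mem_graph_neg {A : H →ₗ.[ℂ] H} {x y : H} :
    (x, y) ∈ (-A).graph ↔ (x, -y) ∈ A.graph := by
  constructor
  · intro h
    obtain ⟨hx, rfl⟩ := mem_graph_iff_exists.1 h
    exact mem_graph_iff_exists.2 ⟨hx, by simp⟩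
  · intro h
    obtain ⟨hx, h⟩ := mem_graph_iff_exists.1 h
    exact mem_graph_iff_exists.2 ⟨hx, by simp [h]⟩

theorem graph_unique {E : H →ₗ.[ℂ] H} {x y z : H} (h : (x, y) ∈ E.graph) (h' : (x, z) ∈ E.graph) :
    y = z := E.mem_graph_snd_inj h h' rfl

theorem eq_of_graph_iff {A B : H →ₗ.[ℂ] H} (h : ∀ x y, (x, y) ∈ A.graph ↔ (x, y) ∈ B.graph) :
    A = B :=
  LinearPMap.eq_of_eq_graph (by ext ⟨x, y⟩; exact h x y)

theorem mem_kerOn {D : Submodule ℂ H} {T : H →ₗ.[ℂ] H} {x : H} :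
    x ∈ kerOn D T ↔ x ∈ D ∧ (x, 0) ∈ T.graph := by
  rw [kerOn, Submodule.mem_inf, mem_graph_iff_exists]
  refine and_congr_right fun _ => ?_
  constructor
  · rintro ⟨z, hz, rfl⟩
    exact ⟨z.2, hz⟩
  · rintro ⟨hx, h⟩
    exact ⟨⟨x, hx⟩, h, rfl⟩

/-- A densely defined operator is skew-adjoint exactly if its graph consists of all pairs which are
formally skew-adjoint to it. -/
theorem isSkewAdjoint_iff [CompleteSpace H] {E : H →ₗ.[ℂ] H} :
    IsSkewAdjoint E ↔ Dense (E.domain : Set H) ∧ ∀ x y, (x, y) ∈ E.graph ↔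
      ∀ u v, (u, v) ∈ E.graph → inner ℂ v x = -inner ℂ u y := by
  refine and_congr_right fun hd => ?_
  have key : ∀ x y, (x, y) ∈ E.adjoint.graph ↔
      ∀ u v, (u, v) ∈ E.graph → inner ℂ v x = inner ℂ u y := by
    intro x y
    rw [LinearPMap.adjoint_graph_eq_graph_adjoint hd, Submodule.mem_adjoint_iff]
    simp only [sub_eq_zero]
  constructor
  · intro h x y
    have h1 : (x, y) ∈ E.graph ↔ (x, -y) ∈ E.adjoint.graph := by
      rw [h, mem_graph_neg, neg_neg]
    rw [h1, key]
    simp only [inner_neg_right]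
  · intro h
    refine eq_of_graph_iff fun x y => ?_
    rw [key, mem_graph_neg, h]
    simp only [inner_neg_right, neg_neg]

/-- Multiplication by `i` turns a skew-adjoint operator into a self-adjoint one. -/
theorem IsSkewAdjoint.isSelfAdjoint_I_smul [CompleteSpace H] {E : H →ₗ.[ℂ] H}
    (h : IsSkewAdjoint E) : IsSelfAdjoint (Complex.I • E) := by
  obtain ⟨hd, h⟩ := isSkewAdjoint_iff.1 h
  rw [LinearPMap.isSelfAdjoint_def]
  refine eq_of_graph_iff fun x y => ?_
  rw [LinearPMap.adjoint_graph_eq_graph_adjoint (by exact hd), Submodule.mem_adjoint_iff,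
    mem_graph_smul]
  have h2 : (∃ a, (x, a) ∈ E.graph ∧ y = Complex.I • a) ↔ (x, -Complex.I • y) ∈ E.graph := by
    constructor
    · rintro ⟨a, ha, rfl⟩
      rwa [smul_smul, neg_mul, Complex.I_mul_I, neg_neg, one_smul]
    · intro hy
      exact ⟨_, hy, by rw [smul_smul, mul_neg, Complex.I_mul_I, neg_neg, one_smul]⟩
  rw [h2, h]
  constructor
  · intro hu u v huv
    have := hu u (Complex.I • v) (mem_graph_smul.2 ⟨v, huv, rfl⟩)
    rw [inner_smul_left, Complex.conj_I] at this
    rw [inner_smul_right]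
    linear_combination Complex.I * this + (inner ℂ v x) * Complex.I_mul_I
  · intro hu a b hab
    obtain ⟨v, hv, rfl⟩ := mem_graph_smul.1 hab
    have := hu a v hv
    rw [inner_smul_right] at this
    rw [inner_smul_left, Complex.conj_I, this]
    linear_combination (-inner ℂ a y) * Complex.I_mul_I

theorem IsSkewAdjoint.graph_closed [CompleteSpace H] {E : H →ₗ.[ℂ] H} (h : IsSkewAdjoint E)
    {u v : ℕ → H} {x y : H} (hm : ∀ n, (u n, v n) ∈ E.graph) (hu : Tendsto u atTop (𝓝 x))
    (hv : Tendsto v atTop (𝓝 y)) : (x, y) ∈ E.graph := by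
  obtain ⟨-, h⟩ := isSkewAdjoint_iff.1 h
  rw [h]
  intro p q hpq
  have h1 : Tendsto (fun n => inner ℂ q (u n)) atTop (𝓝 (inner ℂ q x)) :=
    tendsto_const_nhds.inner hu
  have h2 : Tendsto (fun n => -inner ℂ p (v n)) atTop (𝓝 (-inner ℂ p y)) :=
    (tendsto_const_nhds.inner hv).neg
  refine tendsto_nhds_unique h1 (h2.congr fun n => ?_)
  exact ((h _ _).1 (hm n) p q hpq).symm

theorem IsSkewAdjoint.inner_skew [CompleteSpace H] {E : H →ₗ.[ℂ] H} (h : IsSkewAdjoint E)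
    {u v x y : H} (huv : (u, v) ∈ E.graph) (hxy : (x, y) ∈ E.graph) :
    inner ℂ v x = -inner ℂ u y :=
  ((isSkewAdjoint_iff.1 h).2 x y).1 hxy u v huv

/-- The space of smooth vectors is itself invariant under the three operators. -/
theorem smoothDomain_invariant {E0 Ep Em E : H →ₗ.[ℂ] H}
    (hE : E ∈ ({E0, Ep, Em} : Set (H →ₗ.[ℂ] H))) {x : H} (hx : x ∈ smoothDomain E0 Ep Em) :
    ∃ y ∈ smoothDomain E0 Ep Em, (x, y) ∈ E.graph := by
  have key : smoothDomain E0 Ep Em ≤ Submodule.map (LinearMap.fst ℂ H H)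
      (E.graph ⊓ Submodule.comap (LinearMap.snd ℂ H H) (smoothDomain E0 Ep Em)) := by
    refine sSup_le fun D hD x hx => ?_
    obtain ⟨y, hy, h⟩ := hD E hE x hx
    exact ⟨(x, y), ⟨h, le_sSup (a := D) hD hy⟩, rfl⟩
  obtain ⟨⟨x', y⟩, ⟨h, hy⟩, rfl⟩ := key hx
  exact ⟨y, hy, h⟩

theorem le_smoothDomain {E0 Ep Em : H →ₗ.[ℂ] H} {D : Submodule ℂ H}
    (h0 : ∀ x ∈ D, ∃ y ∈ D, (x, y) ∈ E0.graph) (hp : ∀ x ∈ D, ∃ y ∈ D, (x, y) ∈ Ep.graph)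
    (hm : ∀ x ∈ D, ∃ y ∈ D, (x, y) ∈ Em.graph) : D ≤ smoothDomain E0 Ep Em := by
  refine le_sSup ?_
  rintro E (rfl | rfl | rfl)
  exacts [h0, hp, hm]

end Graphs

/-! ### Ladder operators on an orthonormal sequence -/

/-- The matrix element `√(n (lam + n - 1))` of `L₊` between the weight vectors `n - 1` and `n`. -/
def ladderWeight (lam : ℝ) (n : ℕ) : ℝ := Real.sqrt (n * (lam + n - 1))

@[simp] theorem ladderWeight_zero (lam : ℝ) : ladderWeight lam 0 = 0 := by simp [ladderWeight]

theorem ladderWeight_succ (lam : ℝ) (n : ℕ) :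
    ladderWeight lam (n + 1) = Real.sqrt ((n + 1) * (lam + n)) := by
  rw [ladderWeight]
  push_cast
  congr 1
  ring

theorem ladderWeight_succ_pos {lam : ℝ} (hl : 0 < lam) (n : ℕ) : 0 < ladderWeight lam (n + 1) := by
  rw [ladderWeight_succ]
  positivity

theorem ladderWeight_succ_sq {lam : ℝ} (hl : 0 < lam) (n : ℕ) :
    ladderWeight lam (n + 1) ^ 2 = (n + 1) * (lam + n) := by
  rw [ladderWeight_succ, Real.sq_sqrt (by positivity)]

theorem ladderWeight_sq {lam : ℝ} (hl : 0 < lam) (n : ℕ) :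
    ladderWeight lam n ^ 2 = n * (lam + n - 1) := by
  cases n with
  | zero => simp
  | succ n =>
    rw [ladderWeight_succ_sq hl]
    push_cast
    ring

theorem ladderWeight_succ_le {lam : ℝ} (hl : 0 < lam) (n : ℕ) :
    ladderWeight lam (n + 1) ≤ (1 + lam) * (n + 1) := by
  rw [ladderWeight_succ]
  refine Real.sqrt_le_iff.2 ⟨by positivity, ?_⟩
  have hn : (0 : ℝ) ≤ n := n.cast_nonneg
  have h1 : lam + n ≤ (1 + lam) ^ 2 * (n + 1) := by nlinarith [mul_nonneg hl.le hn]
  nlinarith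

/-- The action on coefficient sequences of the operator `α L₊ + β L₀ + conj α L₋`, which is
formally skew-symmetric when `β` is imaginary. -/
def ladderCoeff (lam : ℝ) (α β : ℂ) (c : ℕ → ℂ) (m : ℕ) : ℂ :=
  α * ladderWeight lam m * c (m - 1) + β * (lam + 2 * m) * c m -
    (starRingEnd ℂ) α * ladderWeight lam (m + 1) * c (m + 1)

section Ladder

variable {H : Type*} [NormedAddCommGroup H] [InnerProductSpace ℂ H]

/-- The image of the weight vector `b n` under `α L₊ + β L₀ + conj α L₋`. -/
def ladderVec (b : ℕ → H) (lam : ℝ) (α β : ℂ) (n : ℕ) : H :=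
  (α * ladderWeight lam (n + 1)) • b (n + 1) + (β * (lam + 2 * n)) • b n -
    ((starRingEnd ℂ) α * ladderWeight lam n) • b (n - 1)

theorem inner_ladderVec_left (b : ℕ → H) (lam : ℝ) {α β : ℂ} (hβ : (starRingEnd ℂ) β = -β) (n : ℕ)
    (x : H) : inner ℂ (ladderVec b lam α β n) x =
      -ladderCoeff lam α β (fun m => inner ℂ (b m) x) n := by
  simp only [ladderVec, ladderCoeff, inner_sub_left, inner_add_left, inner_smul_left, map_mul,
    map_add, Complex.conj_ofReal, Complex.conj_conj, hβ, map_ofNat, map_natCast]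
  ring

theorem ladderVec_mem_span (b : ℕ → H) (lam : ℝ) (α β : ℂ) (n : ℕ) :
    ladderVec b lam α β n ∈ Submodule.span ℂ (range b) := by
  have h : ∀ m, b m ∈ Submodule.span ℂ (range b) := fun m => Submodule.subset_span ⟨m, rfl⟩
  exact Submodule.sub_mem _ (Submodule.add_mem _ (Submodule.smul_mem _ _ (h _))
    (Submodule.smul_mem _ _ (h _))) (Submodule.smul_mem _ _ (h _))

/-- Weighted partial expansions tend to zero if the weights are bounded and tend to zero
pointwise. -/
theorem tendsto_sum_orthonormal_zero {b : ℕ → H} (hb : Orthonormal ℂ b) {σ τ : ℕ → ℕ}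
    (hσ : Function.Injective σ) (hτ : Function.Injective τ) (x : H) {c : ℕ → ℕ → ℂ} {C : ℝ}
    (hC : ∀ N n, n < N → ‖c N n‖ ≤ C) (hc : ∀ n, Tendsto (fun N => c N n) atTop (𝓝 0)) :
    Tendsto (fun N => ∑ n ∈ Finset.range N, (c N n * inner ℂ (b (τ n)) x) • b (σ n)) atTop
      (𝓝 0) := by
  have hsq : ∀ N, ‖∑ n ∈ Finset.range N, (c N n * inner ℂ (b (τ n)) x) • b (σ n)‖ ^ 2 =
      ∑' n, (if n < N then ‖c N n * inner ℂ (b (τ n)) x‖ ^ 2 else 0) := by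
    intro N
    rw [tsum_eq_sum (s := Finset.range N)
      (fun n hn => if_neg (fun h => hn (Finset.mem_range.2 h)))]
    have h := (hb.comp σ hσ).inner_sum (fun n => c N n * inner ℂ (b (τ n)) x)
      (fun n => c N n * inner ℂ (b (τ n)) x) (Finset.range N)
    simp only [Function.comp_apply] at h
    have h2 : ((‖∑ n ∈ Finset.range N, (c N n * inner ℂ (b (τ n)) x) • b (σ n)‖ ^ 2 : ℝ) : ℂ) =
        ((∑ n ∈ Finset.range N, ‖c N n * inner ℂ (b (τ n)) x‖ ^ 2 : ℝ) : ℂ) := by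
      have h3 := inner_self_eq_norm_sq_to_K (𝕜 := ℂ)
        (∑ n ∈ Finset.range N, (c N n * inner ℂ (b (τ n)) x) • b (σ n))
      rw [h] at h3
      push_cast
      refine Eq.trans h3.symm ?_
      refine Finset.sum_congr rfl fun n _ => ?_
      rw [mul_comm, Complex.mul_conj']
    rw [Complex.ofReal_inj.1 h2]
    exact Finset.sum_congr rfl fun n hn => (if_pos (Finset.mem_range.1 hn)).symm
  have hsum : Summable fun n => C ^ 2 * ‖inner ℂ (b (τ n)) x‖ ^ 2 :=
    ((hb.comp τ hτ).inner_products_summable (x := x)).mul_left _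
  have hlim : Tendsto (fun N => ∑' n, (if n < N then ‖c N n * inner ℂ (b (τ n)) x‖ ^ 2 else 0))
      atTop (𝓝 (∑' _ : ℕ, (0 : ℝ))) := by
    refine tendsto_tsum_of_dominated_convergence hsum (fun n => ?_)
      (Eventually.of_forall fun N n => ?_)
    · have h1 : Tendsto (fun N => ‖c N n * inner ℂ (b (τ n)) x‖ ^ 2) atTop (𝓝 0) := by
        have := (((hc n).mul_const (inner ℂ (b (τ n)) x)).norm).pow 2
        simpa using this
      refine h1.congr' ?_
      filter_upwards [eventually_gt_atTop n] with N hN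
      rw [if_pos hN]
    · split_ifs with h
      · rw [norm_mul, mul_pow, Real.norm_of_nonneg (by positivity)]
        have := hC N n h
        gcongr
      · rw [norm_zero]
        positivity
  rw [tsum_zero] at hlim
  rw [tendsto_zero_iff_norm_tendsto_zero]
  have h4 := (hlim.congr fun N => (hsq N).symm).sqrt
  rw [Real.sqrt_zero] at h4
  exact h4.congr fun N => Real.sqrt_sq (norm_nonneg _)

variable [CompleteSpace H]

theorem tendsto_partialSum_starProjection {b : ℕ → H} (hb : Orthonormal ℂ b) (x : H) :
    Tendsto (fun N => ∑ n ∈ Finset.range N, inner ℂ (b n) x • b n) atTop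
      (𝓝 ((Submodule.span ℂ (range b)).topologicalClosure.starProjection x)) := by
  have hlp : Memℓp (fun n => inner ℂ (b n) x) 2 := by
    refine memℓp_gen ?_
    have := hb.inner_products_summable (x := x)
    simpa using this
  have hs : Summable fun n => inner ℂ (b n) x • b n := by
    have := hb.orthogonalFamily.summable_of_lp ⟨_, hlp⟩
    simpa using this
  have h1 := hs.hasSum.tendsto_sum_nat
  have hK : (∑' n, inner ℂ (b n) x • b n) ∈ (Submodule.span ℂ (range b)).topologicalClosure := by
    refine (Submodule.isClosed_topologicalClosure _).mem_of_tendsto h1 (Eventually.of_forall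
      fun N => Submodule.le_topologicalClosure _ (Submodule.sum_mem _ fun n _ =>
        Submodule.smul_mem _ _ (Submodule.subset_span ⟨n, rfl⟩)))
  have horth : x - (∑' n, inner ℂ (b n) x • b n) ∈
      (Submodule.span ℂ (range b)).topologicalClosureᗮ := by
    rw [Submodule.orthogonal_closure, Submodule.mem_orthogonal]
    intro u hu
    refine Submodule.span_induction ?_ (by simp) ?_ ?_ hu
    · rintro _ ⟨m, rfl⟩
      have h2 : HasSum (fun n => inner ℂ (b m) (inner ℂ (b n) x • b n))
          (inner ℂ (b m) (∑' n, inner ℂ (b n) x • b n)) :=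
        hs.hasSum.mapL (innerSL ℂ (b m))
      have h3 := hasSum_single (f := fun n => inner ℂ (b m) (inner ℂ (b n) x • b n)) m
        (fun n hn => by rw [inner_smul_right, hb.2 hn.symm, mul_zero])
      rw [inner_sub_right, h2.unique h3, inner_smul_right, inner_self_eq_norm_sq_to_K, hb.1 m]
      simp
    · intro u v _ _ hu hv
      rw [inner_add_left, hu, hv, add_zero]
    · intro c u _ hu
      rw [inner_smul_left, hu, mul_zero]
  rw [Submodule.eq_starProjection_of_mem_orthogonal hK horth]
  exact h1

/-- Cutting off the expansion of `x` with the weights `1 - n / N` commutes with a tridiagonal matrix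
of linear growth up to an error of order one that tends strongly to zero. Therefore each pair of
vectors related by the matrix, after projection to the closed span of the orthonormal sequence, is a
limit of pairs of finite linear combinations. -/
theorem exists_tendsto_of_ladder {b : ℕ → H} (hb : Orthonormal ℂ b) {lam : ℝ} (hl : 0 < lam)
    {α β : ℂ} {G : Submodule ℂ (H × H)} (hG : ∀ n, (b n, ladderVec b lam α β n) ∈ G) {x y : H}
    (hxy : ∀ m, inner ℂ (b m) y = ladderCoeff lam α β (fun m => inner ℂ (b m) x) m) :
    ∃ u v : ℕ → H, (∀ N, u N ∈ Submodule.span ℂ (range b)) ∧ (∀ N, (u N, v N) ∈ G) ∧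
      Tendsto u atTop (𝓝 ((Submodule.span ℂ (range b)).topologicalClosure.starProjection x)) ∧
      Tendsto v atTop (𝓝 ((Submodule.span ℂ (range b)).topologicalClosure.starProjection y)) := by
  -- the cut-off expansions converge, as the weights `n / N` are bounded and tend to zero pointwise
  have hcut : ∀ z : H, Tendsto (fun N : ℕ => ∑ n ∈ Finset.range N,
      ((1 - n / N : ℂ) * inner ℂ (b n) z) • b n) atTop
      (𝓝 ((Submodule.span ℂ (range b)).topologicalClosure.starProjection z)) := by
    intro z
    have h1 := tendsto_sum_orthonormal_zero hb (σ := id) (τ := id) Function.injective_id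
      Function.injective_id z (c := fun N n => -(n / N : ℂ)) (C := 1) (fun N n hn => ?_) (fun n => ?_)
    · have h2 := (tendsto_partialSum_starProjection hb z).add h1
      rw [add_zero] at h2
      refine h2.congr fun N => ?_
      rw [← Finset.sum_add_distrib]
      refine Finset.sum_congr rfl fun n _ => ?_
      simp only [id]
      module
    · have hN : (0 : ℝ) < N := by exact_mod_cast (Nat.zero_le n).trans_lt hn
      rw [norm_neg, norm_div, Complex.norm_natCast, Complex.norm_natCast, div_le_one hN]
      exact_mod_cast hn.le
    · have h3 := (tendsto_const_div_atTop_nhds_zero_nat (n : ℝ)).ofReal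
      have h4 := h3.neg
      simp only [Complex.ofReal_zero, neg_zero] at h4
      refine h4.congr fun N => ?_
      simp
  -- the two off-diagonal parts of the commutator with the cut-off have the matrix elements
  -- `w (n + 1) / N`, which are bounded for `n < N` because `w` grows linearly
  have herr : ∀ {σ τ : ℕ → ℕ}, Function.Injective σ → Function.Injective τ →
      Tendsto (fun N : ℕ => ∑ n ∈ Finset.range N,
      ((ladderWeight lam (n + 1) / N : ℂ) * inner ℂ (b (τ n)) x) • b (σ n)) atTop (𝓝 0) := by
    intro σ τ hσ hτ
    refine tendsto_sum_orthonormal_zero hb hσ hτ x (C := 1 + lam) (fun N n hn => ?_) (fun n => ?_)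
    · have hN : (0 : ℝ) < N := by exact_mod_cast (Nat.zero_le n).trans_lt hn
      rw [norm_div, Complex.norm_natCast, Complex.norm_real,
        Real.norm_of_nonneg (ladderWeight_succ_pos hl n).le, div_le_iff₀ hN]
      refine (ladderWeight_succ_le hl n).trans ?_
      have : ((n : ℝ) + 1) ≤ N := by exact_mod_cast hn
      gcongr
    · have h3 := (tendsto_const_div_atTop_nhds_zero_nat (ladderWeight lam (n + 1))).ofReal
      simp only [Complex.ofReal_zero] at h3
      refine h3.congr fun N => ?_
      simp
  refine ⟨fun N => ∑ n ∈ Finset.range N, ((1 - n / N : ℂ) * inner ℂ (b n) x) • b n,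
    fun N => ∑ n ∈ Finset.range N, ((1 - n / N : ℂ) * inner ℂ (b n) x) • ladderVec b lam α β n,
    fun N => Submodule.sum_mem _ fun n _ => Submodule.smul_mem _ _ (Submodule.subset_span ⟨n, rfl⟩),
    fun N => ?_, hcut x, ?_⟩
  · have h := Submodule.sum_mem G (t := Finset.range N) fun n _ =>
      G.smul_mem ((1 - n / N : ℂ) * inner ℂ (b n) x) (hG n)
    convert h using 1
    ext
    · simp [Prod.fst_sum]
    · simp [Prod.snd_sum]
  · have h1 := ((hcut y).add ((herr (add_left_injective 1) Function.injective_id).const_smul α)).add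
      ((herr Function.injective_id (add_left_injective 1)).const_smul ((starRingEnd ℂ) α))
    rw [smul_zero, smul_zero, add_zero, add_zero] at h1
    refine h1.congr' ?_
    filter_upwards [eventually_gt_atTop 0] with N hN
    have hN' : (N : ℂ) ≠ 0 := by exact_mod_cast hN.ne'
    -- no boundary terms arise: `w 0 = 0`, and the cut-off vanishes at `n = N`
    have shift : ∀ g : ℕ → H, g 0 = 0 → g N = 0 →
        ∑ n ∈ Finset.range N, g n = ∑ n ∈ Finset.range N, g (n + 1) := by
      intro g h0 hN0
      have e1 := Finset.sum_range_succ g N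
      rw [Finset.sum_range_succ', h0, hN0, add_zero, add_zero] at e1
      exact e1.symm
    have s1 := shift (fun n => ((1 - n / N : ℂ) * (α * ladderWeight lam n *
      inner ℂ (b (n - 1)) x)) • b n) (by simp) (by simp [hN'])
    have s2 := shift (fun n => ((1 - n / N : ℂ) * inner ℂ (b n) x *
      ((starRingEnd ℂ) α * ladderWeight lam n)) • b (n - 1)) (by simp) (by simp [hN'])
    simp only [Nat.add_sub_cancel, Nat.cast_add, Nat.cast_one] at s1 s2
    have e1 : ∑ n ∈ Finset.range N, ((1 - n / N : ℂ) * inner ℂ (b n) y) • b n =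
        ∑ n ∈ Finset.range N, ((1 - n / N : ℂ) * (α * ladderWeight lam n *
          inner ℂ (b (n - 1)) x)) • b n +
        ∑ n ∈ Finset.range N, ((1 - n / N : ℂ) * (β * (lam + 2 * n) * inner ℂ (b n) x -
          (starRingEnd ℂ) α * ladderWeight lam (n + 1) * inner ℂ (b (n + 1)) x)) • b n := by
      rw [← Finset.sum_add_distrib]
      refine Finset.sum_congr rfl fun n _ => ?_
      rw [hxy, ladderCoeff]
      module
    have e2 : ∑ n ∈ Finset.range N, ((1 - n / N : ℂ) * inner ℂ (b n) x) • ladderVec b lam α β n =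
        ∑ n ∈ Finset.range N, ((1 - n / N : ℂ) * inner ℂ (b n) x) •
          ((α * ladderWeight lam (n + 1)) • b (n + 1) + (β * (lam + 2 * n)) • b n) -
        ∑ n ∈ Finset.range N, ((1 - n / N : ℂ) * inner ℂ (b n) x *
          ((starRingEnd ℂ) α * ladderWeight lam n)) • b (n - 1) := by
      rw [← Finset.sum_sub_distrib]
      refine Finset.sum_congr rfl fun n _ => ?_
      rw [ladderVec]
      module
    rw [e1, e2, s1, s2, Finset.smul_sum, Finset.smul_sum, ← Finset.sum_add_distrib,
      ← Finset.sum_add_distrib, ← Finset.sum_add_distrib, ← Finset.sum_sub_distrib]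
    refine Finset.sum_congr rfl fun n _ => ?_
    simp only [id]
    module

end Ladder

/-! ### Skew-adjointness of the ladder operators -/

section LadderGraph

variable {H : Type*} [NormedAddCommGroup H] [InnerProductSpace ℂ H]

theorem ladderCoeff_add (lam : ℝ) (α β : ℂ) (c d : ℕ → ℂ) (m : ℕ) :
    ladderCoeff lam α β (fun n => c n + d n) m =
      ladderCoeff lam α β c m + ladderCoeff lam α β d m := by
  simp only [ladderCoeff]
  ring

theorem ladderCoeff_mul (lam : ℝ) (α β : ℂ) (a : ℂ) (c : ℕ → ℂ) (m : ℕ) :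
    ladderCoeff lam α β (fun n => a * c n) m = a * ladderCoeff lam α β c m := by
  simp only [ladderCoeff]
  ring

/-- All pairs of vectors related by the tridiagonal matrix of `α L₊ + β L₀ + conj α L₋` in the
Hilbert basis `b`: the graph of the maximal operator with this matrix. -/
def ladderGraph (b : HilbertBasis ℕ ℂ H) (lam : ℝ) (α β : ℂ) : Submodule ℂ (H × H) where
  carrier := {p | ∀ m, inner ℂ (b m) p.2 = ladderCoeff lam α β (fun n => inner ℂ (b n) p.1) m}
  zero_mem' m := by simp [ladderCoeff]
  add_mem' := by
    intro p q hp hq m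
    simp only [Prod.fst_add, Prod.snd_add, inner_add_right, ladderCoeff_add, hp m, hq m]
  smul_mem' := by
    intro c p hp m
    simp only [Prod.smul_fst, Prod.smul_snd, inner_smul_right, ladderCoeff_mul, hp m]

theorem mem_ladderGraph {b : HilbertBasis ℕ ℂ H} {lam : ℝ} {α β : ℂ} {x y : H} :
    (x, y) ∈ ladderGraph b lam α β ↔
      ∀ m, inner ℂ (b m) y = ladderCoeff lam α β (fun n => inner ℂ (b n) x) m := Iff.rfl

theorem ext_basis (b : HilbertBasis ℕ ℂ H) {x y : H} (h : ∀ m, inner ℂ (b m) x = inner ℂ (b m) y) :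
    x = y := by
  refine b.repr.injective ?_
  ext m
  rw [b.repr_apply_apply, b.repr_apply_apply, h]

theorem inner_basis (b : HilbertBasis ℕ ℂ H) (m n : ℕ) :
    inner ℂ (b m) (b n) = if m = n then (1 : ℂ) else 0 :=
  orthonormal_iff_ite.1 b.orthonormal m n

theorem ladderVec_mem (b : HilbertBasis ℕ ℂ H) (lam : ℝ) (α β : ℂ) (n : ℕ) :
    (b n, ladderVec b lam α β n) ∈ ladderGraph b lam α β := by
  intro m
  simp only [ladderVec, ladderCoeff, inner_sub_right, inner_add_right, inner_smul_right,
    inner_basis]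
  rcases lt_trichotomy m n with h | rfl | h
  · have h1 : m ≠ n + 1 := by omega
    have h2 : m - 1 ≠ n := by omega
    by_cases h3 : n = m + 1
    · subst h3
      simp [h1, h2]
    · have h4 : m ≠ n - 1 := by omega
      simp [h1, h2, h4, h.ne, Ne.symm h3]
  · have h1 : m ≠ m + 1 := by omega
    cases m with
    | zero => simp
    | succ m => simp
  · have h1 : m ≠ n - 1 := by omega
    have h2 : m + 1 ≠ n := by omega
    by_cases h3 : m = n + 1
    · subst h3
      simp [h1, h2]
    · have h4 : m - 1 ≠ n := by omega
      simp [h1, h2, h3, h4, h.ne']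

/-- The maximal operator with the tridiagonal matrix of `α L₊ + β L₀ + conj α L₋`. -/
def ladderOp (b : HilbertBasis ℕ ℂ H) (lam : ℝ) (α β : ℂ) : H →ₗ.[ℂ] H :=
  (ladderGraph b lam α β).toLinearPMap

theorem ladderOp_graph (b : HilbertBasis ℕ ℂ H) (lam : ℝ) (α β : ℂ) :
    (ladderOp b lam α β).graph = ladderGraph b lam α β := by
  refine Submodule.toLinearPMap_graph_eq _ ?_
  rintro ⟨x, y⟩ h h0
  refine ext_basis b fun m => ?_
  dsimp only at h0 ⊢
  rw [mem_ladderGraph.1 h m, h0]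
  simp [ladderCoeff]

/-- The bounded weighted backward shift `b (m + 1) ↦ s m • b m`. -/
theorem exists_shiftDown (b : HilbertBasis ℕ ℂ H) (s : ℕ → ℂ) {C : ℝ} (hC : ∀ m, ‖s m‖ ≤ C) :
    ∃ A : H →L[ℂ] H, ∀ x m, inner ℂ (b m) (A x) = s m * inner ℂ (b (m + 1)) x := by
  have hC0 : 0 ≤ C := (norm_nonneg _).trans (hC 0)
  have hb := b.orthonormal.comp _ (add_left_injective 1)
  have hle : ∀ x m, ‖s m * inner ℂ (b (m + 1)) x‖ ^ 2 ≤ C ^ 2 * ‖inner ℂ (b (m + 1)) x‖ ^ 2 := by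
    intro x m
    rw [norm_mul, mul_pow]
    have := hC m
    gcongr
  have hs2 : ∀ x, Summable fun m => C ^ 2 * ‖inner ℂ (b (m + 1)) x‖ ^ 2 := fun x =>
    (hb.inner_products_summable (x := x)).mul_left _
  have hs1 : ∀ x, Summable fun m => ‖s m * inner ℂ (b (m + 1)) x‖ ^ 2 := fun x =>
    (hs2 x).of_nonneg_of_le (fun m => by positivity) (hle x)
  have hmem : ∀ x, Memℓp (fun m => s m * inner ℂ (b (m + 1)) x) 2 := by
    intro x
    refine memℓp_gen ?_
    simpa using hs1 x
  let A : H →ₗ[ℂ] H :=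
    { toFun x := b.repr.symm ⟨_, hmem x⟩
      map_add' x y := by
        rw [← map_add]
        refine congrArg _ (Subtype.ext (funext fun m => ?_))
        change s m * _ = s m * _ + s m * _
        rw [inner_add_right, mul_add]
      map_smul' c x := by
        rw [RingHom.id_apply, ← map_smul]
        refine congrArg _ (Subtype.ext (funext fun m => ?_))
        change s m * _ = c * (s m * _)
        rw [inner_smul_right, mul_left_comm] }
  refine ⟨A.mkContinuous C fun x => ?_, fun x m => ?_⟩
  · have h1 : ‖A x‖ ^ 2 ≤ (C * ‖x‖) ^ 2 := by
      have h2 : ‖A x‖ ^ 2 = ∑' m, ‖s m * inner ℂ (b (m + 1)) x‖ ^ 2 := by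
        change ‖b.repr.symm ⟨_, hmem x⟩‖ ^ 2 = _
        rw [LinearIsometryEquiv.norm_map]
        have := lp.norm_rpow_eq_tsum (p := 2) (by norm_num)
          (⟨_, hmem x⟩ : lp (fun _ : ℕ => ℂ) 2)
        simpa using this
      rw [h2, mul_pow]
      calc ∑' m, ‖s m * inner ℂ (b (m + 1)) x‖ ^ 2
          ≤ ∑' m, C ^ 2 * ‖inner ℂ (b (m + 1)) x‖ ^ 2 := (hs1 x).tsum_le_tsum (hle x) (hs2 x)
        _ = C ^ 2 * ∑' m, ‖inner ℂ (b (m + 1)) x‖ ^ 2 := tsum_mul_left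
        _ ≤ C ^ 2 * ‖x‖ ^ 2 := by
          have := hb.tsum_inner_products_le (x := x)
          simp only [Function.comp_apply] at this
          gcongr
    exact (pow_le_pow_iff_left₀ (norm_nonneg _) (by positivity) two_ne_zero).1 h1
  · change inner ℂ (b m) (b.repr.symm ⟨_, hmem x⟩) = _
    rw [← b.repr_apply_apply, LinearIsometryEquiv.apply_symm_apply]

variable [CompleteSpace H]

theorem starProjection_basis (b : HilbertBasis ℕ ℂ H) (x : H) :
    (Submodule.span ℂ (range b)).topologicalClosure.starProjection x = x := by
  have h : (Submodule.span ℂ (range b)).topologicalClosure = ⊤ := b.dense_span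
  rw [Submodule.starProjection_eq_self_iff, h]
  trivial

/-- The finite linear combinations of the basis vectors are a core of the maximal operator. -/
theorem ladderGraph_core (b : HilbertBasis ℕ ℂ H) {lam : ℝ} (hl : 0 < lam) {α β : ℂ}
    {G : Submodule ℂ (H × H)} (hG : ∀ n, (b n, ladderVec b lam α β n) ∈ G) {x y : H}
    (hxy : (x, y) ∈ ladderGraph b lam α β) :
    ∃ u v : ℕ → H, (∀ N, u N ∈ Submodule.span ℂ (range b)) ∧ (∀ N, (u N, v N) ∈ G) ∧
      Tendsto u atTop (𝓝 x) ∧ Tendsto v atTop (𝓝 y) := by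
  have h := exists_tendsto_of_ladder b.orthonormal hl hG hxy
  rwa [starProjection_basis, starProjection_basis] at h

theorem ladderGraph_skew (b : HilbertBasis ℕ ℂ H) {lam : ℝ} (hl : 0 < lam) {α β : ℂ}
    (hβ : (starRingEnd ℂ) β = -β) {u v x y : H} (huv : (u, v) ∈ ladderGraph b lam α β)
    (hxy : (x, y) ∈ ladderGraph b lam α β) : inner ℂ v x = -inner ℂ u y := by
  obtain ⟨p, q, -, hpq, hp, hq⟩ := ladderGraph_core b hl
    (G := Submodule.span ℂ (range fun n => (b n, ladderVec b lam α β n)))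
    (fun n => Submodule.subset_span ⟨n, rfl⟩) huv
  have key : ∀ r ∈ Submodule.span ℂ (range fun n => (b n, ladderVec b lam α β n)),
      inner ℂ r.2 x = -inner ℂ r.1 y := by
    intro r hr
    refine Submodule.span_induction ?_ (by simp) ?_ ?_ hr
    · rintro _ ⟨n, rfl⟩
      rw [inner_ladderVec_left b lam hβ, mem_ladderGraph.1 hxy n]
    · intro r s _ _ h1 h2
      rw [Prod.snd_add, Prod.fst_add, inner_add_left, inner_add_left, h1, h2]
      ring
    · intro c r _ h1
      rw [Prod.smul_snd, Prod.smul_fst, inner_smul_left, inner_smul_left, h1]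
      ring
  have h1 : Tendsto (fun n => inner ℂ (q n) x) atTop (𝓝 (inner ℂ v x)) :=
    hq.inner tendsto_const_nhds
  have h2 : Tendsto (fun n => -inner ℂ (p n) y) atTop (𝓝 (-inner ℂ u y)) :=
    (hp.inner tendsto_const_nhds).neg
  exact tendsto_nhds_unique h1 (h2.congr fun n => (key _ (hpq n)).symm)

/-- A closed operator that is formally skew-adjoint to the tridiagonal matrix on the basis vectors
and extends it there is the maximal operator of the matrix. -/
theorem graph_eq_ladderGraph (b : HilbertBasis ℕ ℂ H) {lam : ℝ} (hl : 0 < lam) {α β : ℂ}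
    (hβ : (starRingEnd ℂ) β = -β) {G : Submodule ℂ (H × H)}
    (hG : ∀ n, (b n, ladderVec b lam α β n) ∈ G)
    (hskew : ∀ n x y, (x, y) ∈ G → inner ℂ (ladderVec b lam α β n) x = -inner ℂ (b n) y)
    (hclosed : ∀ (u v : ℕ → H) (x y : H), (∀ n, (u n, v n) ∈ G) → Tendsto u atTop (𝓝 x) →
      Tendsto v atTop (𝓝 y) → (x, y) ∈ G) : G = ladderGraph b lam α β := by
  ext ⟨x, y⟩
  constructor
  · intro h m
    have := hskew m x y h
    rw [inner_ladderVec_left b lam hβ] at this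
    exact (neg_injective this).symm
  · intro h
    obtain ⟨u, v, -, huv, hu, hv⟩ := ladderGraph_core b hl hG h
    exact hclosed u v x y huv hu hv

theorem isSkewAdjoint_of_graph (b : HilbertBasis ℕ ℂ H) {lam : ℝ} (hl : 0 < lam) {α β : ℂ}
    (hβ : (starRingEnd ℂ) β = -β) {E : H →ₗ.[ℂ] H} (hE : E.graph = ladderGraph b lam α β) :
    IsSkewAdjoint E := by
  rw [isSkewAdjoint_iff]
  constructor
  · have h : Submodule.span ℂ (range b) ≤ E.domain := by
      rw [Submodule.span_le]
      rintro _ ⟨n, rfl⟩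
      refine LinearPMap.mem_domain_of_mem_graph (y := ladderVec b lam α β n) ?_
      rw [hE]
      exact ladderVec_mem b lam α β n
    refine Dense.mono h ?_
    rw [dense_iff_closure_eq, ← Submodule.topologicalClosure_coe, b.dense_span]
    rfl
  · intro x y
    rw [hE]
    constructor
    · intro h u v huv
      exact ladderGraph_skew b hl hβ huv h
    · intro h m
      have := h _ _ (ladderVec_mem b lam α β m)
      rw [inner_ladderVec_left b lam hβ] at this
      exact (neg_injective this).symm

/-- The bounded weighted forward shift `b m ↦ s m • b (m + 1)`. -/
theorem exists_shiftUp (b : HilbertBasis ℕ ℂ H) (s : ℕ → ℂ) {C : ℝ} (hC : ∀ m, ‖s m‖ ≤ C) :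
    ∃ A : H →L[ℂ] H, (∀ x, inner ℂ (b 0) (A x) = 0) ∧
      ∀ x m, inner ℂ (b (m + 1)) (A x) = s m * inner ℂ (b m) x := by
  obtain ⟨B, hB⟩ := exists_shiftDown b (fun m => (starRingEnd ℂ) (s m)) (C := C) (by simpa using hC)
  refine ⟨B.adjoint, fun x => ?_, fun x m => ?_⟩
  · have h : B (b 0) = 0 := ext_basis b fun m => by simp [hB, inner_basis]
    rw [ContinuousLinearMap.adjoint_inner_right, h, inner_zero_left]
  · have h : B (b (m + 1)) = (starRingEnd ℂ) (s m) • b m := ext_basis b fun n => by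
      rw [hB, inner_basis, inner_smul_right, inner_basis]
      by_cases hn : n = m
      · subst hn
        simp
      · simp [hn]
    rw [ContinuousLinearMap.adjoint_inner_right, h, inner_smul_left, Complex.conj_conj]

/-- The domain of the self-adjoint operator `L₀` is contained in that of each tridiagonal
operator. -/
theorem exists_mem_ladderGraph (b : HilbertBasis ℕ ℂ H) {lam : ℝ} (hl : 0 < lam) (α β : ℂ) {x g : H}
    (h : ∀ m : ℕ, inner ℂ (b m) g = (lam + 2 * m) * inner ℂ (b m) x) :
    ∃ y, (x, y) ∈ ladderGraph b lam α β := by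
  have hpos : ∀ m : ℕ, 0 < lam + 2 * m := fun m => by positivity
  have hne : ∀ m : ℕ, (lam + 2 * m : ℂ) ≠ 0 := fun m => by exact_mod_cast (hpos m).ne'
  have hc : (0 : ℝ) < 1 / lam + 1 := by positivity
  have hbd : ∀ m j : ℕ, m ≤ j → j ≤ m + 1 →
      ladderWeight lam (m + 1) / (lam + 2 * j) ≤ (1 + lam) * (1 / lam + 1) := by
    intro m j hj _
    have hj' : (m : ℝ) ≤ j := by exact_mod_cast hj
    have hm : (0 : ℝ) ≤ m := m.cast_nonneg
    rw [div_le_iff₀ (hpos j), mul_assoc]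
    refine (ladderWeight_succ_le hl m).trans ?_
    have : (m : ℝ) + 1 ≤ (1 / lam + 1) * (lam + 2 * j) := by
      have e : (1 / lam + 1) * (lam + 2 * j) = 1 + lam + 2 * j + 2 * (j / lam) := by
        field_simp
        ring
      have : (0 : ℝ) ≤ j / lam := by positivity
      rw [e]
      linarith
    gcongr
  have hbd' : ∀ m j : ℕ, m ≤ j → j ≤ m + 1 →
      ‖(ladderWeight lam (m + 1) : ℂ) / (lam + 2 * j)‖ ≤ (1 + lam) * (1 / lam + 1) := by
    intro m j h1 h2
    have e : (ladderWeight lam (m + 1) : ℂ) / (lam + 2 * j) =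
        ((ladderWeight lam (m + 1) / (lam + 2 * j) : ℝ) : ℂ) := by push_cast; rfl
    rw [e, Complex.norm_real, Real.norm_of_nonneg
      (div_nonneg (ladderWeight_succ_pos hl m).le (hpos j).le)]
    exact hbd m j h1 h2
  obtain ⟨U, hU0, hU⟩ := exists_shiftUp b _ fun m => hbd' m m le_rfl (Nat.le_succ m)
  obtain ⟨D, hD⟩ := exists_shiftDown b _ fun m => hbd' m (m + 1) (Nat.le_succ m) le_rfl
  refine ⟨α • U g + β • g - (starRingEnd ℂ) α • D g, fun m => ?_⟩
  have hm := hne (m + 1)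
  simp only [inner_sub_right, inner_add_right, inner_smul_right, hD, ladderCoeff, h]
  cases m with
  | zero =>
    rw [hU0]
    simp only [ladderWeight_zero, Complex.ofReal_zero]
    field_simp
    ring
  | succ m =>
    have hm' := hne m
    rw [hU, h, Nat.add_sub_cancel]
    field_simp

end LadderGraph

/-! ### The representation with a given weight basis -/

section Triple

variable {H : Type*} [NormedAddCommGroup H] [InnerProductSpace ℂ H]

/-- The three operators are the maximal operators with the tridiagonal matrices that a weight basis
`b` of lowest weight `lam` prescribes: `E₀ = L₊ + L₋` and `E± = (-i (L₊ - L₋) ± i L₀) / 2`. -/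
structure IsLadderTriple (b : HilbertBasis ℕ ℂ H) (lam : ℝ) (E0 Ep Em : H →ₗ.[ℂ] H) : Prop where
  zero : E0.graph = ladderGraph b lam 1 0
  plus : Ep.graph = ladderGraph b lam (-Complex.I / 2) (Complex.I / 2)
  minus : Em.graph = ladderGraph b lam (-Complex.I / 2) (-Complex.I / 2)

theorem conj_I_half : (starRingEnd ℂ) (Complex.I / 2) = -(Complex.I / 2) := by
  simp [neg_div, map_ofNat]

theorem conj_neg_I_half : (starRingEnd ℂ) (-Complex.I / 2) = -(-Complex.I / 2) := by
  simp [neg_div, map_ofNat]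

namespace IsLadderTriple

variable {b : HilbertBasis ℕ ℂ H} {lam : ℝ} {E0 Ep Em : H →ₗ.[ℂ] H}

theorem mem_zero (h : IsLadderTriple b lam E0 Ep Em) {x y : H} : (x, y) ∈ E0.graph ↔
    ∀ m, inner ℂ (b m) y = ladderWeight lam m * inner ℂ (b (m - 1)) x -
      ladderWeight lam (m + 1) * inner ℂ (b (m + 1)) x := by
  rw [h.zero, mem_ladderGraph]
  simp [ladderCoeff]

theorem mem_plus (h : IsLadderTriple b lam E0 Ep Em) {x y : H} : (x, y) ∈ Ep.graph ↔
    ∀ m : ℕ, inner ℂ (b m) y = Complex.I / 2 * ((lam + 2 * m) * inner ℂ (b m) x -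
      ladderWeight lam m * inner ℂ (b (m - 1)) x -
      ladderWeight lam (m + 1) * inner ℂ (b (m + 1)) x) := by
  rw [h.plus, mem_ladderGraph]
  refine forall_congr' fun m => ?_
  rw [ladderCoeff, conj_neg_I_half]
  ring_nf

theorem mem_minus (h : IsLadderTriple b lam E0 Ep Em) {x y : H} : (x, y) ∈ Em.graph ↔
    ∀ m : ℕ, inner ℂ (b m) y = -(Complex.I / 2) * ((lam + 2 * m) * inner ℂ (b m) x +
      ladderWeight lam m * inner ℂ (b (m - 1)) x +
      ladderWeight lam (m + 1) * inner ℂ (b (m + 1)) x) := by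
  rw [h.minus, mem_ladderGraph]
  refine forall_congr' fun m => ?_
  rw [ladderCoeff, conj_neg_I_half]
  ring_nf

theorem opL0_coeff (h : IsLadderTriple b lam E0 Ep Em) {x y : H} (hy : (x, y) ∈ (opL0 Ep Em).graph)
    (m : ℕ) : inner ℂ (b m) y = (lam + 2 * m) * inner ℂ (b m) x := by
  obtain ⟨a, ha, rfl⟩ := mem_graph_smul.1 hy
  obtain ⟨p, q, hp, hq, rfl⟩ := mem_graph_sub.1 ha
  rw [inner_smul_right, inner_sub_right, h.mem_minus.1 hp, h.mem_plus.1 hq]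
  linear_combination (-((lam + 2 * m) * inner ℂ (b m) x)) * Complex.I_mul_I

theorem opLp_coeff (h : IsLadderTriple b lam E0 Ep Em) {x y : H}
    (hy : (x, y) ∈ (opLp E0 Ep Em).graph) (m : ℕ) :
    inner ℂ (b m) y = ladderWeight lam m * inner ℂ (b (m - 1)) x := by
  obtain ⟨a, ha, rfl⟩ := mem_graph_smul.1 hy
  obtain ⟨p, q, hp, hq, rfl⟩ := mem_graph_add.1 ha
  obtain ⟨r, hr, rfl⟩ := mem_graph_smul.1 hq
  obtain ⟨s, t, hs, ht, rfl⟩ := mem_graph_add.1 hr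
  rw [inner_smul_right, inner_add_right, inner_smul_right, inner_add_right, h.mem_minus.1 ht,
    h.mem_plus.1 hs, h.mem_zero.1 hp]
  linear_combination (-1 / 2 * (ladderWeight lam m * inner ℂ (b (m - 1)) x +
    ladderWeight lam (m + 1) * inner ℂ (b (m + 1)) x)) * Complex.I_mul_I

theorem opLm_coeff (h : IsLadderTriple b lam E0 Ep Em) {x y : H}
    (hy : (x, y) ∈ (opLm E0 Ep Em).graph) (m : ℕ) :
    inner ℂ (b m) y = -(ladderWeight lam (m + 1) * inner ℂ (b (m + 1)) x) := by
  obtain ⟨a, ha, rfl⟩ := mem_graph_smul.1 hy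
  obtain ⟨p, q, hp, hq, rfl⟩ := mem_graph_sub.1 ha
  obtain ⟨r, hr, rfl⟩ := mem_graph_smul.1 hq
  obtain ⟨s, t, hs, ht, rfl⟩ := mem_graph_add.1 hr
  rw [inner_smul_right, inner_sub_right, inner_smul_right, inner_add_right, h.mem_minus.1 ht,
    h.mem_plus.1 hs, h.mem_zero.1 hp]
  linear_combination (1 / 2 * (ladderWeight lam m * inner ℂ (b (m - 1)) x +
    ladderWeight lam (m + 1) * inner ℂ (b (m + 1)) x)) * Complex.I_mul_I

theorem weight_coeff (b : HilbertBasis ℕ ℂ H) (lam : ℝ) (n m : ℕ) :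
    inner ℂ (b m) (((lam + 2 * n : ℝ) : ℂ) • b n) = (lam + 2 * m) * inner ℂ (b m) (b n) := by
  rw [inner_smul_right, inner_basis]
  split_ifs with hmn
  · subst hmn
    push_cast
    ring
  · simp

theorem basis_mem_smoothDomain (h : IsLadderTriple b lam E0 Ep Em) (n : ℕ) :
    b n ∈ smoothDomain E0 Ep Em := by
  have key : ∀ {α β : ℂ} {E : H →ₗ.[ℂ] H}, E.graph = ladderGraph b lam α β →
      ∀ x ∈ Submodule.span ℂ (range b), ∃ y ∈ Submodule.span ℂ (range b), (x, y) ∈ E.graph := by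
    intro α β E hE x hx
    refine Submodule.span_induction ?_ ⟨0, Submodule.zero_mem _, E.graph.zero_mem⟩ ?_ ?_ hx
    · rintro _ ⟨n, rfl⟩
      exact ⟨_, ladderVec_mem_span b lam α β n, by rw [hE]; exact ladderVec_mem b lam α β n⟩
    · rintro x x' _ _ ⟨y, hy, h⟩ ⟨y', hy', h'⟩
      exact ⟨y + y', Submodule.add_mem _ hy hy', E.graph.add_mem h h'⟩
    · rintro c x _ ⟨y, hy, h⟩
      exact ⟨c • y, Submodule.smul_mem _ c hy, E.graph.smul_mem c h⟩
  exact le_smoothDomain (key h.zero) (key h.plus) (key h.minus) (Submodule.subset_span ⟨n, rfl⟩)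

theorem ker_plus_eq (h : IsLadderTriple b lam E0 Ep Em) (hl : 0 < lam) :
    kerOn (smoothDomain E0 Ep Em) (opLp E0 Ep Em) = ⊥ := by
  rw [Submodule.eq_bot_iff]
  intro x hx
  rw [mem_kerOn] at hx
  refine ext_basis b fun m => ?_
  have := h.opLp_coeff hx.2 (m + 1)
  rw [inner_zero_right, eq_comm, mul_eq_zero, Complex.ofReal_eq_zero] at this
  simpa using this.resolve_left (ladderWeight_succ_pos hl m).ne'

variable [CompleteSpace H]

theorem skew_zero (h : IsLadderTriple b lam E0 Ep Em) (hl : 0 < lam) : IsSkewAdjoint E0 :=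
  isSkewAdjoint_of_graph b hl (by simp) h.zero

theorem skew_plus (h : IsLadderTriple b lam E0 Ep Em) (hl : 0 < lam) : IsSkewAdjoint Ep :=
  isSkewAdjoint_of_graph b hl conj_I_half h.plus

theorem skew_minus (h : IsLadderTriple b lam E0 Ep Em) (hl : 0 < lam) : IsSkewAdjoint Em :=
  isSkewAdjoint_of_graph b hl conj_neg_I_half h.minus

/-- A vector in the domain of the diagonal operator `L₀` lies in the domains of all three
operators. -/
theorem exists_images (h : IsLadderTriple b lam E0 Ep Em) (hl : 0 < lam) {x g : H}
    (hg : ∀ m : ℕ, inner ℂ (b m) g = (lam + 2 * m) * inner ℂ (b m) x) :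
    ∃ y0 yp ym, (x, y0) ∈ E0.graph ∧ (x, yp) ∈ Ep.graph ∧ (x, ym) ∈ Em.graph := by
  obtain ⟨y0, h0⟩ := exists_mem_ladderGraph b hl 1 0 hg
  obtain ⟨yp, hp⟩ := exists_mem_ladderGraph b hl (-Complex.I / 2) (Complex.I / 2) hg
  obtain ⟨ym, hm⟩ := exists_mem_ladderGraph b hl (-Complex.I / 2) (-Complex.I / 2) hg
  rw [← h.zero] at h0
  rw [← h.plus] at hp
  rw [← h.minus] at hm
  exact ⟨y0, yp, ym, h0, hp, hm⟩

theorem mem_opL0 (h : IsLadderTriple b lam E0 Ep Em) (hl : 0 < lam) {x y : H} :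
    (x, y) ∈ (opL0 Ep Em).graph ↔
      ∀ m : ℕ, inner ℂ (b m) y = (lam + 2 * m) * inner ℂ (b m) x := by
  refine ⟨h.opL0_coeff, fun hy => ?_⟩
  obtain ⟨y0, yp, ym, h0, hp, hm⟩ := h.exists_images hl hy
  have h1 : (x, Complex.I • (ym - yp)) ∈ (opL0 Ep Em).graph :=
    mem_graph_smul.2 ⟨_, mem_graph_sub.2 ⟨_, _, hm, hp, rfl⟩, rfl⟩
  convert h1
  exact ext_basis b fun m => by rw [hy, h.opL0_coeff h1]

theorem mem_opLp (h : IsLadderTriple b lam E0 Ep Em) (hl : 0 < lam) {x g y : H}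
    (hg : ∀ m : ℕ, inner ℂ (b m) g = (lam + 2 * m) * inner ℂ (b m) x)
    (hy : ∀ m : ℕ, inner ℂ (b m) y = ladderWeight lam m * inner ℂ (b (m - 1)) x) :
    (x, y) ∈ (opLp E0 Ep Em).graph := by
  obtain ⟨y0, yp, ym, h0, hp, hm⟩ := h.exists_images hl hg
  have h1 : (x, (1 / 2 : ℂ) • (y0 + Complex.I • (yp + ym))) ∈ (opLp E0 Ep Em).graph :=
    mem_graph_smul.2 ⟨_, mem_graph_add.2 ⟨_, _, h0, mem_graph_smul.2
      ⟨_, mem_graph_add.2 ⟨_, _, hp, hm, rfl⟩, rfl⟩, rfl⟩, rfl⟩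
  convert h1
  exact ext_basis b fun m => by rw [hy, h.opLp_coeff h1]

theorem mem_opLm (h : IsLadderTriple b lam E0 Ep Em) (hl : 0 < lam) {x g y : H}
    (hg : ∀ m : ℕ, inner ℂ (b m) g = (lam + 2 * m) * inner ℂ (b m) x)
    (hy : ∀ m : ℕ, inner ℂ (b m) y = -(ladderWeight lam (m + 1) * inner ℂ (b (m + 1)) x)) :
    (x, y) ∈ (opLm E0 Ep Em).graph := by
  obtain ⟨y0, yp, ym, h0, hp, hm⟩ := h.exists_images hl hg
  have h1 : (x, (1 / 2 : ℂ) • (y0 - Complex.I • (yp + ym))) ∈ (opLm E0 Ep Em).graph :=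
    mem_graph_smul.2 ⟨_, mem_graph_sub.2 ⟨_, _, h0, mem_graph_smul.2
      ⟨_, mem_graph_add.2 ⟨_, _, hp, hm, rfl⟩, rfl⟩, rfl⟩, rfl⟩
  convert h1
  exact ext_basis b fun m => by rw [hy, h.opLm_coeff h1]

theorem isWeightBasis (h : IsLadderTriple b lam E0 Ep Em) (hl : 0 < lam) :
    IsWeightBasis E0 Ep Em lam b where
  L0_apply n := (h.mem_opL0 hl).2 (weight_coeff b lam n)
  Lp_apply n := by
    refine h.mem_opLp hl (weight_coeff b lam n) fun m => ?_
    rw [← ladderWeight_succ, inner_smul_right, inner_basis, inner_basis]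
    cases m with
    | zero => simp
    | succ m =>
      by_cases hmn : m = n
      · subst hmn
        simp
      · simp [hmn]
  Lm_zero := by
    refine h.mem_opLm hl (weight_coeff b lam 0) fun m => ?_
    rw [inner_basis]
    simp
  Lm_succ n := by
    refine h.mem_opLm hl (weight_coeff b lam (n + 1)) fun m => ?_
    rw [← ladderWeight_succ, inner_smul_right, inner_basis, inner_basis]
    by_cases hmn : m = n
    · subst hmn
      simp
    · simp [hmn]

/-- The commutation relations are compared coefficientwise, where they reduce to
`w (m + 1) ^ 2 - w m ^ 2 = lam + 2 m` for the matrix elements `w` of the ladder operators. -/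
theorem isUnitaryRep (h : IsLadderTriple b lam E0 Ep Em) (hl : 0 < lam) :
    IsUnitaryRep E0 Ep Em where
  skew_zero := h.skew_zero hl
  skew_plus := h.skew_plus hl
  skew_minus := h.skew_minus hl
  dense_smooth := by
    have h1 : Submodule.span ℂ (range b) ≤ smoothDomain E0 Ep Em := by
      rw [Submodule.span_le]
      rintro _ ⟨n, rfl⟩
      exact h.basis_mem_smoothDomain n
    refine Dense.mono h1 ?_
    rw [dense_iff_closure_eq, ← Submodule.topologicalClosure_coe, b.dense_span]
    rfl
  comm_zero_plus := by
    intro x hx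
    obtain ⟨y, hy, hxy⟩ := smoothDomain_invariant (E := Ep) (by simp) hx
    obtain ⟨z, hz, hxz⟩ := smoothDomain_invariant (E := E0) (by simp) hx
    obtain ⟨xy, -, h1⟩ := smoothDomain_invariant (E := E0) (by simp) hy
    obtain ⟨yx, -, h2⟩ := smoothDomain_invariant (E := Ep) (by simp) hz
    refine ⟨y, xy, z, yx, hxy, h1, hxz, h2, ?_⟩
    refine mem_graph_smul.2 ⟨(1 / 2 : ℂ) • (xy - yx), h.mem_plus.2 fun m => ?_, by
      rw [smul_smul]; norm_num⟩
    rw [inner_smul_right, inner_sub_right, h.mem_zero.1 h1, h.mem_plus.1 h2]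
    simp only [h.mem_zero.1 hxz, h.mem_plus.1 hxy]
    have e2 := congrArg Complex.ofReal (ladderWeight_sq hl m)
    have e1 := congrArg Complex.ofReal (ladderWeight_sq hl (m + 1))
    push_cast at e1 e2
    cases m with
    | zero =>
      simp only [ladderWeight_zero, Complex.ofReal_zero, Nat.cast_zero, Nat.add_sub_cancel] at *
      push_cast at *
      linear_combination (Complex.I / 2 * inner ℂ (b 0) x) * e1
    | succ m =>
      simp only [Nat.add_sub_cancel]
      push_cast at *
      linear_combination (Complex.I / 2 * inner ℂ (b (m + 1)) x) * (e1 - e2)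
  comm_zero_minus := by
    intro x hx
    obtain ⟨y, hy, hxy⟩ := smoothDomain_invariant (E := Em) (by simp) hx
    obtain ⟨z, hz, hxz⟩ := smoothDomain_invariant (E := E0) (by simp) hx
    obtain ⟨xy, -, h1⟩ := smoothDomain_invariant (E := E0) (by simp) hy
    obtain ⟨yx, -, h2⟩ := smoothDomain_invariant (E := Em) (by simp) hz
    refine ⟨y, xy, z, yx, hxy, h1, hxz, h2, ?_⟩
    refine mem_graph_smul.2 ⟨(-1 / 2 : ℂ) • (xy - yx), h.mem_minus.2 fun m => ?_, by
      rw [smul_smul]; norm_num⟩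
    rw [inner_smul_right, inner_sub_right, h.mem_zero.1 h1, h.mem_minus.1 h2]
    simp only [h.mem_zero.1 hxz, h.mem_minus.1 hxy]
    have e2 := congrArg Complex.ofReal (ladderWeight_sq hl m)
    have e1 := congrArg Complex.ofReal (ladderWeight_sq hl (m + 1))
    push_cast at e1 e2
    cases m with
    | zero =>
      simp only [ladderWeight_zero, Complex.ofReal_zero, Nat.cast_zero, Nat.add_sub_cancel] at *
      push_cast at *
      linear_combination (-Complex.I / 2 * inner ℂ (b 0) x) * e1
    | succ m =>
      simp only [Nat.add_sub_cancel]
      push_cast at *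
      linear_combination (-Complex.I / 2 * inner ℂ (b (m + 1)) x) * (e1 - e2)
  comm_plus_minus := by
    intro x hx
    obtain ⟨y, hy, hxy⟩ := smoothDomain_invariant (E := Em) (by simp) hx
    obtain ⟨z, hz, hxz⟩ := smoothDomain_invariant (E := Ep) (by simp) hx
    obtain ⟨xy, -, h1⟩ := smoothDomain_invariant (E := Ep) (by simp) hy
    obtain ⟨yx, -, h2⟩ := smoothDomain_invariant (E := Em) (by simp) hz
    refine ⟨y, xy, z, yx, hxy, h1, hxz, h2, h.mem_zero.2 fun m => ?_⟩
    rw [inner_sub_right, h.mem_plus.1 h1, h.mem_minus.1 h2]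
    simp only [h.mem_plus.1 hxz, h.mem_minus.1 hxy]
    cases m with
    | zero =>
      simp only [ladderWeight_zero, Complex.ofReal_zero, Nat.cast_zero, Nat.add_sub_cancel] at *
      push_cast at *
      linear_combination (ladderWeight lam (0 + 1) * inner ℂ (b (0 + 1)) x) * Complex.I_mul_I
    | succ m =>
      simp only [Nat.add_sub_cancel]
      push_cast at *
      linear_combination (ladderWeight lam (m + 1 + 1) * inner ℂ (b (m + 1 + 1)) x -
        ladderWeight lam (m + 1) * inner ℂ (b m) x) * Complex.I_mul_I

theorem ker_minus_eq (h : IsLadderTriple b lam E0 Ep Em) (hl : 0 < lam) :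
    kerOn (smoothDomain E0 Ep Em) (opLm E0 Ep Em) = Submodule.span ℂ {b 0} := by
  ext x
  rw [mem_kerOn, Submodule.mem_span_singleton]
  constructor
  · rintro ⟨-, hx⟩
    refine ⟨inner ℂ (b 0) x, (ext_basis b fun m => ?_).symm⟩
    rw [inner_smul_right, inner_basis]
    cases m with
    | zero => simp
    | succ m =>
      have := h.opLm_coeff hx m
      rw [inner_zero_right, eq_comm, neg_eq_zero, mul_eq_zero, Complex.ofReal_eq_zero] at this
      simpa using this.resolve_left (ladderWeight_succ_pos hl m).ne'
  · rintro ⟨c, rfl⟩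
    refine ⟨Submodule.smul_mem _ c (h.basis_mem_smoothDomain 0), ?_⟩
    have := (opLm E0 Ep Em).graph.smul_mem c (h.isWeightBasis hl).Lm_zero
    simpa using this

theorem hasLowestWeight (h : IsLadderTriple b lam E0 Ep Em) (hl : 0 < lam) :
    HasLowestWeight E0 Ep Em lam := by
  refine ⟨b 0, ?_, b.orthonormal.ne_zero 0, ?_⟩
  · rw [h.ker_minus_eq hl]
    exact Submodule.mem_span_singleton_self _
  · simpa using (h.isWeightBasis hl).L0_apply 0

/-- A reducing projection commutes with the lowering operator, therefore multiplies the lowest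
weight vector by a scalar, and then all weight vectors by the same scalar. -/
theorem isIrreducible (h : IsLadderTriple b lam E0 Ep Em) (hl : 0 < lam) :
    IsIrreducible E0 Ep Em := by
  have hw := h.isWeightBasis hl
  refine ⟨⟨b 0, 0, b.orthonormal.ne_zero 0⟩, ?_⟩
  intro K _ h0 hp hm
  have hLp : Reduces K (opLp E0 Ep Em) := by
    intro x y hy
    obtain ⟨a, ha, rfl⟩ := mem_graph_smul.1 hy
    obtain ⟨p, q, hp', hq, rfl⟩ := mem_graph_add.1 ha
    obtain ⟨r, hr, rfl⟩ := mem_graph_smul.1 hq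
    obtain ⟨s, t, hs, ht, rfl⟩ := mem_graph_add.1 hr
    simp only [map_smul, map_add]
    exact mem_graph_smul.2 ⟨_, mem_graph_add.2 ⟨_, _, h0 _ _ hp', mem_graph_smul.2
      ⟨_, mem_graph_add.2 ⟨_, _, hp _ _ hs, hm _ _ ht, rfl⟩, rfl⟩, rfl⟩, rfl⟩
  have hLm : Reduces K (opLm E0 Ep Em) := by
    intro x y hy
    obtain ⟨a, ha, rfl⟩ := mem_graph_smul.1 hy
    obtain ⟨p, q, hp', hq, rfl⟩ := mem_graph_sub.1 ha
    obtain ⟨r, hr, rfl⟩ := mem_graph_smul.1 hq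
    obtain ⟨s, t, hs, ht, rfl⟩ := mem_graph_add.1 hr
    simp only [map_smul, map_add, map_sub]
    exact mem_graph_smul.2 ⟨_, mem_graph_sub.2 ⟨_, _, h0 _ _ hp', mem_graph_smul.2
      ⟨_, mem_graph_add.2 ⟨_, _, hp _ _ hs, hm _ _ ht, rfl⟩, rfl⟩, rfl⟩, rfl⟩
  obtain ⟨c, hc⟩ : ∃ c : ℂ, K.starProjection (b 0) = c • b 0 := by
    refine ⟨inner ℂ (b 0) (K.starProjection (b 0)), ext_basis b fun m => ?_⟩
    rw [inner_smul_right, inner_basis]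
    cases m with
    | zero => simp
    | succ m =>
      have := h.opLm_coeff (hLm _ _ hw.Lm_zero) m
      rw [map_zero, inner_zero_right, eq_comm, neg_eq_zero, mul_eq_zero,
        Complex.ofReal_eq_zero] at this
      simpa using this.resolve_left (ladderWeight_succ_pos hl m).ne'
  have hall : ∀ n, K.starProjection (b n) = c • b n := by
    intro n
    induction n with
    | zero => exact hc
    | succ n ih =>
      have h1 := hLp _ _ (hw.Lp_apply n)
      rw [ih] at h1
      have h2 := graph_unique h1 ((opLp E0 Ep Em).graph.smul_mem c (hw.Lp_apply n))
      rw [map_smul, smul_comm c] at h2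
      refine smul_right_injective H ?_ h2
      rw [← ladderWeight_succ]
      exact_mod_cast (ladderWeight_succ_pos hl n).ne'
  have hP : ∀ x, K.starProjection x = c • x := by
    intro x
    have hd : Dense (Submodule.span ℂ (range b) : Set H) := by
      rw [dense_iff_closure_eq, ← Submodule.topologicalClosure_coe, b.dense_span]
      rfl
    have h1 : K.starProjection = c • ContinuousLinearMap.id ℂ H := by
      refine ContinuousLinearMap.ext_on hd ?_
      rintro _ ⟨n, rfl⟩
      simpa using hall n
    rw [h1]
    rfl
  by_cases hc0 : c = 0
  · left
    rw [Submodule.eq_bot_iff]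
    intro x hx
    rw [← Submodule.starProjection_eq_self_iff.2 hx, hP, hc0, zero_smul]
  · right
    rw [Submodule.eq_top_iff']
    intro x
    have h1 := Submodule.smul_mem K c⁻¹ (Submodule.starProjection_apply_mem K x)
    rwa [hP, smul_smul, inv_mul_cancel₀ hc0, one_smul] at h1

theorem isLowestWeightIrrep (h : IsLadderTriple b lam E0 Ep Em) (hl : 0 < lam) :
    IsLowestWeightIrrep E0 Ep Em where
  rep := h.isUnitaryRep hl
  irreducible := h.isIrreducible hl
  ker_plus := h.ker_plus_eq hl
  ker_minus := by
    rw [h.ker_minus_eq hl]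
    exact finrank_span_singleton (b.orthonormal.ne_zero 0)

end IsLadderTriple

end Triple

section Annihilation

variable {H : Type*} [NormedAddCommGroup H] [InnerProductSpace ℂ H]

/-! ### Positivity of `i E₋` and unitary equivalence -/

theorem inner_mem_span_eventually_zero (b : HilbertBasis ℕ ℂ H) {x : H}
    (hx : x ∈ Submodule.span ℂ (range b)) : ∃ M, ∀ m, M ≤ m → inner ℂ (b m) x = (0 : ℂ) := by
  refine Submodule.span_induction ?_ ⟨0, fun m _ => inner_zero_right _⟩ ?_ ?_ hx
  · rintro _ ⟨n, rfl⟩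
    refine ⟨n + 1, fun m hm => ?_⟩
    rw [inner_basis, if_neg (by omega)]
  · rintro x y _ _ ⟨M, hM⟩ ⟨N, hN⟩
    refine ⟨max M N, fun m hm => ?_⟩
    rw [inner_add_right, hM m (le_trans (le_max_left _ _) hm),
      hN m (le_trans (le_max_right _ _) hm), add_zero]
  · rintro c x _ ⟨M, hM⟩
    exact ⟨M, fun m hm => by rw [inner_smul_right, hM m hm, mul_zero]⟩

namespace IsLadderTriple

variable {b : HilbertBasis ℕ ℂ H} {lam : ℝ} {E0 Ep Em : H →ₗ.[ℂ] H}

/-- On finite linear combinations the quadratic form of `i E₋` is bounded below by the telescoping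
remainders of the inequality `2 √((m+1)(lam+m)) |x_m x_{m+1}| ≤ (lam+m)|x_m|² + (m+1)|x_{m+1}|²`. -/
theorem form_nonneg_of_mem_span (h : IsLadderTriple b lam E0 Ep Em) (hl : 0 < lam) {x y : H}
    (hx : x ∈ Submodule.span ℂ (range b)) (hxy : (x, y) ∈ Em.graph) :
    0 ≤ (inner ℂ x (Complex.I • y)).re := by
  obtain ⟨M, hM⟩ := inner_mem_span_eventually_zero b hx
  set c : ℕ → ℂ := fun m => inner ℂ (b m) x with hc
  set t : ℕ → ℝ := fun m => ladderWeight lam (m + 1) * ((starRingEnd ℂ) (c m) * c (m + 1)).re with ht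
  have hterm : ∀ m : ℕ, (inner ℂ x (b m) * inner ℂ (b m) (Complex.I • y)).re =
      (lam + 2 * m) / 2 * ‖c m‖ ^ 2 + t m / 2 +
        (ladderWeight lam m * ((starRingEnd ℂ) (c m) * c (m - 1)).re) / 2 := by
    intro m
    rw [← inner_conj_symm, inner_smul_right, h.mem_minus.1 hxy]
    have e : (starRingEnd ℂ) (inner ℂ (b m) x) * (Complex.I * (-(Complex.I / 2) *
        ((lam + 2 * m) * inner ℂ (b m) x + ladderWeight lam m * inner ℂ (b (m - 1)) x +
          ladderWeight lam (m + 1) * inner ℂ (b (m + 1)) x))) =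
        ((((lam + 2 * m) / 2 : ℝ) : ℂ) * ((starRingEnd ℂ) (c m) * c m) +
        ((ladderWeight lam (m + 1) / 2 : ℝ) : ℂ) * ((starRingEnd ℂ) (c m) * c (m + 1))) +
        ((ladderWeight lam m / 2 : ℝ) : ℂ) * ((starRingEnd ℂ) (c m) * c (m - 1)) := by
      simp only [hc]
      push_cast
      linear_combination (-(1 / 2) * (starRingEnd ℂ) (inner ℂ (b m) x) *
        ((lam + 2 * m) * inner ℂ (b m) x + ladderWeight lam m * inner ℂ (b (m - 1)) x +
          ladderWeight lam (m + 1) * inner ℂ (b (m + 1)) x)) * Complex.I_mul_I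
    have e2 : (starRingEnd ℂ) (c m) * c m = ((‖c m‖ ^ 2 : ℝ) : ℂ) := by
      rw [mul_comm, Complex.mul_conj']
      push_cast
      rfl
    rw [e, e2, Complex.add_re, Complex.add_re, ← Complex.ofReal_mul, Complex.ofReal_re,
      Complex.re_ofReal_mul, Complex.re_ofReal_mul]
    simp only [ht]
    ring
  -- the arithmetic-geometric mean inequality, with `w (m + 1)² = (m + 1) (lam + m)`
  have ht_le : ∀ m : ℕ, -((lam + m) * ‖c m‖ ^ 2 + (m + 1) * ‖c (m + 1)‖ ^ 2) / 2 ≤ t m := by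
    intro m
    have h1 : |((starRingEnd ℂ) (c m) * c (m + 1)).re| ≤ ‖c m‖ * ‖c (m + 1)‖ := by
      refine (Complex.abs_re_le_norm _).trans ?_
      rw [norm_mul, RCLike.norm_conj]
    have h2 := ladderWeight_succ_sq hl m
    have h3 := ladderWeight_succ_pos hl m
    have h4 : ladderWeight lam (m + 1) * (‖c m‖ * ‖c (m + 1)‖) ≤
        ((lam + m) * ‖c m‖ ^ 2 + (m + 1) * ‖c (m + 1)‖ ^ 2) / 2 := by
      have hs1 : Real.sqrt (lam + m) ^ 2 = lam + m := Real.sq_sqrt (by positivity)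
      have hs2 : Real.sqrt (m + 1) ^ 2 = (m : ℝ) + 1 := Real.sq_sqrt (by positivity)
      have h5 : ladderWeight lam (m + 1) = Real.sqrt (m + 1) * Real.sqrt (lam + m) := by
        rw [ladderWeight_succ, Real.sqrt_mul (by positivity)]
      rw [h5]
      have := sq_nonneg (Real.sqrt (lam + m) * ‖c m‖ - Real.sqrt (m + 1) * ‖c (m + 1)‖)
      have e : (Real.sqrt (lam + m) * ‖c m‖ - Real.sqrt (m + 1) * ‖c (m + 1)‖) ^ 2 =
          Real.sqrt (lam + m) ^ 2 * ‖c m‖ ^ 2 + Real.sqrt (m + 1) ^ 2 * ‖c (m + 1)‖ ^ 2 -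
          2 * (Real.sqrt (m + 1) * Real.sqrt (lam + m) * (‖c m‖ * ‖c (m + 1)‖)) := by ring
      rw [e, hs1, hs2] at this
      linarith
    have h6 := (abs_le.1 h1).1
    have h7 : ladderWeight lam (m + 1) * -(‖c m‖ * ‖c (m + 1)‖) ≤ t m := by
      simp only [ht]
      gcongr
    linarith
  -- each term of the form uses up half of the two neighbouring off-diagonal terms `t`
  have hS : ∀ N : ℕ, (lam + N) / 2 * ‖c N‖ ^ 2 + t N / 2 ≤ ∑ m ∈ Finset.range (N + 1),
      (inner ℂ x (b m) * inner ℂ (b m) (Complex.I • y)).re := by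
    intro N
    induction N with
    | zero =>
      rw [Finset.sum_range_one, hterm]
      simp
    | succ N ih =>
      rw [Finset.sum_range_succ, hterm, Nat.add_sub_cancel]
      have e : ladderWeight lam (N + 1) * ((starRingEnd ℂ) (c (N + 1)) * c N).re = t N := by
        simp only [ht]
        rw [← Complex.conj_re ((starRingEnd ℂ) (c (N + 1)) * c N), map_mul, Complex.conj_conj,
          mul_comm (c (N + 1))]
      rw [e]
      have := ht_le N
      push_cast
      nlinarith
  have hsum : inner ℂ x (Complex.I • y) =
      ∑ m ∈ Finset.range (M + 1), inner ℂ x (b m) * inner ℂ (b m) (Complex.I • y) := by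
    refine (b.hasSum_inner_mul_inner x (Complex.I • y)).unique (hasSum_sum_of_ne_finset_zero ?_)
    intro m hm
    rw [← inner_conj_symm, hM m (by simp at hm; omega), map_zero, zero_mul]
  rw [hsum, Complex.re_sum]
  have hM0 : c M = 0 := hM M le_rfl
  have := hS M
  simpa [ht, hM0] using this

variable [CompleteSpace H]

theorem form_nonneg (h : IsLadderTriple b lam E0 Ep Em) (hl : 0 < lam) {x y : H}
    (hxy : (x, y) ∈ Em.graph) : 0 ≤ (inner ℂ x (Complex.I • y)).re := by
  obtain ⟨u, v, hu, huv, hux, hvy⟩ := ladderGraph_core b hl (G := Em.graph)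
    (fun n => by rw [h.minus]; exact ladderVec_mem b lam _ _ n) (by rw [← h.minus]; exact hxy)
  have hlim : Tendsto (fun n => (inner ℂ (u n) (Complex.I • v n)).re) atTop
      (𝓝 (inner ℂ x (Complex.I • y)).re) :=
    (Complex.continuous_re.tendsto _).comp (hux.inner (hvy.const_smul Complex.I))
  exact ge_of_tendsto' hlim fun n => h.form_nonneg_of_mem_span hl (hu n) (huv n)

/-- If `T` is an operator between the tridiagonal matrix of `E₋` on finite linear combinations of
weight vectors and `E₋` itself, then `i E₋` is the Friedrichs extension of `i T`. -/
theorem isFriedrichsExtension (h : IsLadderTriple b lam E0 Ep Em) (hl : 0 < lam)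
    {T : H →ₗ.[ℂ] H} (hT : T ≤ Em)
    (hTb : ∀ n, (b n, ladderVec b lam (-Complex.I / 2) (-Complex.I / 2) n) ∈ T.graph) :
    IsFriedrichsExtension (Complex.I • T) (Complex.I • Em) := by
  have hle := LinearPMap.le_graph_of_le hT
  have hskew := h.skew_minus hl
  have hval : ∀ x : (Complex.I • T).domain, ∃ y, ((x : H), y) ∈ T.graph ∧
      (Complex.I • T) x = Complex.I • y := fun x =>
    mem_graph_smul.1 ((Complex.I • T).mem_graph x)
  refine ⟨?_, ?_, ⟨0, fun x => ?_⟩, ?_, hskew.isSelfAdjoint_I_smul, ?_⟩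
  · have h1 : Submodule.span ℂ (range b) ≤ T.domain := by
      rw [Submodule.span_le]
      rintro _ ⟨n, rfl⟩
      exact LinearPMap.mem_domain_of_mem_graph (hTb n)
    refine Dense.mono h1 ?_
    rw [dense_iff_closure_eq, ← Submodule.topologicalClosure_coe, b.dense_span]
    rfl
  · intro x y
    obtain ⟨p, hp, hp'⟩ := hval x
    obtain ⟨q, hq, hq'⟩ := hval y
    rw [hp', hq', inner_smul_left, inner_smul_right, hskew.inner_skew (hle hp) (hle hq),
      Complex.conj_I, neg_mul_neg]
  · obtain ⟨p, hp, hp'⟩ := hval x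
    rw [hp', zero_mul]
    exact h.form_nonneg hl (hle hp)
  · refine LinearPMap.le_of_le_graph ?_
    rintro ⟨x, y⟩ hxy
    obtain ⟨a, ha, rfl⟩ := mem_graph_smul.1 hxy
    exact mem_graph_smul.2 ⟨a, hle ha, rfl⟩
  · intro x hx
    obtain ⟨y, hy⟩ := LinearPMap.mem_domain_iff.1 hx
    obtain ⟨y, hxy, rfl⟩ := mem_graph_smul.1 hy
    rw [h.minus] at hxy
    obtain ⟨u, v, -, huv, hux, hvy⟩ := ladderGraph_core b hl hTb hxy
    have hu : ∀ n, u n ∈ (Complex.I • T).domain := fun n =>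
      LinearPMap.mem_domain_of_mem_graph (f := T) (huv n)
    refine ⟨fun n => ⟨u n, hu n⟩, hux, ?_⟩
    have hval' : ∀ p : ℕ × ℕ, (Complex.I • T) (⟨u p.1, hu p.1⟩ - ⟨u p.2, hu p.2⟩) =
        Complex.I • (v p.1 - v p.2) := by
      intro p
      have h1 : (u p.1 - u p.2, Complex.I • (v p.1 - v p.2)) ∈ (Complex.I • T).graph :=
        mem_graph_smul.2 ⟨_, T.graph.sub_mem (huv p.1) (huv p.2), rfl⟩
      exact graph_unique ((Complex.I • T).mem_graph (⟨u p.1, hu p.1⟩ - ⟨u p.2, hu p.2⟩)) h1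
    simp only [hval', Submodule.coe_sub]
    rw [← prod_atTop_atTop_eq]
    have hu1 := (hux.comp tendsto_fst).sub (hux.comp (tendsto_snd (f := (atTop : Filter ℕ))))
    have hv1 := ((hvy.comp tendsto_fst).sub
      (hvy.comp (tendsto_snd (f := (atTop : Filter ℕ))))).const_smul Complex.I
    have h2 := (Complex.continuous_re.tendsto _).comp (hu1.inner hv1)
    rw [sub_self, inner_zero_left, Complex.zero_re] at h2
    exact h2

end IsLadderTriple

theorem ladderGraph_transport {H' : Type*} [NormedAddCommGroup H'] [InnerProductSpace ℂ H']
    (b : HilbertBasis ℕ ℂ H) (b' : HilbertBasis ℕ ℂ H') (lam : ℝ) (α β : ℂ) (x y : H) :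
    (x, y) ∈ ladderGraph b lam α β ↔
      (b.repr.trans b'.repr.symm x, b.repr.trans b'.repr.symm y) ∈ ladderGraph b' lam α β := by
  have hU : ∀ m z, inner ℂ (b' m) (b.repr.trans b'.repr.symm z) = inner ℂ (b m) z := by
    intro m z
    rw [← b'.repr_apply_apply, ← b.repr_apply_apply, LinearIsometryEquiv.trans_apply,
      LinearIsometryEquiv.apply_symm_apply]
  rw [mem_ladderGraph, mem_ladderGraph]
  simp only [hU]

/-- Representations with weight bases of the same lowest weight are unitarily equivalent. -/
theorem IsLadderTriple.exists_intertwines {H' : Type*} [NormedAddCommGroup H']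
    [InnerProductSpace ℂ H'] {b : HilbertBasis ℕ ℂ H} {b' : HilbertBasis ℕ ℂ H'} {lam : ℝ}
    {E0 Ep Em : H →ₗ.[ℂ] H} {E0' Ep' Em' : H' →ₗ.[ℂ] H'} (h : IsLadderTriple b lam E0 Ep Em)
    (h' : IsLadderTriple b' lam E0' Ep' Em') :
    ∃ U : H ≃ₗᵢ[ℂ] H', Intertwines U E0 E0' ∧ Intertwines U Ep Ep' ∧ Intertwines U Em Em' := by
  refine ⟨b.repr.trans b'.repr.symm, fun x y => ?_, fun x y => ?_, fun x y => ?_⟩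
  · rw [h.zero, h'.zero, ladderGraph_transport b b']
  · rw [h.plus, h'.plus, ladderGraph_transport b b']
  · rw [h.minus, h'.minus, ladderGraph_transport b b']

/-! ### The annihilation operator and the operator `A` -/

/-- The bounded operator with matrix elements `b (m + 1) ↦ √((m + 1) / (lam + m)) b m`. -/
theorem exists_annihilation (b : HilbertBasis ℕ ℂ H) {lam : ℝ} (hl : 0 < lam) :
    ∃ a : H →L[ℂ] H, ∀ x m, inner ℂ (b m) (a x) =
      ((Real.sqrt ((m + 1) / (lam + m)) : ℝ) : ℂ) * inner ℂ (b (m + 1)) x := by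
  refine exists_shiftDown b (fun m : ℕ => ((Real.sqrt ((m + 1) / (lam + m)) : ℝ) : ℂ))
    (C := Real.sqrt (1 + 1 / lam)) fun m => ?_
  rw [Complex.norm_real, Real.norm_of_nonneg (Real.sqrt_nonneg _)]
  refine Real.sqrt_le_sqrt ?_
  rw [div_le_iff₀ (by positivity)]
  have e : (1 + 1 / lam) * (lam + m) = lam + m + 1 + m / lam := by
    field_simp
    ring
  have : (0 : ℝ) ≤ m / lam := by positivity
  rw [e]
  linarith

variable {b : HilbertBasis ℕ ℂ H} {lam : ℝ} {a : H →L[ℂ] H}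

theorem IsLadderTriple.isAnnihilationOperator [CompleteSpace H] {E0 Ep Em : H →ₗ.[ℂ] H}
    (h : IsLadderTriple b lam E0 Ep Em) (hl : 0 < lam)
    (ha : ∀ x (m : ℕ), inner ℂ (b m) (a x) =
      ((Real.sqrt ((m + 1) / (lam + m)) : ℝ) : ℂ) * inner ℂ (b (m + 1)) x) :
    IsAnnihilationOperator E0 Ep Em lam a := by
  intro f g hfg
  have hg := h.opL0_coeff hfg
  -- `a` maps the domain of `L₀` to itself, since `L₀ a = a (L₀ - 2)` there
  refine h.mem_opLp hl (g := a (g - (2 : ℂ) • f)) (fun m => ?_) (fun m => ?_)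
  · rw [ha, ha, inner_sub_right, inner_smul_right, hg]
    push_cast
    ring
  · rw [inner_smul_right, inner_sub_right, inner_smul_right, hg, ha]
    cases m with
    | zero => simp
    | succ m =>
      have e : ladderWeight lam (m + 1) * Real.sqrt ((m + 1) / (lam + m)) = m + 1 := by
        rw [ladderWeight_succ, ← Real.sqrt_mul (by positivity)]
        have : ((m : ℝ) + 1) * (lam + m) * ((m + 1) / (lam + m)) = (m + 1) ^ 2 := by
          field_simp
        rw [this, Real.sqrt_sq (by positivity)]
      have e' : (ladderWeight lam (m + 1) : ℂ) * ((Real.sqrt ((m + 1) / (lam + m)) : ℝ) : ℂ) =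
          m + 1 := by exact_mod_cast e
      rw [Nat.add_sub_cancel, ← mul_assoc, e']
      push_cast
      ring

theorem annihilation_basis_zero (ha : ∀ x (m : ℕ), inner ℂ (b m) (a x) =
      ((Real.sqrt ((m + 1) / (lam + m)) : ℝ) : ℂ) * inner ℂ (b (m + 1)) x) : a (b 0) = 0 :=
  ext_basis b fun m => by rw [ha, inner_basis]; simp

theorem annihilation_basis_succ (ha : ∀ x (m : ℕ), inner ℂ (b m) (a x) =
      ((Real.sqrt ((m + 1) / (lam + m)) : ℝ) : ℂ) * inner ℂ (b (m + 1)) x) (n : ℕ) :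
    a (b (n + 1)) = ((Real.sqrt ((n + 1) / (lam + n)) : ℝ) : ℂ) • b n := by
  refine ext_basis b fun m => ?_
  rw [ha, inner_smul_right, inner_basis, inner_basis]
  by_cases hmn : m = n
  · subst hmn
    simp
  · simp [hmn]

theorem annihilation_coeff_succ (hl : 0 < lam) (ha : ∀ x (m : ℕ), inner ℂ (b m) (a x) =
      ((Real.sqrt ((m + 1) / (lam + m)) : ℝ) : ℂ) * inner ℂ (b (m + 1)) x) {z : ℂ} {v : H}
    (hv : a v = z • v) (m : ℕ) : inner ℂ (b (m + 1)) v =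
      z / ((Real.sqrt ((m + 1) / (lam + m)) : ℝ) : ℂ) * inner ℂ (b m) v := by
  have h1 := ha v m
  have hs : ((Real.sqrt ((m + 1) / (lam + m)) : ℝ) : ℂ) ≠ 0 := by
    have : 0 < Real.sqrt ((m + 1) / (lam + m)) := by positivity
    exact_mod_cast this.ne'
  rw [hv, inner_smul_right] at h1
  field_simp
  rw [h1]
  ring

/-- The eigenvalues of the annihilation operator lie in the open unit disc: an eigenvector to `z`
with `1 ≤ |z|` would satisfy `(m + 1) |v (m + 1)|² ≥ (lam + m) |v m|²`, so that its coefficients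
would not be square summable. -/
theorem norm_lt_one_of_eigenvector (hl : 0 < lam) (ha : ∀ x (m : ℕ), inner ℂ (b m) (a x) =
      ((Real.sqrt ((m + 1) / (lam + m)) : ℝ) : ℂ) * inner ℂ (b (m + 1)) x) {z : ℂ} {v : H}
    (hv : a v = z • v) (hv0 : v ≠ 0) : ‖z‖ < 1 := by
  by_contra hz
  rw [not_lt] at hz
  have hc := annihilation_coeff_succ hl ha hv
  have h0 : inner ℂ (b 0) v ≠ (0 : ℂ) := by
    intro h0
    refine hv0 (ext_basis b fun m => ?_)
    rw [inner_zero_right]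
    induction m with
    | zero => exact h0
    | succ m ih => rw [hc, ih, mul_zero]
  have hstep : ∀ m : ℕ, (lam + m) * ‖inner ℂ (b m) v‖ ^ 2 ≤
      (m + 1) * ‖inner ℂ (b (m + 1)) v‖ ^ 2 := by
    intro m
    have hq : (0 : ℝ) < (m + 1) / (lam + m) := by positivity
    rw [hc, norm_mul, norm_div, Complex.norm_real, Real.norm_of_nonneg (Real.sqrt_nonneg _), mul_pow,
      div_pow, Real.sq_sqrt hq.le]
    have e : ((m : ℝ) + 1) * (‖z‖ ^ 2 / ((m + 1) / (lam + m)) * ‖inner ℂ (b m) v‖ ^ 2) =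
        ‖z‖ ^ 2 * ((lam + m) * ‖inner ℂ (b m) v‖ ^ 2) := by
      field_simp
    rw [e]
    exact le_mul_of_one_le_left (by positivity) (one_le_pow₀ hz)
  have hlow : ∀ m : ℕ, lam * ‖inner ℂ (b 0) v‖ ^ 2 ≤ (m + 1) * ‖inner ℂ (b (m + 1)) v‖ ^ 2 := by
    intro m
    induction m with
    | zero => simpa using hstep 0
    | succ m ih =>
      refine ih.trans (le_trans ?_ (hstep (m + 1)))
      push_cast
      exact mul_le_mul_of_nonneg_right (by linarith) (sq_nonneg _)
  have hpos : 0 < lam * ‖inner ℂ (b 0) v‖ ^ 2 := by positivity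
  have hs : Summable fun m : ℕ => ‖inner ℂ (b (m + 1)) v‖ ^ 2 :=
    (b.orthonormal.comp _ (add_left_injective 1)).inner_products_summable v
  have hs2 : Summable fun m : ℕ => lam * ‖inner ℂ (b 0) v‖ ^ 2 * (1 / ((m + 1 : ℕ) : ℝ)) := by
    refine hs.of_nonneg_of_le (fun m => by positivity) fun m => ?_
    rw [mul_one_div, div_le_iff₀ (by positivity)]
    push_cast
    rw [mul_comm (‖inner ℂ (b (m + 1)) v‖ ^ 2)]
    exact hlow m
  have hs3 := (summable_mul_left_iff hpos.ne').1 hs2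
  exact Real.not_summable_one_div_natCast ((summable_nat_add_iff 1).1 hs3)

/-- The two-term recursion determines an eigenvector by its component along `b 0`. -/
theorem eigenvector_unique (hl : 0 < lam) (ha : ∀ x (m : ℕ), inner ℂ (b m) (a x) =
      ((Real.sqrt ((m + 1) / (lam + m)) : ℝ) : ℂ) * inner ℂ (b (m + 1)) x) {z : ℂ} {v w : H}
    (hv : a v = z • v) (hw : a w = z • w) (hv0 : v ≠ 0) : ∃ c : ℂ, w = c • v := by
  have hcv := annihilation_coeff_succ hl ha hv
  have hcw := annihilation_coeff_succ hl ha hw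
  have h0 : inner ℂ (b 0) v ≠ (0 : ℂ) := by
    intro h0
    refine hv0 (ext_basis b fun m => ?_)
    rw [inner_zero_right]
    induction m with
    | zero => exact h0
    | succ m ih => rw [hcv, ih, mul_zero]
  refine ⟨inner ℂ (b 0) w / inner ℂ (b 0) v, ext_basis b fun m => ?_⟩
  rw [inner_smul_right]
  induction m with
  | zero => field_simp
  | succ m ih =>
    rw [hcv, hcw, ih]
    ring

/-- The number `1` lies outside the open unit disc, hence is no eigenvalue of `a`. -/
theorem annihilation_sub_injective (hl : 0 < lam) (ha : ∀ x (m : ℕ), inner ℂ (b m) (a x) =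
      ((Real.sqrt ((m + 1) / (lam + m)) : ℝ) : ℂ) * inner ℂ (b (m + 1)) x) :
    Function.Injective (fun v : H => a v - v) := by
  intro v w hvw
  by_contra hne
  have h1 : a (v - w) = (1 : ℂ) • (v - w) := by
    simp only at hvw
    rw [map_sub, one_smul, sub_eq_sub_iff_sub_eq_sub]
    exact hvw
  have := norm_lt_one_of_eigenvector hl ha h1 (sub_ne_zero.2 hne)
  simp at this

theorem mem_cayleyGraph {W : Submodule ℂ H} {p : H × H} : p ∈ cayleyGraph a W ↔
    p.1 ∈ W ∧ ∃ v : H, a v - v = p.1 ∧ p.2 = -Complex.I • (a v + v) := Iff.rfl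

/-- The closure of the Cayley transform of `a` on the finite linear combinations of weight vectors
is its Cayley transform on the whole range of `a - 1`. -/
theorem exists_isOperatorA (hl : 0 < lam) (ha : ∀ x (m : ℕ), inner ℂ (b m) (a x) =
      ((Real.sqrt ((m + 1) / (lam + m)) : ℝ) : ℂ) * inner ℂ (b (m + 1)) x) :
    ∃ A : H →ₗ.[ℂ] H, IsOperatorA b a A ∧ ∀ f g, (f, g) ∈ A.graph ↔
      ∃ v, a v - v = f ∧ g = -Complex.I • (a v + v) := by
  have hinj := annihilation_sub_injective hl ha
  have hgraph : (cayleyGraph a ⊤).toLinearPMap.graph = cayleyGraph a ⊤ := by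
    refine Submodule.toLinearPMap_graph_eq _ ?_
    rintro ⟨f, g⟩ ⟨-, v, hv, hg⟩ h0
    dsimp only at *
    have hv0 : v = 0 := hinj (by simp only [map_zero, sub_zero]; rw [hv, h0])
    rw [hg, hv0, map_zero, add_zero, smul_zero]
  have hmem : ∀ v ∈ Submodule.span ℂ (range b), a v - v ∈ Submodule.span ℂ (range b) := by
    intro v hv
    refine Submodule.sub_mem _ ?_ hv
    refine Submodule.span_induction ?_ (by simp) ?_ ?_ hv
    · rintro _ ⟨n, rfl⟩
      cases n with
      | zero => rw [annihilation_basis_zero ha]; exact Submodule.zero_mem _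
      | succ n =>
        rw [annihilation_basis_succ ha]
        exact Submodule.smul_mem _ _ (Submodule.subset_span ⟨n, rfl⟩)
    · intro x y _ _ hx hy
      rw [map_add]
      exact Submodule.add_mem _ hx hy
    · intro c x _ hx
      rw [map_smul]
      exact Submodule.smul_mem _ c hx
  refine ⟨(cayleyGraph a ⊤).toLinearPMap, ⟨hinj, ?_, ?_⟩, fun f g => ?_⟩
  -- `(a - 1) b (n + 1)` is a multiple of `b n` minus `b (n + 1)`, so all `b n` are reached
  · have hrange : Submodule.span ℂ (range b) ≤
        LinearMap.range ((a - ContinuousLinearMap.id ℂ H : H →L[ℂ] H) : H →ₗ[ℂ] H) := by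
      rw [Submodule.span_le]
      rintro _ ⟨n, rfl⟩
      induction n with
      | zero =>
        refine ⟨-b 0, ?_⟩
        simp [annihilation_basis_zero ha]
      | succ n ih =>
        have h1 := Submodule.sub_mem _ (Submodule.smul_mem _
          ((Real.sqrt ((n + 1) / (lam + n)) : ℝ) : ℂ) ih) (LinearMap.mem_range_self
          ((a - ContinuousLinearMap.id ℂ H : H →L[ℂ] H) : H →ₗ[ℂ] H) (b (n + 1)))
        convert h1 using 1
        simp [annihilation_basis_succ ha]
    intro f hf
    obtain ⟨v, hv⟩ := hrange hf
    exact ⟨(f, -Complex.I • (a v + v)), ⟨hf, v, by simpa using hv, rfl⟩, rfl⟩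
  · rw [hgraph]
    refine le_antisymm ?_ ?_
    · rintro ⟨f, g⟩ ⟨-, v, hv, hg⟩
      dsimp only at hv hg
      subst hv hg
      have hcont : Continuous fun v : H => (a v - v, -Complex.I • (a v + v)) := by fun_prop
      have hd : v ∈ closure (Submodule.span ℂ (range b) : Set H) := by
        rw [← Submodule.topologicalClosure_coe, b.dense_span]
        trivial
      exact map_mem_closure (f := fun v : H => (a v - v, -Complex.I • (a v + v))) hcont hd
        fun w hw => ⟨hmem w hw, w, rfl, rfl⟩
    · refine Submodule.topologicalClosure_minimal _
        (fun p hp => ⟨trivial, hp.2⟩) ?_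
      -- the vector `v` is recovered from the pair as `(i g - f) / 2`
      have hset : (cayleyGraph a ⊤ : Set (H × H)) =
          {p | a ((1 / 2 : ℂ) • (Complex.I • p.2 - p.1)) - (1 / 2 : ℂ) • (Complex.I • p.2 - p.1) =
            p.1} ∩ {p | p.2 = -Complex.I • (a ((1 / 2 : ℂ) • (Complex.I • p.2 - p.1)) +
              (1 / 2 : ℂ) • (Complex.I • p.2 - p.1))} := by
        ext ⟨f, g⟩
        constructor
        · rintro ⟨-, v, hv, hg⟩
          dsimp only at hv hg
          have e : (1 / 2 : ℂ) • (Complex.I • g - f) = v := by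
            rw [hg, ← hv, smul_smul, mul_neg, Complex.I_mul_I]
            module
          exact ⟨by simpa only [mem_ofPred_eq, e] using hv, by simpa only [mem_ofPred_eq, e] using hg⟩
        · rintro ⟨h1, h2⟩
          exact ⟨trivial, _, h1, h2⟩
      rw [hset]
      exact (isClosed_eq (by fun_prop) (by fun_prop)).inter (isClosed_eq (by fun_prop) (by fun_prop))
  · rw [hgraph, mem_cayleyGraph]
    simp

/-- The eigenvectors of the Cayley transform of `a` are those of `a`, the eigenvalue `η` being
carried to the point `(η - i) / (η + i)` of the unit disc. -/
theorem cayley_eigenvector_iff {η : ℂ} {f : H} (hf : f ≠ 0) :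
    (∃ v, a v - v = f ∧ η • f = -Complex.I • (a v + v)) ↔
      η + Complex.I ≠ 0 ∧ a f = ((η - Complex.I) / (η + Complex.I)) • f := by
  constructor
  · rintro ⟨v, rfl, hv⟩
    have h1 : (η + Complex.I) • a v = (η - Complex.I) • v := by
      rw [smul_sub, smul_add] at hv
      rw [add_smul, sub_smul]
      rw [← sub_eq_zero] at hv ⊢
      rw [← hv]
      module
    have hne : η + Complex.I ≠ 0 := by
      intro h0
      rw [h0, zero_smul] at h1
      have h2 : η - Complex.I ≠ 0 := by
        rw [eq_neg_of_add_eq_zero_left h0]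
        intro h3
        have := congrArg Complex.im h3
        norm_num at this
      have hv0 := (smul_eq_zero.1 h1.symm).resolve_left h2
      exact hf (by rw [hv0, map_zero, sub_zero])
    have h2 : a v = ((η - Complex.I) / (η + Complex.I)) • v := by
      rw [div_eq_inv_mul, mul_smul, ← h1, smul_smul, inv_mul_cancel₀ hne, one_smul]
    refine ⟨hne, ?_⟩
    rw [map_sub, h2, map_smul, h2, smul_sub]
  -- on the eigenspace, `a - 1` is multiplication by `-2i / (η + i)`
  · rintro ⟨hne, h1⟩
    refine ⟨(-(η + Complex.I) / (2 * Complex.I)) • f, ?_, ?_⟩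
    · rw [map_smul, h1, smul_smul, ← sub_smul]
      have : -(η + Complex.I) / (2 * Complex.I) * ((η - Complex.I) / (η + Complex.I)) -
          -(η + Complex.I) / (2 * Complex.I) = 1 := by
        have := Complex.I_ne_zero
        field_simp
        ring
      rw [this, one_smul]
    · rw [map_smul, h1, smul_smul, ← add_smul, smul_smul]
      congr 1
      have := Complex.I_ne_zero
      field_simp
      ring

theorem im_pos_of_norm_lt_one {η : ℂ} (hne : η + Complex.I ≠ 0)
    (h : ‖(η - Complex.I) / (η + Complex.I)‖ < 1) : 0 < η.im := by
  rw [norm_div, div_lt_one (norm_pos_iff.2 hne)] at h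
  have h2 : ‖η - Complex.I‖ ^ 2 < ‖η + Complex.I‖ ^ 2 := by gcongr
  rw [Complex.sq_norm, Complex.sq_norm, Complex.normSq_apply, Complex.normSq_apply] at h2
  simp at h2
  nlinarith

end Annihilation

/-! ### Classification of the representations of lowest-weight-type -/

section Classification

variable {H : Type*} [NormedAddCommGroup H] [InnerProductSpace ℂ H]

/-- A sequence with unit first member on which the raising and lowering operators are formally
skew-adjoint is orthonormal. -/
theorem orthonormal_of_ladder {b : ℕ → H} {lam : ℝ} (hl : 0 < lam) (h0 : ‖b 0‖ = 1)
    (h : ∀ n m, (ladderWeight lam (n + 1) : ℂ) * inner ℂ (b (n + 1)) (b m) =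
      ladderWeight lam m * inner ℂ (b n) (b (m - 1))) : Orthonormal ℂ b := by
  have hw : ∀ n, (ladderWeight lam (n + 1) : ℂ) ≠ 0 := fun n => by
    exact_mod_cast (ladderWeight_succ_pos hl n).ne'
  have hs : ∀ n, inner ℂ (b (n + 1)) (b 0) = (0 : ℂ) := by
    intro n
    have := h n 0
    rw [ladderWeight_zero, Complex.ofReal_zero, zero_mul, mul_eq_zero] at this
    exact this.resolve_left (hw n)
  rw [orthonormal_iff_ite]
  intro n
  induction n with
  | zero =>
    intro m
    cases m with
    | zero => rw [inner_self_eq_norm_sq_to_K, h0]; simp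
    | succ m => rw [← inner_conj_symm, hs]; simp
  | succ n ih =>
    intro m
    cases m with
    | zero => rw [hs]; simp
    | succ m =>
      have h1 := h n (m + 1)
      rw [Nat.add_sub_cancel, ih] at h1
      by_cases hmn : n = m
      · subst hmn
        simpa [hw] using h1
      · simpa [hw, hmn] using h1

variable {E0 Ep Em : H →ₗ.[ℂ] H}

theorem exists_restrict {E : H →ₗ.[ℂ] H} (hE : E ∈ ({E0, Ep, Em} : Set (H →ₗ.[ℂ] H))) :
    ∃ e : smoothDomain E0 Ep Em →ₗ[ℂ] smoothDomain E0 Ep Em,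
      ∀ x : smoothDomain E0 Ep Em, ((x : H), (e x : H)) ∈ E.graph := by
  have h : ∀ x : smoothDomain E0 Ep Em, ∃ y : smoothDomain E0 Ep Em, ((x : H), (y : H)) ∈ E.graph :=
    fun x => by
      obtain ⟨y, hy, hxy⟩ := smoothDomain_invariant hE x.2
      exact ⟨⟨y, hy⟩, hxy⟩
  choose f hf using h
  exact ⟨{ toFun := f
           map_add' := fun x y => Subtype.ext
            (graph_unique (hf (x + y)) (E.graph.add_mem (hf x) (hf y)))
           map_smul' := fun c x => Subtype.ext
            (graph_unique (hf (c • x)) (E.graph.smul_mem c (hf x))) }, hf⟩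

theorem CommutatorEqOn.apply {D : Submodule ℂ H} {X Y Z : H →ₗ.[ℂ] H} (h : CommutatorEqOn D X Y Z)
    {x y : D →ₗ[ℂ] D} (hx : ∀ v : D, ((v : H), (x v : H)) ∈ X.graph)
    (hy : ∀ v : D, ((v : H), (y v : H)) ∈ Y.graph) {v z : D} (hz : ((v : H), (z : H)) ∈ Z.graph) :
    x (y v) = y (x v) + z := by
  obtain ⟨p, q, r, s, h1, h2, h3, h4, h5⟩ := h v v.2
  have e1 := graph_unique h1 (hy v)
  have e3 := graph_unique h3 (hx v)
  subst e1 e3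
  have e2 := graph_unique h2 (hx _)
  have e4 := graph_unique h4 (hy _)
  subst e2 e4
  have e5 := graph_unique h5 hz
  refine Subtype.ext ?_
  rw [Submodule.coe_add, ← e5]
  abel

/-- The action of the ladder operators `L₀, L₊, L₋` on the space of smooth vectors of a unitary
representation. -/
structure LadderAction (E0 Ep Em : H →ₗ.[ℂ] H) where
  /-- The restriction of `L₀`. -/
  l0 : smoothDomain E0 Ep Em →ₗ[ℂ] smoothDomain E0 Ep Em
  /-- The restriction of `L₊`. -/
  lp : smoothDomain E0 Ep Em →ₗ[ℂ] smoothDomain E0 Ep Em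
  /-- The restriction of `L₋`. -/
  lm : smoothDomain E0 Ep Em →ₗ[ℂ] smoothDomain E0 Ep Em
  mem_l0 : ∀ v : smoothDomain E0 Ep Em, ((v : H), (l0 v : H)) ∈ (opL0 Ep Em).graph
  mem_lp : ∀ v : smoothDomain E0 Ep Em, ((v : H), (lp v : H)) ∈ (opLp E0 Ep Em).graph
  mem_lm : ∀ v : smoothDomain E0 Ep Em, ((v : H), (lm v : H)) ∈ (opLm E0 Ep Em).graph
  mem_E0 : ∀ v : smoothDomain E0 Ep Em,
    ((v : H), ((lp v + lm v : smoothDomain E0 Ep Em) : H)) ∈ E0.graph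
  mem_Ep : ∀ v : smoothDomain E0 Ep Em,
    ((v : H), (((-Complex.I / 2) • (lp v - lm v) + (Complex.I / 2) • l0 v :
      smoothDomain E0 Ep Em) : H)) ∈ Ep.graph
  mem_Em : ∀ v : smoothDomain E0 Ep Em,
    ((v : H), (((-Complex.I / 2) • (lp v - lm v) + (-Complex.I / 2) • l0 v :
      smoothDomain E0 Ep Em) : H)) ∈ Em.graph
  lm_lp : ∀ v, lm (lp v) = lp (lm v) - l0 v
  l0_lp : ∀ v, l0 (lp v) = lp (l0 v) + (2 : ℂ) • lp v
  l0_lm : ∀ v, l0 (lm v) = lm (l0 v) - (2 : ℂ) • lm v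
  inner_lp : ∀ u v : smoothDomain E0 Ep Em, inner ℂ (lp u : H) (v : H) = -inner ℂ (u : H) (lm v : H)
  inner_l0 : ∀ u v : smoothDomain E0 Ep Em, inner ℂ (l0 u : H) (v : H) = inner ℂ (u : H) (l0 v : H)

theorem LadderAction.mem_ker_minus (L : LadderAction E0 Ep Em) {v : H} :
    v ∈ kerOn (smoothDomain E0 Ep Em) (opLm E0 Ep Em) ↔
      ∃ hv : v ∈ smoothDomain E0 Ep Em, L.lm ⟨v, hv⟩ = 0 := by
  rw [mem_kerOn]
  constructor
  · rintro ⟨hv, h⟩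
    exact ⟨hv, Subtype.ext (graph_unique (L.mem_lm ⟨v, hv⟩) h)⟩
  · rintro ⟨hv, h⟩
    have := L.mem_lm ⟨v, hv⟩
    rw [h] at this
    exact ⟨hv, this⟩

variable [CompleteSpace H]

theorem IsUnitaryRep.exists_ladderAction (h : IsUnitaryRep E0 Ep Em) :
    Nonempty (LadderAction E0 Ep Em) := by
  obtain ⟨e0, h0⟩ := exists_restrict (E0 := E0) (Ep := Ep) (Em := Em) (E := E0) (by simp)
  obtain ⟨ep, hp⟩ := exists_restrict (E0 := E0) (Ep := Ep) (Em := Em) (E := Ep) (by simp)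
  obtain ⟨em, hm⟩ := exists_restrict (E0 := E0) (Ep := Ep) (Em := Em) (E := Em) (by simp)
  have c1 : ∀ v, e0 (ep v) = ep (e0 v) + (2 : ℂ) • ep v := fun v =>
    h.comm_zero_plus.apply h0 hp (mem_graph_smul.2 ⟨_, hp v, rfl⟩)
  have c2 : ∀ v, e0 (em v) = em (e0 v) + (-2 : ℂ) • em v := fun v =>
    h.comm_zero_minus.apply h0 hm (mem_graph_smul.2 ⟨_, hm v, rfl⟩)
  have c3 : ∀ v, ep (em v) = em (ep v) + e0 v := fun v =>
    h.comm_plus_minus.apply hp hm (h0 v)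
  have hI : Complex.I ^ 2 = -1 := Complex.I_sq
  have s0 : ∀ u v : smoothDomain E0 Ep Em, inner ℂ (e0 u : H) (v : H) = -inner ℂ (u : H) (e0 v : H) := fun u v =>
    h.skew_zero.inner_skew (h0 u) (h0 v)
  have sp : ∀ u v : smoothDomain E0 Ep Em, inner ℂ (ep u : H) (v : H) = -inner ℂ (u : H) (ep v : H) := fun u v =>
    h.skew_plus.inner_skew (hp u) (hp v)
  have sm : ∀ u v : smoothDomain E0 Ep Em, inner ℂ (em u : H) (v : H) = -inner ℂ (u : H) (em v : H) := fun u v =>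
    h.skew_minus.inner_skew (hm u) (hm v)
  refine ⟨{
    l0 := Complex.I • (em - ep)
    lp := (1 / 2 : ℂ) • (e0 + Complex.I • (ep + em))
    lm := (1 / 2 : ℂ) • (e0 - Complex.I • (ep + em))
    mem_l0 := fun v => mem_graph_smul.2 ⟨_, mem_graph_sub.2 ⟨_, _, hm v, hp v, rfl⟩, rfl⟩
    mem_lp := fun v => mem_graph_smul.2 ⟨_, mem_graph_add.2 ⟨_, _, h0 v, mem_graph_smul.2
      ⟨_, mem_graph_add.2 ⟨_, _, hp v, hm v, rfl⟩, rfl⟩, rfl⟩, rfl⟩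
    mem_lm := fun v => mem_graph_smul.2 ⟨_, mem_graph_sub.2 ⟨_, _, h0 v, mem_graph_smul.2
      ⟨_, mem_graph_add.2 ⟨_, _, hp v, hm v, rfl⟩, rfl⟩, rfl⟩, rfl⟩
    mem_E0 := fun v => ?_
    mem_Ep := fun v => ?_
    mem_Em := fun v => ?_
    lm_lp := fun v => ?_
    l0_lp := fun v => ?_
    l0_lm := fun v => ?_
    inner_lp := fun u v => ?_
    inner_l0 := fun u v => ?_ }⟩
  · convert h0 v using 3
    simp only [LinearMap.smul_apply, LinearMap.add_apply, LinearMap.sub_apply]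
    module
  · convert hp v using 3
    simp only [LinearMap.smul_apply, LinearMap.add_apply, LinearMap.sub_apply]
    match_scalars
    all_goals ring_nf
    all_goals simp only [hI]
    all_goals ring
  · convert hm v using 3
    simp only [LinearMap.smul_apply, LinearMap.add_apply, LinearMap.sub_apply]
    match_scalars
    all_goals ring_nf
    all_goals simp only [hI]
    all_goals ring
  · simp only [LinearMap.smul_apply, LinearMap.add_apply, LinearMap.sub_apply, map_smul, map_add,
      map_sub, c1, c2, c3]
    match_scalars <;> ring_nf
  · simp only [LinearMap.smul_apply, LinearMap.add_apply, LinearMap.sub_apply, map_smul, map_add,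
      map_sub, c1, c2, c3]
    match_scalars
    all_goals ring_nf
    all_goals simp only [hI]
    all_goals ring
  · simp only [LinearMap.smul_apply, LinearMap.add_apply, LinearMap.sub_apply, map_smul, map_add,
      map_sub, c1, c2, c3]
    match_scalars
    all_goals ring_nf
    all_goals simp only [hI]
    all_goals ring
  · simp only [LinearMap.smul_apply, LinearMap.add_apply, LinearMap.sub_apply, Submodule.coe_smul,
      Submodule.coe_add, Submodule.coe_sub, inner_smul_left, inner_smul_right, inner_add_left,
      inner_add_right, inner_sub_right, s0, sp, sm, Complex.conj_I, map_div₀,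
      map_one, map_ofNat]
    ring
  · simp only [LinearMap.smul_apply, LinearMap.sub_apply, Submodule.coe_smul,
      Submodule.coe_sub, inner_smul_left, inner_smul_right,
      inner_sub_left, inner_sub_right, sp, sm, Complex.conj_I]
    ring

/-- The kernel of `L₋` is one-dimensional and invariant under the symmetric operator `L₀`. -/
theorem IsLowestWeightIrrep.exists_lowestWeight (h : IsLowestWeightIrrep E0 Ep Em) :
    ∃ lam : ℝ, HasLowestWeight E0 Ep Em lam := by
  obtain ⟨L⟩ := h.rep.exists_ladderAction
  obtain ⟨⟨v, hv⟩, hv0, hall⟩ := finrank_eq_one_iff'.1 h.ker_minus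
  have hv0' : v ≠ 0 := fun h0 => hv0 (Subtype.ext h0)
  obtain ⟨hvS, hlm⟩ := L.mem_ker_minus.1 hv
  have h1 : (L.l0 ⟨v, hvS⟩ : H) ∈ kerOn (smoothDomain E0 Ep Em) (opLm E0 Ep Em) := by
    refine L.mem_ker_minus.2 ⟨Subtype.mem _, ?_⟩
    have := L.l0_lm ⟨v, hvS⟩
    rw [hlm, map_zero, smul_zero, sub_zero] at this
    exact this.symm
  obtain ⟨c, hc⟩ := hall ⟨_, h1⟩
  have hc' : c • v = (L.l0 ⟨v, hvS⟩ : H) := congrArg Subtype.val hc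
  have hreal := L.inner_l0 ⟨v, hvS⟩ ⟨v, hvS⟩
  rw [← hc', inner_smul_left, inner_smul_right] at hreal
  have hre : (starRingEnd ℂ) c = c := mul_right_cancel₀ (inner_self_ne_zero.2 hv0') hreal
  refine ⟨c.re, v, hv, hv0', ?_⟩
  rw [Complex.conj_eq_iff_re.1 hre, hc']
  exact L.mem_l0 ⟨v, hvS⟩

theorem IsLowestWeightIrrep.lowestWeight_unique (h : IsLowestWeightIrrep E0 Ep Em) {lam lam' : ℝ}
    (h1 : HasLowestWeight E0 Ep Em lam) (h2 : HasLowestWeight E0 Ep Em lam') : lam = lam' := by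
  obtain ⟨v, hv, hv0, hvg⟩ := h1
  obtain ⟨w, hw, hw0, hwg⟩ := h2
  obtain ⟨⟨u, hu⟩, hu0, hall⟩ := finrank_eq_one_iff'.1 h.ker_minus
  obtain ⟨c, hc⟩ := hall ⟨v, hv⟩
  obtain ⟨d, hd⟩ := hall ⟨w, hw⟩
  have hc' : c • u = v := congrArg Subtype.val hc
  have hd' : d • u = w := congrArg Subtype.val hd
  have hc0 : c ≠ 0 := fun h0 => hv0 (by rw [← hc', h0, zero_smul])
  have h3 : w = (d / c) • v := by
    rw [← hc', ← hd', smul_smul, div_mul_cancel₀ d hc0]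
  have h4 := (opL0 Ep Em).graph.smul_mem (d / c) hvg
  rw [Prod.smul_mk, ← h3, smul_comm, ← h3] at h4
  exact_mod_cast smul_left_injective ℂ hw0 (graph_unique h4 hwg)

/-- Starting from a unit vector of lowest weight, the raising operator produces a Hilbert basis in
which the three operators have their tridiagonal matrices: the closed span of the orbit reduces the
representation because the matrices on the orbit are essentially skew-adjoint. -/
theorem IsLowestWeightIrrep.exists_ladderTriple (h : IsLowestWeightIrrep E0 Ep Em) {lam : ℝ}
    (hlam : HasLowestWeight E0 Ep Em lam) :
    0 < lam ∧ ∃ b : HilbertBasis ℕ ℂ H, IsLadderTriple b lam E0 Ep Em := by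
  obtain ⟨L⟩ := h.rep.exists_ladderAction
  obtain ⟨v, hv, hv0, hvg⟩ := hlam
  obtain ⟨hvS, hlm⟩ := L.mem_ker_minus.1 hv
  have hl0 : L.l0 ⟨v, hvS⟩ = (lam : ℂ) • ⟨v, hvS⟩ :=
    Subtype.ext (graph_unique (L.mem_l0 ⟨v, hvS⟩) hvg)
  have hl : 0 < lam := by
    -- `‖L₊ v‖² = lam ‖v‖²` by the commutation relations, and `L₊ v ≠ 0`
    have h1 := L.inner_lp ⟨v, hvS⟩ (L.lp ⟨v, hvS⟩)
    rw [L.lm_lp, hlm, map_zero, zero_sub, hl0, Submodule.coe_neg, Submodule.coe_smul,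
      inner_neg_right, neg_neg, inner_smul_right, inner_self_eq_norm_sq_to_K,
      inner_self_eq_norm_sq_to_K] at h1
    have h2 : ‖(L.lp ⟨v, hvS⟩ : H)‖ ^ 2 = lam * ‖v‖ ^ 2 := by
      refine Complex.ofReal_injective ?_
      rw [Complex.ofReal_mul, Complex.ofReal_pow, Complex.ofReal_pow]
      exact h1
    have h3 : (L.lp ⟨v, hvS⟩ : H) ≠ 0 := by
      intro h0
      have h4 : v ∈ kerOn (smoothDomain E0 Ep Em) (opLp E0 Ep Em) := by
        have := L.mem_lp ⟨v, hvS⟩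
        rw [h0] at this
        exact mem_kerOn.2 ⟨hvS, this⟩
      rw [h.ker_plus] at h4
      exact hv0 h4
    have h5 : 0 < lam * ‖v‖ ^ 2 := by rw [← h2]; positivity
    exact pos_of_mul_pos_left h5 (sq_nonneg _)
  refine ⟨hl, ?_⟩
  have hw : ∀ n, (ladderWeight lam (n + 1) : ℂ) ≠ 0 := fun n => by
    exact_mod_cast (ladderWeight_succ_pos hl n).ne'
  -- the normalised orbit of the lowest weight vector under the raising operator
  let s : ℕ → smoothDomain E0 Ep Em := fun n => Nat.rec (((‖v‖ : ℂ)⁻¹) • ⟨v, hvS⟩)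
    (fun n x => ((ladderWeight lam (n + 1) : ℂ))⁻¹ • L.lp x) n
  have hs0 : s 0 = ((‖v‖ : ℂ)⁻¹) • ⟨v, hvS⟩ := rfl
  have hlp : ∀ n, L.lp (s n) = (ladderWeight lam (n + 1) : ℂ) • s (n + 1) := by
    intro n
    change _ = (ladderWeight lam (n + 1) : ℂ) • ((ladderWeight lam (n + 1) : ℂ))⁻¹ • L.lp (s n)
    rw [smul_smul, mul_inv_cancel₀ (hw n), one_smul]
  clear_value s
  have hl0s : ∀ n : ℕ, L.l0 (s n) = (lam + 2 * n : ℂ) • s n := by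
    intro n
    induction n with
    | zero =>
      rw [hs0, map_smul, hl0]
      simp only [Nat.cast_zero]
      module
    | succ n ih =>
      refine smul_right_injective _ (hw n) ?_
      simp only
      rw [← map_smul, smul_comm, ← hlp, L.l0_lp, ih, map_smul]
      push_cast
      module
  have hlms : ∀ n : ℕ, L.lm (s n) = -(ladderWeight lam n : ℂ) • s (n - 1) := by
    intro n
    induction n with
    | zero => rw [hs0, map_smul, hlm]; simp
    | succ n ih =>
      refine smul_right_injective _ (hw n) ?_
      simp only
      rw [← map_smul, ← hlp, L.lm_lp, ih, map_smul, hl0s, Nat.add_sub_cancel]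
      have e : (ladderWeight lam (n + 1) : ℂ) ^ 2 = ladderWeight lam n ^ 2 + (lam + 2 * n) := by
        have : ladderWeight lam (n + 1) ^ 2 = ladderWeight lam n ^ 2 + (lam + 2 * n) := by
          rw [ladderWeight_succ_sq hl, ladderWeight_sq hl]
          ring
        exact_mod_cast this
      cases n with
      | zero =>
        rw [smul_smul, mul_neg, ← sq, e]
        simp
      | succ n =>
        rw [Nat.add_sub_cancel, hlp, smul_smul, smul_smul, mul_neg, ← sq, e]
        module
  have horth : Orthonormal ℂ (fun n => (s n : H)) := by
    refine orthonormal_of_ladder hl ?_ fun n m => ?_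
    · rw [hs0, Submodule.coe_smul, norm_smul, norm_inv, Complex.norm_real, norm_norm]
      exact inv_mul_cancel₀ (norm_ne_zero_iff.2 hv0)
    · have h1 := L.inner_lp (s n) (s m)
      rw [hlp, hlms, Submodule.coe_smul, Submodule.coe_smul, inner_smul_left, inner_smul_right,
        Complex.conj_ofReal] at h1
      rw [h1]
      ring
  have hmem : ∀ n, ((s n : H), ladderVec (fun n => (s n : H)) lam 1 0 n) ∈ E0.graph ∧
      ((s n : H), ladderVec (fun n => (s n : H)) lam (-Complex.I / 2) (Complex.I / 2) n) ∈
        Ep.graph ∧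
      ((s n : H), ladderVec (fun n => (s n : H)) lam (-Complex.I / 2) (-Complex.I / 2) n) ∈
        Em.graph := by
    intro n
    refine ⟨?_, ?_, ?_⟩
    · convert L.mem_E0 (s n) using 2
      simp only [hlp, hlms, ladderVec, map_one, Submodule.coe_add, Submodule.coe_smul]
      module
    · convert L.mem_Ep (s n) using 2
      simp only [hlp, hlms, hl0s, ladderVec, conj_neg_I_half, Submodule.coe_add, Submodule.coe_smul,
        Submodule.coe_sub]
      module
    · convert L.mem_Em (s n) using 2
      simp only [hlp, hlms, hl0s, ladderVec, conj_neg_I_half, Submodule.coe_add, Submodule.coe_smul,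
        Submodule.coe_sub]
      module
  -- by the cut-off argument, the projection to the closed span of the orbit preserves the graph of
  -- each skew-adjoint operator with the tridiagonal matrix
  have hred : ∀ {α β : ℂ} {E : H →ₗ.[ℂ] H}, (starRingEnd ℂ) β = -β → IsSkewAdjoint E →
      (∀ n, ((s n : H), ladderVec (fun n => (s n : H)) lam α β n) ∈ E.graph) →
      Reduces (Submodule.span ℂ (range fun n => (s n : H))).topologicalClosure E := by
    intro α β E hβ hE hs x y hxy
    obtain ⟨p, q, -, hpq, hp, hq⟩ := exists_tendsto_of_ladder horth hl (G := E.graph) hs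
      (x := x) (y := y) (fun m => by
        have := hE.inner_skew (hs m) hxy
        rw [inner_ladderVec_left _ lam hβ] at this
        exact (neg_injective this).symm)
    exact hE.graph_closed hpq hp hq
  have hK : (Submodule.span ℂ (range fun n => (s n : H))).topologicalClosure = ⊤ := by
    refine (h.irreducible.2 _ (hred (by simp) h.rep.skew_zero fun n => (hmem n).1)
      (hred conj_I_half h.rep.skew_plus fun n => (hmem n).2.1)
      (hred conj_neg_I_half h.rep.skew_minus fun n => (hmem n).2.2)).resolve_left fun hbot => ?_
    have h1 : (s 0 : H) ∈ (Submodule.span ℂ (range fun n => (s n : H))).topologicalClosure :=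
      Submodule.le_topologicalClosure _ (Submodule.subset_span ⟨0, rfl⟩)
    rw [hbot] at h1
    exact horth.ne_zero 0 h1
  have hb : ⇑(HilbertBasis.mk horth hK.ge) = fun n => (s n : H) := HilbertBasis.coe_mk _ _
  have hgraph : ∀ {α β : ℂ} {E : H →ₗ.[ℂ] H}, (starRingEnd ℂ) β = -β → IsSkewAdjoint E →
      (∀ n, ((s n : H), ladderVec (fun n => (s n : H)) lam α β n) ∈ E.graph) →
      E.graph = ladderGraph (HilbertBasis.mk horth hK.ge) lam α β := by
    intro α β E hβ hE hs
    refine graph_eq_ladderGraph _ hl hβ (fun n => ?_) (fun n x y hxy => ?_) ?_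
    · rw [hb]
      exact hs n
    · rw [hb]
      exact hE.inner_skew (hs n) hxy
    · intro u v x y huv hu hv
      exact hE.graph_closed huv hu hv
  exact ⟨HilbertBasis.mk horth hK.ge, hgraph (by simp) h.rep.skew_zero fun n => (hmem n).1,
    hgraph conj_I_half h.rep.skew_plus fun n => (hmem n).2.1,
    hgraph conj_neg_I_half h.rep.skew_minus fun n => (hmem n).2.2⟩

end Classification

/-! ### Laguerre polynomials -/

section Laguerre

open Polynomial

/-- The coefficient of `x^m` in the Sonine polynomial `S_n^{lam-1}(2x)`; the binomial coefficient
makes it vanish for `m > n`. -/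
def laguerreCoeff (lam : ℝ) (n m : ℕ) : ℝ :=
  (-1) ^ m * 2 ^ m * (n.choose m : ℝ) * Real.Gamma (n + lam) /
    ((n.factorial : ℝ) * Real.Gamma (m + lam))

theorem laguerreCoeff_of_lt (lam : ℝ) {n m : ℕ} (h : n < m) : laguerreCoeff lam n m = 0 := by
  simp [laguerreCoeff, Nat.choose_eq_zero_of_lt h]

theorem gamma_ne_zero {lam : ℝ} (hl : 0 < lam) (m : ℕ) : Real.Gamma (m + lam) ≠ 0 :=
  (Real.Gamma_pos_of_pos (by positivity)).ne'

theorem gamma_succ {lam : ℝ} (hl : 0 < lam) (m : ℕ) :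
    Real.Gamma ((m + 1 : ℕ) + lam) = (m + lam) * Real.Gamma (m + lam) := by
  rw [← Real.Gamma_add_one (by positivity)]
  congr 1
  push_cast
  ring

/-- The coefficient identity for `x P' = n P - (lam + n - 1) P_{n-1}`. -/
theorem laguerreCoeff_lower {lam : ℝ} (hl : 0 < lam) (n m : ℕ) :
    ((n : ℝ) + 1 - m) * laguerreCoeff lam (n + 1) m = (lam + n) * laguerreCoeff lam n m := by
  rw [laguerreCoeff, laguerreCoeff, gamma_succ hl, Nat.factorial_succ]
  have h1 := gamma_ne_zero hl m
  have h2 : (n.factorial : ℝ) ≠ 0 := by positivity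
  have h3 : ((n + 1).choose m : ℝ) * ((n : ℝ) + 1 - m) = n.choose m * (n + 1) := by
    rcases le_or_gt m (n + 1) with h | h
    · have := Nat.choose_mul_succ_eq n m
      rw [← Nat.cast_add_one, ← Nat.cast_sub h]
      exact_mod_cast this.symm
    · rw [Nat.choose_eq_zero_of_lt h, Nat.choose_eq_zero_of_lt (by omega)]
      simp
  have h4 : (n : ℝ) + 1 ≠ 0 := by positivity
  push_cast
  field_simp
  linear_combination (n + lam) * h3

/-- The coefficient identity for `x P'' + lam P' = -2 (lam + n - 1) P_{n-1}`. -/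
theorem laguerreCoeff_deriv {lam : ℝ} (hl : 0 < lam) (n m : ℕ) :
    ((m : ℝ) + 1) * (m + lam) * laguerreCoeff lam (n + 1) (m + 1) =
      -2 * (lam + n) * laguerreCoeff lam n m := by
  rw [laguerreCoeff, laguerreCoeff, gamma_succ hl, gamma_succ hl, Nat.factorial_succ]
  have h1 := gamma_ne_zero hl m
  have h2 : (n.factorial : ℝ) ≠ 0 := by positivity
  have h3 : ((n : ℝ) + 1) * n.choose m = (n + 1).choose (m + 1) * (m + 1) := by
    exact_mod_cast Nat.add_one_mul_choose_eq n m
  have h4 : (n : ℝ) + 1 ≠ 0 := by positivity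
  have h5 : (m : ℝ) + lam ≠ 0 := by positivity
  push_cast
  field_simp
  ring_nf
  ring_nf at h3
  linear_combination (2 * (-1) ^ m * 2 ^ m * (n + lam)) * h3

theorem laguerreCoeff_raise {lam : ℝ} (hl : 0 < lam) (n m : ℕ) :
    ((m : ℝ) + 1 + n + lam) * laguerreCoeff lam n (m + 1) - 2 * laguerreCoeff lam n m =
      (n + 1) * laguerreCoeff lam (n + 1) (m + 1) := by
  have h1 := laguerreCoeff_lower hl n (m + 1)
  have h2 := laguerreCoeff_deriv hl n m
  have h3 : ((m : ℝ) + lam) ≠ 0 := by positivity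
  have h4 : ((m : ℝ) + 1) ≠ 0 := by positivity
  have h5 : ((n : ℝ) + lam) ≠ 0 := by positivity
  push_cast at h1
  have e : ((m : ℝ) + 1 + n + lam) * laguerreCoeff lam n (m + 1) =
      (m + 1) * laguerreCoeff lam n (m + 1) + ((n : ℝ) - m) * laguerreCoeff lam (n + 1) (m + 1) := by
    linear_combination -h1
  have h6 : (n + lam) * (((m : ℝ) + 1) * laguerreCoeff lam n (m + 1) -
      2 * laguerreCoeff lam n m - (m + 1) * laguerreCoeff lam (n + 1) (m + 1)) = 0 := by
    linear_combination (-((m : ℝ) + 1)) * h1 - h2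
  have h7 := (mul_eq_zero.1 h6).resolve_left h5
  linear_combination e + h7

/-- The Sonine polynomial `S_n^{lam-1}(2x)` as a polynomial in `x` with complex coefficients. -/
def laguerrePoly (lam : ℝ) (n : ℕ) : ℂ[X] :=
  ∑ m ∈ Finset.range (n + 1), C (laguerreCoeff lam n m : ℂ) * X ^ m

theorem coeff_laguerrePoly (lam : ℝ) (n m : ℕ) :
    (laguerrePoly lam n).coeff m = (laguerreCoeff lam n m : ℂ) := by
  rw [laguerrePoly, finsetSum_coeff]
  simp only [coeff_C_mul, coeff_X_pow, mul_ite, mul_one, mul_zero]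
  rw [Finset.sum_ite_eq]
  split_ifs with h
  · rfl
  · rw [laguerreCoeff_of_lt lam (by simpa using h)]
    simp

/-- The factor that normalises the Laguerre functions. -/
def laguerreNorm (lam : ℝ) (n : ℕ) : ℝ :=
  Real.sqrt (2 ^ lam * (n.factorial : ℝ) / Real.Gamma (n + lam))

theorem laguerreNorm_succ_mul {lam : ℝ} (hl : 0 < lam) (n : ℕ) :
    laguerreNorm lam (n + 1) * ladderWeight lam (n + 1) = (n + 1) * laguerreNorm lam n := by
  have h1 : 0 < Real.Gamma (n + lam) := Real.Gamma_pos_of_pos (by positivity)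
  rw [laguerreNorm, laguerreNorm, ladderWeight_succ, gamma_succ hl, Nat.factorial_succ,
    ← Real.sqrt_mul (by positivity)]
  have e : (2 : ℝ) ^ lam * ((n + 1) * n.factorial : ℕ) / ((n + lam) * Real.Gamma (n + lam)) *
      ((n + 1) * (lam + n)) = (n + 1) ^ 2 * (2 ^ lam * n.factorial / Real.Gamma (n + lam)) := by
    have h2 : (n : ℝ) + lam ≠ 0 := by positivity
    push_cast
    field_simp
    ring
  rw [e, Real.sqrt_mul (by positivity), Real.sqrt_sq (by positivity)]

theorem laguerreNorm_mul {lam : ℝ} (hl : 0 < lam) (n : ℕ) :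
    laguerreNorm lam n * ladderWeight lam (n + 1) = (lam + n) * laguerreNorm lam (n + 1) := by
  have h1 := laguerreNorm_succ_mul hl n
  have h2 := ladderWeight_succ_sq hl n
  have h3 : (n : ℝ) + 1 ≠ 0 := by positivity
  refine mul_left_cancel₀ h3 ?_
  linear_combination (-ladderWeight lam (n + 1)) * h1 + laguerreNorm lam (n + 1) * h2

/-- The polynomial factor of the `n`-th normalised Laguerre function. -/
def weightPoly (lam : ℝ) (n : ℕ) : ℂ[X] := C (laguerreNorm lam n : ℂ) * laguerrePoly lam n

theorem coeff_weightPoly (lam : ℝ) (n m : ℕ) :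
    (weightPoly lam n).coeff m = ((laguerreNorm lam n * laguerreCoeff lam n m : ℝ) : ℂ) := by
  rw [weightPoly, coeff_C_mul, coeff_laguerrePoly, Complex.ofReal_mul]

theorem coeff_X_mul_derivative (p : ℂ[X]) (m : ℕ) : (X * derivative p).coeff m = m * p.coeff m := by
  cases m with
  | zero => simp
  | succ m =>
    rw [coeff_X_mul, coeff_derivative]
    push_cast
    ring

theorem weightPoly_lower {lam : ℝ} (hl : 0 < lam) (n : ℕ) :
    X * derivative (weightPoly lam n) =
      C (n : ℂ) * weightPoly lam n - C (ladderWeight lam n : ℂ) * weightPoly lam (n - 1) := by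
  ext m
  rw [coeff_sub, coeff_C_mul, coeff_C_mul, coeff_X_mul_derivative, coeff_weightPoly,
    coeff_weightPoly]
  cases n with
  | zero =>
    rcases m with _ | m
    · simp
    · simp [laguerreCoeff_of_lt lam (Nat.succ_pos m)]
  | succ n =>
    have h1 := laguerreCoeff_lower hl n m
    have h2 := laguerreNorm_mul hl n
    have e : m * (laguerreNorm lam (n + 1) * laguerreCoeff lam (n + 1) m) =
        ((n + 1 : ℕ) : ℝ) * (laguerreNorm lam (n + 1) * laguerreCoeff lam (n + 1) m) -
        ladderWeight lam (n + 1) * (laguerreNorm lam n * laguerreCoeff lam n m) := by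
      push_cast
      linear_combination (-laguerreNorm lam (n + 1)) * h1 + laguerreCoeff lam n m * h2
    rw [Nat.add_sub_cancel]
    exact_mod_cast congrArg Complex.ofReal e

theorem weightPoly_raise {lam : ℝ} (hl : 0 < lam) (n : ℕ) :
    X * derivative (weightPoly lam n) + (C (n + lam : ℂ) - C 2 * X) * weightPoly lam n =
      C (ladderWeight lam (n + 1) : ℂ) * weightPoly lam (n + 1) := by
  ext m
  rw [coeff_add, sub_mul, coeff_sub, coeff_C_mul, mul_assoc, coeff_C_mul, coeff_C_mul,
    coeff_X_mul_derivative, coeff_weightPoly, coeff_weightPoly]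
  have h2 := laguerreNorm_succ_mul hl n
  cases m with
  | zero =>
    have h1 := laguerreCoeff_lower hl n 0
    have e : (0 : ℝ) * (laguerreNorm lam n * laguerreCoeff lam n 0) +
        ((n + lam) * (laguerreNorm lam n * laguerreCoeff lam n 0) - 0) =
        ladderWeight lam (n + 1) * (laguerreNorm lam (n + 1) * laguerreCoeff lam (n + 1) 0) := by
      push_cast at h1
      linear_combination (-laguerreNorm lam n) * h1 - laguerreCoeff lam (n + 1) 0 * h2
    simpa using congrArg Complex.ofReal e
  | succ m =>
    have h1 := laguerreCoeff_raise hl n m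
    rw [coeff_X_mul, coeff_weightPoly]
    have e : ((m + 1 : ℕ) : ℝ) * (laguerreNorm lam n * laguerreCoeff lam n (m + 1)) +
        ((n + lam) * (laguerreNorm lam n * laguerreCoeff lam n (m + 1)) -
          2 * (laguerreNorm lam n * laguerreCoeff lam n m)) =
        ladderWeight lam (n + 1) *
          (laguerreNorm lam (n + 1) * laguerreCoeff lam (n + 1) (m + 1)) := by
      push_cast
      linear_combination laguerreNorm lam n * h1 - laguerreCoeff lam (n + 1) (m + 1) * h2
    exact_mod_cast congrArg Complex.ofReal e

/-- Laguerre's differential equation. -/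
theorem weightPoly_ode {lam : ℝ} (hl : 0 < lam) (n : ℕ) :
    X * derivative (derivative (weightPoly lam n)) +
      (C (lam : ℂ) - C 2 * X) * derivative (weightPoly lam n) +
      C (2 * n : ℂ) * weightPoly lam n = 0 := by
  have h1 := weightPoly_lower hl n
  ext m
  rw [coeff_add, coeff_add, sub_mul, coeff_sub, mul_assoc, coeff_C_mul, coeff_C_mul, coeff_C_mul,
    coeff_X_mul_derivative, coeff_X_mul_derivative, coeff_derivative, coeff_weightPoly,
    coeff_weightPoly, coeff_zero]
  have e : (m : ℝ) * (laguerreNorm lam n * laguerreCoeff lam n (m + 1) * (m + 1)) +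
      (lam * (laguerreNorm lam n * laguerreCoeff lam n (m + 1) * (m + 1)) -
        2 * (m * (laguerreNorm lam n * laguerreCoeff lam n m))) +
      2 * n * (laguerreNorm lam n * laguerreCoeff lam n m) = 0 := by
    cases n with
    | zero =>
      rw [laguerreCoeff_of_lt lam (Nat.succ_pos m)]
      rcases m with _ | m
      · simp
      · simp [laguerreCoeff_of_lt lam (Nat.succ_pos m)]
    | succ n =>
      have h2 := laguerreCoeff_lower hl n m
      have h3 := laguerreCoeff_deriv hl n m
      push_cast
      linear_combination laguerreNorm lam (n + 1) * h3 + 2 * laguerreNorm lam (n + 1) * h2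
  exact_mod_cast congrArg Complex.ofReal e

/-- The three-term recursion. -/
theorem X_mul_weightPoly {lam : ℝ} (hl : 0 < lam) (n : ℕ) :
    C 2 * X * weightPoly lam n = C (lam + 2 * n : ℂ) * weightPoly lam n -
      C (ladderWeight lam (n + 1) : ℂ) * weightPoly lam (n + 1) -
      C (ladderWeight lam n : ℂ) * weightPoly lam (n - 1) := by
  have h1 := weightPoly_lower hl n
  have h2 := weightPoly_raise hl n
  have h3 : (C 2 : ℂ[X]) = 2 := map_ofNat C 2
  simp only [C_add, C_mul, h3] at *
  linear_combination h1 - h2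

theorem weightPoly_zero {lam : ℝ} (hl : 0 < lam) :
    weightPoly lam 0 = C (laguerreNorm lam 0 : ℂ) := by
  have h := gamma_ne_zero hl 0
  simp only [Nat.cast_zero, zero_add] at h
  rw [weightPoly, laguerrePoly]
  simp [laguerreCoeff, h]

theorem laguerreNorm_pos {lam : ℝ} (hl : 0 < lam) (n : ℕ) : 0 < laguerreNorm lam n := by
  have h1 : 0 < Real.Gamma (n + lam) := Real.Gamma_pos_of_pos (by positivity)
  rw [laguerreNorm]
  positivity

/-- The normalised Laguerre polynomials span all polynomials. -/
theorem span_weightPoly {lam : ℝ} (hl : 0 < lam) :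
    Submodule.span ℂ (range (weightPoly lam)) = ⊤ := by
  have hX : ∀ p ∈ Submodule.span ℂ (range (weightPoly lam)),
      X * p ∈ Submodule.span ℂ (range (weightPoly lam)) := by
    intro p hp
    refine Submodule.span_induction ?_ (by simp) ?_ ?_ hp
    · rintro _ ⟨n, rfl⟩
      have hm : ∀ m, weightPoly lam m ∈ Submodule.span ℂ (range (weightPoly lam)) := fun m =>
        Submodule.subset_span ⟨m, rfl⟩
      have h1 := X_mul_weightPoly hl n
      have h2 : X * weightPoly lam n = (1 / 2 : ℂ) • ((lam + 2 * n : ℂ) • weightPoly lam n -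
          (ladderWeight lam (n + 1) : ℂ) • weightPoly lam (n + 1) -
          (ladderWeight lam n : ℂ) • weightPoly lam (n - 1)) := by
        simp only [smul_eq_C_mul]
        rw [← h1, ← mul_assoc, ← mul_assoc, ← C_mul]
        norm_num
      rw [h2]
      exact Submodule.smul_mem _ _ (Submodule.sub_mem _ (Submodule.sub_mem _
        (Submodule.smul_mem _ _ (hm _)) (Submodule.smul_mem _ _ (hm _)))
        (Submodule.smul_mem _ _ (hm _)))
    · intro p q _ _ hp hq
      rw [mul_add]
      exact Submodule.add_mem _ hp hq
    · intro c p _ hp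
      rw [mul_smul_comm]
      exact Submodule.smul_mem _ c hp
  have h1 : (1 : ℂ[X]) ∈ Submodule.span ℂ (range (weightPoly lam)) := by
    have h2 : weightPoly lam 0 ∈ Submodule.span ℂ (range (weightPoly lam)) :=
      Submodule.subset_span ⟨0, rfl⟩
    have h3 := Submodule.smul_mem _ ((laguerreNorm lam 0 : ℂ))⁻¹ h2
    have h4 : (laguerreNorm lam 0 : ℂ) ≠ 0 := by exact_mod_cast (laguerreNorm_pos hl 0).ne'
    rwa [weightPoly_zero hl, smul_eq_C_mul, ← C_mul, inv_mul_cancel₀ h4, C_1] at h3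
  rw [Submodule.eq_top_iff']
  intro p
  induction p using Polynomial.induction_on' with
  | add p q hp hq => exact Submodule.add_mem _ hp hq
  | monomial n c =>
    have h2 : (X ^ n : ℂ[X]) ∈ Submodule.span ℂ (range (weightPoly lam)) := by
      induction n with
      | zero => simpa using h1
      | succ n ih =>
        rw [pow_succ']
        exact hX _ ih
    rw [← C_mul_X_pow_eq_monomial, ← smul_eq_C_mul]
    exact Submodule.smul_mem _ c h2

end Laguerre

/-! ### The functions `x^k p(x) e^{iηx}` -/

section WeightFun

open Polynomial

/-- The function `x^k p(x) e^{iηx}` with a polynomial `p`; the Laguerre functions have `η = i`, the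
affine coherent states have constant `p`. -/
def weightFun (k : ℝ) (η : ℂ) (p : ℂ[X]) (x : ℝ) : ℂ :=
  ((x ^ k : ℝ) : ℂ) * p.eval (x : ℂ) * Complex.exp (Complex.I * η * x)

/-- The polynomial `q` with `x (x^k p e^{iηx})' = x^k q e^{iηx}`. -/
def eulerPoly (k : ℝ) (η : ℂ) (p : ℂ[X]) : ℂ[X] :=
  X * derivative p + (C (Complex.I * η) * X + C (k : ℂ)) * p

variable {k : ℝ} {η : ℂ}

theorem weightFun_add (p q : ℂ[X]) (x : ℝ) :
    weightFun k η (p + q) x = weightFun k η p x + weightFun k η q x := by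
  simp only [weightFun, eval_add]
  ring

theorem weightFun_C_mul (c : ℂ) (p : ℂ[X]) (x : ℝ) :
    weightFun k η (C c * p) x = c * weightFun k η p x := by
  simp only [weightFun, eval_mul, eval_C]
  ring

theorem weightFun_sub (p q : ℂ[X]) (x : ℝ) :
    weightFun k η (p - q) x = weightFun k η p x - weightFun k η q x := by
  simp only [weightFun, eval_sub]
  ring

theorem weightFun_X_mul (p : ℂ[X]) (x : ℝ) :
    weightFun k η (X * p) x = x * weightFun k η p x := by
  simp only [weightFun, eval_mul, eval_X]
  ring

theorem hasDerivAt_weightFun (k : ℝ) (η : ℂ) (p : ℂ[X]) {x : ℝ} (hx : 0 < x) :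
    HasDerivAt (weightFun k η p) (weightFun k η (eulerPoly k η p) x / x) x := by
  have h1 : HasDerivAt (fun x : ℝ => ((x ^ k : ℝ) : ℂ)) ((k * x ^ (k - 1) : ℝ) : ℂ) x :=
    (Real.hasDerivAt_rpow_const (Or.inl hx.ne')).ofReal_comp
  have h2 : HasDerivAt (fun x : ℝ => p.eval (x : ℂ)) ((derivative p).eval (x : ℂ)) x :=
    (p.hasDerivAt (x : ℂ)).comp_ofReal
  have h3 : HasDerivAt (fun x : ℝ => Complex.exp (Complex.I * η * x))
      (Complex.exp (Complex.I * η * x) * (Complex.I * η * 1)) x := by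
    have : HasDerivAt (fun z : ℂ => Complex.exp (Complex.I * η * z))
        (Complex.exp (Complex.I * η * x) * (Complex.I * η * 1)) (x : ℂ) :=
      ((hasDerivAt_id (x : ℂ)).const_mul (Complex.I * η)).cexp
    exact this.comp_ofReal
  have hx' : (x : ℂ) ≠ 0 := by exact_mod_cast hx.ne'
  have e : ((x ^ k : ℝ) : ℂ) = ((x ^ (k - 1) : ℝ) : ℂ) * x := by
    rw [← Complex.ofReal_mul]
    congr 1
    rw [← Real.rpow_add_one hx.ne', sub_add_cancel]
  refine HasDerivAt.congr_deriv (f := weightFun k η p) ((h1.mul h2).mul h3) ?_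
  simp only [weightFun, eulerPoly, eval_add, eval_mul, eval_X, eval_C, Pi.mul_apply]
  rw [e]
  push_cast
  field_simp
  ring

theorem continuousOn_weightFun (k : ℝ) (η : ℂ) (p : ℂ[X]) :
    ContinuousOn (weightFun k η p) (Ioi 0) := fun _ hx =>
  (hasDerivAt_weightFun k η p hx).continuousAt.continuousWithinAt

theorem aestronglyMeasurable_weightFun (k : ℝ) (η : ℂ) (p : ℂ[X]) :
    AEStronglyMeasurable (weightFun k η p) posMeasure :=
  (continuousOn_weightFun k η p).aestronglyMeasurable measurableSet_Ioi

theorem norm_exp_I_mul (η : ℂ) (x : ℝ) :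
    ‖Complex.exp (Complex.I * η * x)‖ = Real.exp (-(η.im * x)) := by
  rw [Complex.norm_exp]
  congr 1
  simp

theorem exists_bound_eval (p : ℂ[X]) {δ : ℝ} (hδ : 0 < δ) :
    ∃ M : ℝ, 0 ≤ M ∧ ∀ x : ℝ, 0 < x → ‖p.eval (x : ℂ)‖ ≤ M * Real.exp (δ * x) := by
  induction p using Polynomial.induction_on' with
  | add p q hp hq =>
    obtain ⟨M, hM0, hM⟩ := hp
    obtain ⟨N, hN0, hN⟩ := hq
    refine ⟨M + N, by positivity, fun x hx => ?_⟩
    rw [eval_add, add_mul]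
    exact (norm_add_le _ _).trans (add_le_add (hM x hx) (hN x hx))
  | monomial n c =>
    refine ⟨‖c‖ * (n.factorial / δ ^ n), by positivity, fun x hx => ?_⟩
    have h := Real.pow_div_factorial_le_exp (δ * x) (by positivity) n
    rw [eval_monomial, norm_mul, norm_pow, Complex.norm_real, Real.norm_of_nonneg hx.le, mul_assoc]
    gcongr
    rw [div_le_iff₀ (by positivity), mul_pow] at h
    rw [div_mul_eq_mul_div, le_div_iff₀ (by positivity)]
    linarith

/-- Exponential decay, with the exact power behaviour at zero. -/
theorem exists_bound_weightFun (k : ℝ) (hη : 0 < η.im) (p : ℂ[X]) :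
    ∃ M : ℝ, 0 ≤ M ∧ ∀ x : ℝ, 0 < x →
      ‖weightFun k η p x‖ ≤ M * (x ^ k * Real.exp (-(η.im / 2 * x))) := by
  obtain ⟨M, hM0, hM⟩ := exists_bound_eval p (half_pos hη)
  refine ⟨M, hM0, fun x hx => ?_⟩
  have h1 : 0 ≤ x ^ k := Real.rpow_nonneg hx.le k
  rw [weightFun, norm_mul, norm_mul, Complex.norm_real, Real.norm_of_nonneg h1, norm_exp_I_mul]
  calc x ^ k * ‖p.eval (x : ℂ)‖ * Real.exp (-(η.im * x))
      ≤ x ^ k * (M * Real.exp (η.im / 2 * x)) * Real.exp (-(η.im * x)) := by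
        gcongr
        exact hM x hx
    _ = M * (x ^ k * (Real.exp (η.im / 2 * x) * Real.exp (-(η.im * x)))) := by ring
    _ = M * (x ^ k * Real.exp (-(η.im / 2 * x))) := by
        rw [← Real.exp_add]
        congr 3
        ring

theorem memLp_rpow_mul_exp (hk : -(1 / 2) < k) {δ : ℝ} (hδ : 0 < δ) :
    MemLp (fun x : ℝ => x ^ k * Real.exp (-(δ * x))) 2 posMeasure := by
  have hm : AEStronglyMeasurable (fun x : ℝ => x ^ k * Real.exp (-(δ * x))) posMeasure := by
    refine ContinuousOn.aestronglyMeasurable (fun x hx => ?_) measurableSet_Ioi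
    exact ((Real.continuousAt_rpow_const x k (Or.inl (ne_of_gt hx))).mul
      (by fun_prop)).continuousWithinAt
  rw [memLp_two_iff_integrable_sq hm]
  have h := integrableOn_rpow_mul_exp_neg_mul_rpow (p := 1) (s := 2 * k) (b := 2 * δ) (by linarith)
    one_pos (by linarith)
  refine h.congr_fun (fun x hx => ?_) measurableSet_Ioi
  simp only
  rw [mul_pow, ← Real.exp_nat_mul, ← Real.rpow_mul_natCast (le_of_lt hx), Real.rpow_one]
  congr 2
  · push_cast
    ring
  · push_cast
    ring

theorem memLp_weightFun (hk : -(1 / 2) < k) (hη : 0 < η.im) (p : ℂ[X]) :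
    MemLp (weightFun k η p) 2 posMeasure := by
  obtain ⟨M, hM0, hM⟩ := exists_bound_weightFun k hη p
  refine MemLp.of_le ((memLp_rpow_mul_exp hk (half_pos hη)).const_mul M)
    (aestronglyMeasurable_weightFun k η p) ?_
  rw [ae_restrict_iff' measurableSet_Ioi]
  refine Eventually.of_forall fun x hx => (hM x hx).trans (le_abs_self _)

theorem weightFun_isBigO (k : ℝ) (η : ℂ) (p : ℂ[X]) :
    weightFun k η p =O[𝓝[>] 0] fun x : ℝ => x ^ k := by
  have h1 : (fun x : ℝ => p.eval (x : ℂ) * Complex.exp (Complex.I * η * x)) =O[𝓝[>] 0]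
      fun _ : ℝ => (1 : ℝ) := by
    have hc : Continuous fun x : ℝ => p.eval (x : ℂ) * Complex.exp (Complex.I * η * x) := by
      fun_prop
    exact (hc.continuousAt.tendsto.mono_left nhdsWithin_le_nhds).isBigO_one ℝ
  have h2 : (fun x : ℝ => ((x ^ k : ℝ) : ℂ)) =O[𝓝[>] 0] fun x : ℝ => x ^ k :=
    IsBigO.of_bound 1 (Eventually.of_forall fun x => by rw [Complex.norm_real, one_mul])
  have h3 := h2.mul h1
  simp only [mul_one] at h3
  refine h3.congr_left fun x => ?_
  rw [weightFun]
  ring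

theorem rpow_isLittleO_at_zero {s t : ℝ} (h : s < t) :
    (fun x : ℝ => x ^ t) =o[𝓝[>] 0] fun x : ℝ => x ^ s := by
  refine isLittleO_of_tendsto' ?_ ?_
  · filter_upwards [self_mem_nhdsWithin] with x hx h0
    exact absurd h0 (Real.rpow_pos_of_pos hx s).ne'
  · have h1 : Tendsto (fun x : ℝ => x ^ (t - s)) (𝓝[>] 0) (𝓝 0) := by
      have h2 := (Real.continuousAt_rpow_const 0 (t - s) (Or.inr (sub_pos.2 h).le)).tendsto
      rw [Real.zero_rpow (sub_pos.2 h).ne'] at h2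
      exact h2.mono_left nhdsWithin_le_nhds
    refine h1.congr' ?_
    filter_upwards [self_mem_nhdsWithin] with x hx
    rw [Real.rpow_sub hx]

theorem tendsto_pow_mul_weightFun (k : ℝ) (hη : 0 < η.im) (p : ℂ[X]) (n : ℕ) :
    Tendsto (fun x : ℝ => (x : ℂ) ^ n * weightFun k η p x) atTop (𝓝 0) := by
  obtain ⟨M, hM0, hM⟩ := exists_bound_weightFun k hη p
  have h := (tendsto_rpow_mul_exp_neg_mul_atTop_nhds_zero (k + n) (η.im / 2) (half_pos hη)).const_mul M
  rw [mul_zero] at h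
  rw [tendsto_zero_iff_norm_tendsto_zero]
  refine squeeze_zero' (Eventually.of_forall fun x => norm_nonneg _) ?_ h
  filter_upwards [eventually_gt_atTop 0] with x hx
  rw [norm_mul, norm_pow, Complex.norm_real, Real.norm_of_nonneg hx.le, Real.rpow_add hx,
    Real.rpow_natCast]
  calc x ^ n * ‖weightFun k η p x‖ ≤ x ^ n * (M * (x ^ k * Real.exp (-(η.im / 2 * x)))) := by
        gcongr
        exact hM x hx
    _ = M * (x ^ k * x ^ n * Real.exp (-(η.im / 2) * x)) := by
        rw [neg_mul]
        ring

/-- The vector `x^k p(x) e^{iηx}` of `L²(ℝ⁺)`. -/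
def weightVec (hk : -(1 / 2) < k) (hη : 0 < η.im) (p : ℂ[X]) : L2Pos :=
  (memLp_weightFun hk hη p).toLp

variable (hk : -(1 / 2) < k) (hη : 0 < η.im)

theorem coeFn_weightVec (p : ℂ[X]) : weightVec hk hη p =ᵐ[posMeasure] weightFun k η p :=
  MemLp.coeFn_toLp _

theorem weightVec_add (p q : ℂ[X]) :
    weightVec hk hη (p + q) = weightVec hk hη p + weightVec hk hη q := by
  refine Lp.ext ?_
  filter_upwards [coeFn_weightVec hk hη (p + q), coeFn_weightVec hk hη p, coeFn_weightVec hk hη q,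
    Lp.coeFn_add (weightVec hk hη p) (weightVec hk hη q)] with x h1 h2 h3 h4
  rw [h4, Pi.add_apply, h1, h2, h3, weightFun_add]

theorem weightVec_C_mul (c : ℂ) (p : ℂ[X]) :
    weightVec hk hη (C c * p) = c • weightVec hk hη p := by
  refine Lp.ext ?_
  filter_upwards [coeFn_weightVec hk hη (C c * p), coeFn_weightVec hk hη p,
    Lp.coeFn_smul c (weightVec hk hη p)] with x h1 h2 h3
  rw [h3, Pi.smul_apply, h1, h2, weightFun_C_mul, smul_eq_mul]

theorem weightVec_sub (p q : ℂ[X]) :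
    weightVec hk hη (p - q) = weightVec hk hη p - weightVec hk hη q := by
  have h : p - q = p + C (-1) * q := by simp [sub_eq_add_neg]
  rw [h, weightVec_add, weightVec_C_mul]
  module

/-! ### The action of the operators on `x^k p(x) e^{iηx}` -/

/-- A function with a continuous derivative is locally absolutely continuous. -/
theorem IsPrimitive.of_hasDerivAt {F F' : ℝ → ℂ} (hF : ∀ x, 0 < x → HasDerivAt F (F' x) x)
    (hF' : ContinuousOn F' (Ioi 0)) : IsPrimitive F F' := by
  refine ⟨hF'.locallyIntegrableOn measurableSet_Ioi, fun a b ha hb => ?_⟩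
  have hsub : uIcc a b ⊆ Ioi (0 : ℝ) := fun x hx => lt_of_lt_of_le (lt_min ha hb) hx.1
  exact (intervalIntegral.integral_eq_sub_of_hasDerivAt (fun x hx => hF x (hsub hx))
    ((hF'.mono hsub).intervalIntegrable)).symm

theorem continuousOn_weightFun_div (k : ℝ) (η : ℂ) (p : ℂ[X]) :
    ContinuousOn (fun x : ℝ => weightFun k η p x / x) (Ioi 0) := by
  refine (continuousOn_weightFun k η p).div (by fun_prop) fun x hx => ?_
  exact_mod_cast (ne_of_gt hx : x ≠ 0)

theorem isPrimitive_weightFun (k : ℝ) (η : ℂ) (p : ℂ[X]) :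
    IsPrimitive (weightFun k η p) fun x => weightFun k η (eulerPoly k η p) x / x :=
  IsPrimitive.of_hasDerivAt (fun _ hx => hasDerivAt_weightFun k η p hx)
    (continuousOn_weightFun_div k η _)

theorem IsPrimitive.congr {F G h : ℝ → ℂ} (hF : IsPrimitive F h) (hFG : ∀ x, 0 < x → F x = G x) :
    IsPrimitive G h :=
  ⟨hF.1, fun a b ha hb => by rw [← hFG a ha, ← hFG b hb, hF.2 a b ha hb]⟩

theorem weightVec_mem_graphE0 (p : ℂ[X]) :
    (weightVec hk hη p, weightVec hk hη (p + C 2 * eulerPoly k η p)) ∈ graphE0 := by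
  refine ⟨weightFun k η p, fun x => weightFun k η (eulerPoly k η p) x / x,
    isPrimitive_weightFun k η p, coeFn_weightVec hk hη p, ?_⟩
  filter_upwards [coeFn_weightVec hk hη (p + C 2 * eulerPoly k η p),
    ae_restrict_mem measurableSet_Ioi] with x hx hx0
  have hx' : (x : ℂ) ≠ 0 := by exact_mod_cast (ne_of_gt hx0 : x ≠ 0)
  rw [hx, weightFun_add, weightFun_C_mul]
  field_simp
  linear_combination (weightFun k η p x + 2 * weightFun k η (eulerPoly k η p) x) * Complex.I_sq

theorem weightVec_mem_graphEp (p : ℂ[X]) :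
    (weightVec hk hη p, weightVec hk hη (C Complex.I * (X * p))) ∈ graphEp := by
  change weightVec hk hη (C Complex.I * (X * p)) =ᵐ[posMeasure]
    fun x => Complex.I * (x * weightVec hk hη p x)
  filter_upwards [coeFn_weightVec hk hη (C Complex.I * (X * p)), coeFn_weightVec hk hη p]
    with x h1 h2
  rw [h1, h2, weightFun_C_mul, weightFun_X_mul]

/-- As `P Q P + k² Q⁻¹ = (k² - (x d/dx)²) / x`, the operator maps `x^k p e^{iηx}` to `x^k r e^{iηx}`
where `x r = k² p - D² p`, with `D` the polynomial action `eulerPoly` of `x d/dx`. -/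
theorem weightVec_mem_graphPreEm {p r : ℂ[X]}
    (hr : X * r = C (k ^ 2 : ℂ) * p - eulerPoly k η (eulerPoly k η p)) :
    (weightVec hk hη p, weightVec hk hη (C (-Complex.I) * r)) ∈ graphPreEm k := by
  refine ⟨weightFun k η p, fun x => weightFun k η (eulerPoly k η p) x / x,
    fun x => weightFun k η (eulerPoly k η (eulerPoly k η p)) x / x,
    fun x hx => hasDerivAt_weightFun k η p hx, ?_, coeFn_weightVec hk hη p, ?_,
    weightFun_isBigO k η p, ?_, ?_⟩
  · refine (isPrimitive_weightFun k η (eulerPoly k η p)).congr fun x hx => ?_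
    have hx' : (x : ℂ) ≠ 0 := by exact_mod_cast hx.ne'
    field_simp
  · filter_upwards [coeFn_weightVec hk hη (C (-Complex.I) * r),
      ae_restrict_mem measurableSet_Ioi] with x hx hx0
    have hx' : (x : ℂ) ≠ 0 := by exact_mod_cast (ne_of_gt hx0 : x ≠ 0)
    have h1 := congrArg (fun q => weightFun k η q x) hr
    simp only [weightFun_sub, weightFun_C_mul, weightFun_X_mul] at h1
    rw [hx, weightFun_C_mul]
    field_simp
    linear_combination -h1
  -- `x F' - k F` is of order `x^(k+1)`, and `k + 1 > -k`
  · have h1 : (fun x : ℝ => ((x : ℂ)) * weightFun k η (derivative p + C (Complex.I * η) * p) x)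
        =o[𝓝[>] 0] fun x : ℝ => x ^ (-k) := by
      have h2 : (fun x : ℝ => (x : ℂ)) =O[𝓝[>] 0] fun x : ℝ => x :=
        IsBigO.of_bound 1 (Eventually.of_forall fun x => by rw [Complex.norm_real, one_mul])
      have h3 := h2.mul (weightFun_isBigO k η (derivative p + C (Complex.I * η) * p))
      have h4 : (fun x : ℝ => x * x ^ k) =ᶠ[𝓝[>] 0] fun x : ℝ => x ^ (k + 1) := by
        filter_upwards [self_mem_nhdsWithin] with x hx
        rw [Real.rpow_add_one (ne_of_gt hx), mul_comm]
      exact (h3.congr' EventuallyEq.rfl h4).trans_isLittleO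
        (rpow_isLittleO_at_zero (by linarith))
    refine h1.congr' ?_ EventuallyEq.rfl
    filter_upwards [self_mem_nhdsWithin] with x hx
    have hx' : (x : ℂ) ≠ 0 := by exact_mod_cast (ne_of_gt hx : x ≠ 0)
    have h2 : eulerPoly k η p = X * (derivative p + C (Complex.I * η) * p) + C (k : ℂ) * p := by
      rw [eulerPoly]
      ring
    have h3 : weightFun k η (eulerPoly k η p) x =
        x * weightFun k η (derivative p + C (Complex.I * η) * p) x + k * weightFun k η p x := by
      rw [h2, weightFun_add, weightFun_C_mul, weightFun_X_mul]
    rw [h3]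
    field_simp
    ring
  · simpa using tendsto_pow_mul_weightFun k hη p 0

end WeightFun

/-! ### Integration by parts on the half-line -/

theorem uIcc_subset_Ioi_zero {a b : ℝ} (ha : 0 < a) (hb : 0 < b) : uIcc a b ⊆ Ioi 0 :=
  fun _ hx => lt_of_lt_of_le (lt_min ha hb) hx.1

theorem absolutelyContinuousOnInterval_integral {h : ℝ → ℂ} {a b : ℝ}
    (hh : IntervalIntegrable h volume a b) :
    AbsolutelyContinuousOnInterval (fun x => ∫ t in a..x, h t) a b := by
  have hre : IntervalIntegrable (fun t => (h t).re) volume a b := ⟨hh.1.re, hh.2.re⟩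
  have him : IntervalIntegrable (fun t => (h t).im) volume a b := ⟨hh.1.im, hh.2.im⟩
  have hc : ∀ c : ℂ, AbsolutelyContinuousOnInterval (fun _ : ℝ => c) a b := fun c =>
    (contDiffOn_const (n := 1)).absolutelyContinuousOnInterval
  have h1 := (hre.absolutelyContinuousOnInterval_intervalIntegral left_mem_uIcc).smul (hc 1)
  have h2 := (him.absolutelyContinuousOnInterval_intervalIntegral left_mem_uIcc).smul
    (hc Complex.I)
  have h3 := h1.add h2
  have key : ∀ x ∈ uIcc a b, ((fun x => ∫ t in a..x, (h t).re) • (fun _ : ℝ => (1 : ℂ)) +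
      (fun x => ∫ t in a..x, (h t).im) • fun _ : ℝ => Complex.I) x = ∫ t in a..x, h t := by
    intro x hx
    have hx' : IntervalIntegrable h volume a x := hh.mono_set (uIcc_subset_uIcc_left hx)
    have e1 : (∫ t in a..x, (h t).re) = (∫ t in a..x, h t).re :=
      Complex.reCLM.intervalIntegral_comp_comm hx'
    have e2 : (∫ t in a..x, (h t).im) = (∫ t in a..x, h t).im :=
      Complex.imCLM.intervalIntegral_comp_comm hx'
    simp only [Pi.add_apply, Pi.smul_apply', e1, e2, Complex.real_smul, mul_one]
    exact Complex.re_add_im _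
  rw [absolutelyContinuousOnInterval_iff] at h3 ⊢
  intro ε hε
  obtain ⟨δ, hδ, H⟩ := h3 ε hε
  refine ⟨δ, hδ, fun E hE hE' => ?_⟩
  refine lt_of_eq_of_lt (Finset.sum_congr rfl fun i hi => ?_) (H E hE hE')
  rw [key _ (hE.1 i hi).1, key _ (hE.1 i hi).2]

/-- The product rule: the difference of the two sides is absolutely continuous, and its derivative
vanishes almost everywhere. -/
theorem IsPrimitive.mul {F f G g : ℝ → ℂ} (hF : IsPrimitive F f) (hG : IsPrimitive G g) :
    IsPrimitive (fun x => F x * G x) (fun x => f x * G x + F x * g x) := by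
  have hl : IsLocallyClosed (Ioi (0 : ℝ)) := isOpen_Ioi.isLocallyClosed
  have hloc : LocallyIntegrableOn (fun x => f x * G x + F x * g x) (Ioi 0) :=
    (hF.1.mul_continuousOn hG.continuousOn hl).add (hG.1.continuousOn_mul hF.continuousOn hl)
  refine ⟨hloc, fun a b ha hb => ?_⟩
  have hsub := uIcc_subset_Ioi_zero ha hb
  have hw : IntervalIntegrable (fun x => f x * G x + F x * g x) volume a b :=
    (hloc.integrableOn_compact_subset hsub isCompact_uIcc).intervalIntegrable
  have hf := hF.intervalIntegrable ha hb
  have hg := hG.intervalIntegrable ha hb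
  have hc : ∀ c : ℂ, AbsolutelyContinuousOnInterval (fun _ : ℝ => c) a b := fun c =>
    (contDiffOn_const (n := 1)).absolutelyContinuousOnInterval
  have hac := (((hc (F a)).add (absolutelyContinuousOnInterval_integral hf)).smul
    ((hc (G a)).add (absolutelyContinuousOnInterval_integral hg))).sub
    (absolutelyContinuousOnInterval_integral hw)
  have hFx : ∀ x, 0 < x → F a + ∫ t in a..x, f t = F x := fun x hx => by rw [← hF.2 a x ha hx]; ring
  have hGx : ∀ x, 0 < x → G a + ∫ t in a..x, g t = G x := fun x hx => by rw [← hG.2 a x ha hx]; ring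
  obtain ⟨C, hC⟩ := hac.const_of_ae_hasDerivAt_zero (by
    filter_upwards [hf.ae_hasDerivAt_integral, hg.ae_hasDerivAt_integral,
      hw.ae_hasDerivAt_integral] with x h1 h2 h3 hx
    have d1 := (h1 hx a left_mem_uIcc).const_add (F a)
    have d2 := (h2 hx a left_mem_uIcc).const_add (G a)
    refine ((d1.mul d2).sub (h3 hx a left_mem_uIcc)).congr_deriv ?_
    rw [hFx x (hsub hx), hGx x (hsub hx), sub_self])
  have e := (hC b right_mem_uIcc).trans (hC a left_mem_uIcc).symm
  simp only [Pi.sub_apply, Pi.add_apply, Pi.mul_apply, smul_eq_mul, hFx b hb, hGx b hb,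
    intervalIntegral.integral_same, add_zero, sub_zero] at e
  linear_combination e

theorem IsPrimitive.sub {F f G g : ℝ → ℂ} (hF : IsPrimitive F f) (hG : IsPrimitive G g) :
    IsPrimitive (fun x => F x - G x) (fun x => f x - g x) := by
  have h := hF.add (hG.smul (-1))
  convert h using 1 <;> funext x <;>
    simp [sub_eq_add_neg]

theorem eq_zero_of_tendsto_of_frequently {l : Filter ℝ} {W : ℝ → ℂ} {c : ℂ} (h : Tendsto W l (𝓝 c))
    (hs : ∀ ε : ℝ, 0 < ε → ∃ᶠ x in l, ‖W x‖ < ε) : c = 0 := by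
  by_contra hc
  have hc' : 0 < ‖c‖ := norm_pos_iff.2 hc
  refine (hs (‖c‖ / 2) (half_pos hc')) ?_
  filter_upwards [h.norm.eventually (lt_mem_nhds (half_lt_self hc'))] with x hx
  exact not_lt.2 hx.le

/-- The fundamental theorem of calculus on `(0, ∞)`. As `w` is integrable, `W` has limits at both
ends, and it suffices that it is small along some sequence. -/
theorem IsPrimitive.integral_eq_zero {W w : ℝ → ℂ} (hW : IsPrimitive W w)
    (hw : Integrable w posMeasure)
    (h0 : ∀ ε : ℝ, 0 < ε → ∃ᶠ x in 𝓝[>] 0, ‖W x‖ < ε)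
    (h1 : ∀ ε : ℝ, 0 < ε → ∃ᶠ x in atTop, ‖W x‖ < ε) : ∫ x, w x ∂posMeasure = 0 := by
  have hi : IntegrableOn w (Ioi 0) := hw
  have e1 : W 1 + ∫ x in Ioi 1, w x = 0 := by
    refine eq_zero_of_tendsto_of_frequently ?_ h1
    have ht := (intervalIntegral_tendsto_integral_Ioi 1 (hi.mono_set (Ioi_subset_Ioi zero_le_one))
      tendsto_id).const_add (W 1)
    refine ht.congr' ?_
    filter_upwards [eventually_gt_atTop 0] with x hx
    rw [id, ← hW.2 1 x one_pos hx]
    ring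
  have e0 : W 1 - ∫ x in Ioc 0 1, w x = 0 := by
    refine eq_zero_of_tendsto_of_frequently ?_ h0
    have hI : IntervalIntegrable w volume 0 1 := by
      rw [intervalIntegrable_iff_integrableOn_Ioc_of_le zero_le_one]
      exact hi.mono_set fun x hx => hx.1
    have hc := (intervalIntegral.continuousOn_primitive_interval' hI right_mem_uIcc)
      0 left_mem_uIcc
    have ht : Tendsto (fun x => W 1 + ∫ t in (1 : ℝ)..x, w t) (𝓝[uIcc 0 1] 0)
      (𝓝 (W 1 + ∫ t in (1 : ℝ)..0, w t)) := Tendsto.const_add _ hc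
    rw [intervalIntegral.integral_symm, intervalIntegral.integral_of_le zero_le_one,
      ← sub_eq_add_neg, uIcc_of_le zero_le_one] at ht
    have hle : 𝓝[>] (0 : ℝ) ≤ 𝓝[Icc 0 1] 0 := by
      rw [← nhdsWithin_Ioc_eq_nhdsGT (one_pos : (0 : ℝ) < 1)]
      exact nhdsWithin_mono _ Ioc_subset_Icc_self
    refine (ht.mono_left hle).congr' ?_
    filter_upwards [self_mem_nhdsWithin] with x hx
    rw [← hW.2 1 x one_pos hx]
    ring
  have e2 : ∫ x, w x ∂posMeasure = (∫ x in Ioc 0 1, w x) + ∫ x in Ioi 1, w x := by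
    rw [← setIntegral_union (Ioc_disjoint_Ioi le_rfl) measurableSet_Ioi
      (hi.mono_set fun x hx => hx.1) (hi.mono_set (Ioi_subset_Ioi zero_le_one)),
      Ioc_union_Ioi_eq_Ioi zero_le_one]
  rw [e2]
  linear_combination e1 - e0

/-- A lower bound `ε ≤ |W|` near `0` would make `1 / x` integrable there. -/
theorem frequently_lt_nhdsGT_of_integrable {W : ℝ → ℂ}
    (h : Integrable (fun x : ℝ => W x / x) posMeasure) {ε : ℝ} (hε : 0 < ε) :
    ∃ᶠ x in 𝓝[>] 0, ‖W x‖ < ε := by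
  intro hev
  obtain ⟨δ, hδ, H⟩ := mem_nhdsGT_iff_exists_Ioc_subset.1 hev
  have hδ' : (0 : ℝ) < δ := hδ
  have hi : IntegrableOn (fun x : ℝ => x⁻¹) (Ioc 0 δ) := by
    refine Integrable.mono' ((h.norm.const_mul ε⁻¹).mono_measure
      (Measure.restrict_mono (fun x hx => hx.1 : Ioc 0 δ ⊆ Ioi 0) le_rfl)) (by fun_prop) ?_
    rw [ae_restrict_iff' measurableSet_Ioc]
    refine Eventually.of_forall fun x hx => ?_
    have h1 : ε ≤ ‖W x‖ := not_lt.1 (H hx)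
    have hx0 : 0 < x := hx.1
    rw [norm_inv, norm_div, Complex.norm_real, Real.norm_of_nonneg hx0.le, inv_mul_eq_div,
      le_div_iff₀ hε, inv_mul_eq_div]
    gcongr
  have := (intervalIntegrable_iff_integrableOn_Ioc_of_le hδ'.le).2 hi
  rw [intervalIntegrable_inv_iff] at this
  rcases this with h1 | h1
  · exact hδ'.ne h1
  · exact h1 left_mem_uIcc

/-- A lower bound `ε ≤ |W|` near `∞` would make `1 / x` integrable there. -/
theorem frequently_lt_atTop_of_integrable {W : ℝ → ℂ}
    (h : Integrable (fun x : ℝ => W x / x) posMeasure) {ε : ℝ} (hε : 0 < ε) :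
    ∃ᶠ x in atTop, ‖W x‖ < ε := by
  intro hev
  obtain ⟨M, hM⟩ := eventually_atTop.1 (hev.and (eventually_gt_atTop 0))
  refine not_integrableOn_Ioi_inv (a := max M 0) ?_
  refine Integrable.mono' ((h.norm.const_mul ε⁻¹).mono_measure
    (Measure.restrict_mono (Ioi_subset_Ioi (le_max_right M 0)) le_rfl)) (by fun_prop) ?_
  rw [ae_restrict_iff' measurableSet_Ioi]
  refine Eventually.of_forall fun x hx => ?_
  have h2 := hM x ((le_max_left M 0).trans (le_of_lt hx))
  have h1 : ε ≤ ‖W x‖ := not_lt.1 h2.1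
  have hx0 : 0 < x := h2.2
  rw [norm_inv, norm_div, Complex.norm_real, Real.norm_of_nonneg hx0.le, inv_mul_eq_div,
    le_div_iff₀ hε, inv_mul_eq_div]
  gcongr

/-! ### The skew-symmetry pairings with the vectors `x^k p(x) e^{iηx}` -/

section Pairing

open Polynomial

variable {k : ℝ} {η : ℂ}

theorem inner_eq_integral (f g : L2Pos) :
    inner ℂ f g = ∫ x, (starRingEnd ℂ) (f x) * g x ∂posMeasure := by
  rw [L2.inner_def]
  refine integral_congr_ae (Eventually.of_forall fun x => ?_)
  simp only [RCLike.inner_apply]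
  ring

theorem integrable_conj_mul (f g : L2Pos) :
    Integrable (fun x => (starRingEnd ℂ) (f x) * g x) posMeasure := by
  refine (L2.integrable_inner (𝕜 := ℂ) f g).congr (Eventually.of_forall fun x => ?_)
  simp only [RCLike.inner_apply]
  ring

/-- Two vectors whose products with `φ` and `χ` add up to an integrable function with vanishing
integral are related by the skew-symmetry pairing. -/
theorem inner_eq_neg_inner_of_integral {φ χ f g : L2Pos} {w : ℝ → ℂ} (c : ℂ)
    (hw : ∀ᵐ x ∂posMeasure, (starRingEnd ℂ) (χ x) * f x + (starRingEnd ℂ) (φ x) * g x = c * w x)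
    (h0 : ∫ x, w x ∂posMeasure = 0) : inner ℂ χ f = -inner ℂ φ g := by
  rw [eq_neg_iff_add_eq_zero, inner_eq_integral, inner_eq_integral,
    ← integral_add (integrable_conj_mul χ f) (integrable_conj_mul φ g), integral_congr_ae hw,
    integral_const_mul, h0, mul_zero]

theorem isPrimitive_conj_weightFun (k : ℝ) (η : ℂ) (p : ℂ[X]) :
    IsPrimitive (fun x => (starRingEnd ℂ) (weightFun k η p x))
      fun x => (starRingEnd ℂ) (weightFun k η (eulerPoly k η p) x / x) := by
  refine IsPrimitive.of_hasDerivAt (fun x hx => (hasDerivAt_weightFun k η p hx).star) ?_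
  exact Complex.continuous_conj.comp_continuousOn (continuousOn_weightFun_div k η _)

variable (hk : -(1 / 2) < k) (hη : 0 < η.im)

/-- The boundary terms `2 x conj(φ) F` vanish at `0` and `∞` along a sequence, because `conj(φ) F` is
integrable. -/
theorem inner_weightVec_graphE0 (p : ℂ[X]) {f g : L2Pos} (hfg : (f, g) ∈ graphE0) :
    inner ℂ (weightVec hk hη (p + C 2 * eulerPoly k η p)) f = -inner ℂ (weightVec hk hη p) g := by
  obtain ⟨F, F', hF, hf, hg⟩ := hfg
  dsimp only at hf hg
  have hid : IsPrimitive (fun x : ℝ => (x : ℂ)) fun _ => 1 :=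
    IsPrimitive.of_hasDerivAt (fun x _ => Complex.ofRealCLM.hasDerivAt) continuousOn_const
  have hW := (hid.mul (isPrimitive_conj_weightFun k η p)).mul hF
  have hw : ∀ᵐ x ∂posMeasure,
      (starRingEnd ℂ) (weightVec hk hη (p + C 2 * eulerPoly k η p) x) * f x +
        (starRingEnd ℂ) (weightVec hk hη p x) * g x =
      2 * ((1 * (starRingEnd ℂ) (weightFun k η p x) +
        x * (starRingEnd ℂ) (weightFun k η (eulerPoly k η p) x / x)) * F x +
        x * (starRingEnd ℂ) (weightFun k η p x) * F' x) := by
    filter_upwards [hf, hg, coeFn_weightVec hk hη p,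
      coeFn_weightVec hk hη (p + C 2 * eulerPoly k η p),
      ae_restrict_mem measurableSet_Ioi] with x h1 h2 h3 h4 hx
    have hx' : (x : ℂ) ≠ 0 := by exact_mod_cast (ne_of_gt hx : x ≠ 0)
    rw [h1, h2, h3, h4, weightFun_add, weightFun_C_mul]
    simp only [map_add, map_mul, map_div₀, Complex.conj_ofReal, map_ofNat]
    field_simp
    linear_combination (-(starRingEnd ℂ) (weightFun k η p x) * (F x + 2 * x * F' x)) *
      Complex.I_sq
  refine inner_eq_neg_inner_of_integral 2 hw (hW.integral_eq_zero ?_ ?_ ?_)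
  · have h := ((integrable_conj_mul (weightVec hk hη (p + C 2 * eulerPoly k η p)) f).add
      (integrable_conj_mul (weightVec hk hη p) g)).const_mul (1 / 2)
    refine h.congr ?_
    filter_upwards [hw] with x hx
    simp only [Pi.add_apply]
    rw [hx]
    ring
  all_goals
    have hi : Integrable (fun x : ℝ => x * (starRingEnd ℂ) (weightFun k η p x) * F x / x)
        posMeasure := by
      refine (integrable_conj_mul (weightVec hk hη p) f).congr ?_
      filter_upwards [hf, coeFn_weightVec hk hη p, ae_restrict_mem measurableSet_Ioi]
        with x h1 h2 hx
      have hx' : (x : ℂ) ≠ 0 := by exact_mod_cast (ne_of_gt hx : x ≠ 0)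
      rw [h1, h2]
      field_simp
    intro ε hε
  · exact frequently_lt_nhdsGT_of_integrable hi hε
  · exact frequently_lt_atTop_of_integrable hi hε

theorem inner_weightVec_graphEp (p : ℂ[X]) {f g : L2Pos} (hfg : (f, g) ∈ graphEp) :
    inner ℂ (weightVec hk hη (C Complex.I * (X * p))) f = -inner ℂ (weightVec hk hη p) g := by
  have hg : g =ᵐ[posMeasure] fun x => Complex.I * (x * f x) := hfg
  refine inner_eq_neg_inner_of_integral (w := fun _ => 0) 0 ?_ (by simp)
  filter_upwards [hg, coeFn_weightVec hk hη p, coeFn_weightVec hk hη (C Complex.I * (X * p))]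
    with x h1 h2 h3
  rw [h1, h2, h3, weightFun_C_mul, weightFun_X_mul]
  simp only [map_mul, Complex.conj_ofReal, Complex.conj_I]
  ring

theorem weightFun_X_mul_isBigO (k : ℝ) (η : ℂ) (p : ℂ[X]) :
    weightFun k η (X * p) =O[𝓝[>] 0] fun x : ℝ => x ^ (k + 1) := by
  have h2 : (fun x : ℝ => (x : ℂ)) =O[𝓝[>] 0] fun x : ℝ => x :=
    IsBigO.of_bound 1 (Eventually.of_forall fun x => by rw [Complex.norm_real, one_mul])
  have h3 := h2.mul (weightFun_isBigO k η p)
  refine h3.congr' (Eventually.of_forall fun x => (weightFun_X_mul p x).symm) ?_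
  filter_upwards [self_mem_nhdsWithin] with x hx
  rw [Real.rpow_add_one (ne_of_gt hx), mul_comm]

/-- A primitive of a function in `L²(1, ∞)` grows at most linearly. -/
theorem IsPrimitive.exists_linear_bound {W h : ℝ → ℂ} (hW : IsPrimitive W h)
    (hh : MemLp h 2 (volume.restrict (Ioi 1))) : ∃ A : ℝ, ∀ x, 1 ≤ x → ‖W x‖ ≤ A + x := by
  have hi : Integrable (fun x => ‖h x‖ ^ 2) (volume.restrict (Ioi 1)) :=
    (memLp_two_iff_integrable_sq_norm hh.1).1 hh
  refine ⟨‖W 1‖ + ∫ x in Ioi 1, ‖h x‖ ^ 2, fun x hx => ?_⟩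
  have h1 := hW.2 1 x one_pos (one_pos.trans_le hx)
  have hi' : IntegrableOn (fun x => ‖h x‖ ^ 2) (Ioc 1 x) :=
    IntegrableOn.mono_set (t := Ioi 1) hi fun t ht => ht.1
  have h2 : ‖∫ t in (1 : ℝ)..x, h t‖ ≤ ∫ t in Ioc 1 x, (1 + ‖h t‖ ^ 2) := by
    rw [intervalIntegral.integral_of_le hx]
    refine norm_integral_le_of_norm_le ((integrable_const _).add hi')
      (Eventually.of_forall fun t => ?_)
    nlinarith [sq_nonneg (‖h t‖ - 1), sq_nonneg (‖h t‖)]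
  rw [integral_add (integrable_const _) hi'] at h2
  have h3 : ∫ t in Ioc 1 x, ‖h t‖ ^ 2 ≤ ∫ t in Ioi 1, ‖h t‖ ^ 2 :=
    setIntegral_mono_set hi (Eventually.of_forall fun t => sq_nonneg _)
      (Eventually.of_forall fun t (ht : t ∈ Ioc 1 x) => ht.1)
  have h4 : ∫ _ in Ioc 1 x, (1 : ℝ) = x - 1 := by
    simp [hx]
  have h5 : W x = W 1 + ∫ t in (1 : ℝ)..x, h t := by rw [← h1]; ring
  rw [h5]
  have := norm_add_le (W 1) (∫ t in (1 : ℝ)..x, h t)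
  linarith

/-- The pairing for `P Q P + k² Q⁻¹`; the boundary terms are `conj(φ) x F' - conj(x φ') F`. -/
theorem inner_weightVec_graphPreEm {p r : ℂ[X]}
    (hr : X * r = C (k ^ 2 : ℂ) * p - eulerPoly k η (eulerPoly k η p)) {f g : L2Pos}
    (hfg : (f, g) ∈ graphPreEm k) :
    inner ℂ (weightVec hk hη (C (-Complex.I) * r)) f = -inner ℂ (weightVec hk hη p) g := by
  obtain ⟨F, F', h, hF, hh, hf, hg, hO, ho, hlim⟩ := hfg
  dsimp only at hf hg
  have hFp : IsPrimitive F F' := by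
    refine IsPrimitive.of_hasDerivAt hF ?_
    have h1 : ContinuousOn (fun x : ℝ => (x : ℂ) * F' x / x) (Ioi 0) := by
      refine hh.continuousOn.div (by fun_prop) fun x hx => ?_
      exact_mod_cast (ne_of_gt hx : x ≠ 0)
    refine h1.congr fun x hx => ?_
    have hx' : (x : ℂ) ≠ 0 := by exact_mod_cast (ne_of_gt hx : x ≠ 0)
    field_simp
  have hW := ((isPrimitive_conj_weightFun k η p).mul hh).sub
    ((isPrimitive_conj_weightFun k η (eulerPoly k η p)).mul hFp)
  set q := eulerPoly k η p with hq
  have hw : ∀ᵐ x ∂posMeasure,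
      (starRingEnd ℂ) (weightVec hk hη (C (-Complex.I) * r) x) * f x +
        (starRingEnd ℂ) (weightVec hk hη p x) * g x =
      Complex.I * ((starRingEnd ℂ) (weightFun k η q x / x) * (x * F' x) +
          (starRingEnd ℂ) (weightFun k η p x) * h x -
        ((starRingEnd ℂ) (weightFun k η (eulerPoly k η q) x / x) * F x +
          (starRingEnd ℂ) (weightFun k η q x) * F' x)) := by
    filter_upwards [hf, hg, coeFn_weightVec hk hη p, coeFn_weightVec hk hη (C (-Complex.I) * r),
      ae_restrict_mem measurableSet_Ioi] with x h1 h2 h3 h4 hx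
    have hx' : (x : ℂ) ≠ 0 := by exact_mod_cast (ne_of_gt hx : x ≠ 0)
    have h6 := congrArg (fun q => weightFun k η q x) hr
    simp only [weightFun_sub, weightFun_C_mul, weightFun_X_mul] at h6
    have h5 := congrArg (starRingEnd ℂ) h6
    simp only [map_sub, map_mul, map_pow, Complex.conj_ofReal] at h5
    rw [h1, h2, h3, h4, weightFun_C_mul]
    simp only [map_mul, map_neg, map_div₀, Complex.conj_ofReal, Complex.conj_I]
    field_simp
    linear_combination F x * h5
  refine inner_eq_neg_inner_of_integral Complex.I hw (hW.integral_eq_zero ?_ ?_ ?_)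
  · have h1 := ((integrable_conj_mul (weightVec hk hη (C (-Complex.I) * r)) f).add
      (integrable_conj_mul (weightVec hk hη p) g)).const_mul (-Complex.I)
    refine h1.congr ?_
    filter_upwards [hw] with x hx
    simp only [Pi.add_apply]
    rw [hx, ← mul_assoc, neg_mul, Complex.I_mul_I, neg_neg, one_mul]
  · intro ε hε
    refine Eventually.frequently ?_
    -- at `0` they are rewritten as `conj(φ) (x F' - k F) - conj(x φ' - k φ) F`, where the factors are of
    -- orders `x^k`, `o(x^(-k))`, `x^(k+1)` and `x^k`
    have hq' : q = X * (derivative p + C (Complex.I * η) * p) + C (k : ℂ) * p := by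
      rw [hq, eulerPoly]
      ring
    have hconj : ∀ (s : ℂ[X]) (t : ℝ), weightFun k η s =O[𝓝[>] 0] (fun x : ℝ => x ^ t) →
        (fun x => (starRingEnd ℂ) (weightFun k η s x)) =O[𝓝[>] 0] fun x : ℝ => x ^ t :=
      fun s t hs => hs.norm_left.congr_left (fun x => by rw [← RCLike.norm_conj]) |>.of_norm_left
    have t1 := (hconj p k (weightFun_isBigO k η p)).mul_isLittleO ho
    have t2 := (hconj _ _ (weightFun_X_mul_isBigO k η (derivative p + C (Complex.I * η) * p))).mul
      hO
    have e1 : (fun x : ℝ => x ^ k * x ^ (-k)) =ᶠ[𝓝[>] 0] fun _ => (1 : ℝ) := by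
      filter_upwards [self_mem_nhdsWithin] with x hx
      rw [← Real.rpow_add hx, add_neg_cancel, Real.rpow_zero]
    have e2 : (fun x : ℝ => x ^ (k + 1) * x ^ k) =ᶠ[𝓝[>] 0] fun x : ℝ => x ^ (2 * k + 1) := by
      filter_upwards [self_mem_nhdsWithin] with x hx
      rw [← Real.rpow_add hx]
      congr 1
      ring
    have t3 : (fun x : ℝ => x ^ (2 * k + 1)) =o[𝓝[>] 0] fun _ => (1 : ℝ) := by
      simpa using rpow_isLittleO_at_zero (show (0 : ℝ) < 2 * k + 1 by linarith)
    have t4 := (t1.congr' EventuallyEq.rfl e1).sub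
      ((t2.congr' EventuallyEq.rfl e2).trans_isLittleO t3)
    have t5 := (isLittleO_one_iff ℝ).1 t4
    have t6 : Tendsto (fun x : ℝ => (starRingEnd ℂ) (weightFun k η p x) * (x * F' x) -
        (starRingEnd ℂ) (weightFun k η q x) * F x) (𝓝[>] 0) (𝓝 0) := by
      refine t5.congr fun x => ?_
      simp only [hq', weightFun_add, weightFun_C_mul, map_add, map_mul, Complex.conj_ofReal]
      ring
    filter_upwards [(tendsto_zero_iff_norm_tendsto_zero.1 t6).eventually (gt_mem_nhds hε)] with x hx
    exact hx
  · intro ε hε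
    refine Eventually.frequently ?_
    -- at `∞` the function `F` vanishes, and `x F'` grows at most linearly while `φ` decays
    -- exponentially: the derivative `h` of `x F'` is `k² F / x - i g`, which lies in `L²(1, ∞)`
    have hmem : MemLp h 2 (volume.restrict (Ioi 1)) := by
      have hle : volume.restrict (Ioi (1 : ℝ)) ≤ posMeasure :=
        Measure.restrict_mono (Ioi_subset_Ioi zero_le_one) le_rfl
      have m1 : MemLp (fun x => -Complex.I * g x) 2 (volume.restrict (Ioi 1)) :=
        ((Lp.memLp g).mono_measure hle).const_mul _
      have m2 : MemLp (fun x : ℝ => (k : ℂ) ^ 2 * (f x * (x : ℂ)⁻¹)) 2 (volume.restrict (Ioi 1)) := by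
        refine MemLp.const_mul ?_ _
        refine MemLp.of_le ((Lp.memLp f).mono_measure hle)
          (((Lp.memLp f).mono_measure hle).1.mul
            (by fun_prop : Measurable fun x : ℝ => (x : ℂ)⁻¹).aestronglyMeasurable) ?_
        rw [ae_restrict_iff' measurableSet_Ioi]
        refine Eventually.of_forall fun x hx => ?_
        have hx1 : (1 : ℝ) < x := hx
        rw [norm_mul, norm_inv, Complex.norm_real, Real.norm_of_nonneg (zero_le_one.trans hx1.le),
          ← div_eq_mul_inv]
        exact div_le_self (norm_nonneg _) hx1.le
      refine (memLp_congr_ae ?_).1 (m1.add m2)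
      filter_upwards [ae_mono hle hf, ae_mono hle hg] with x h1 h2
      simp only [Pi.add_apply]
      rw [h1, h2]
      linear_combination (-h x + k ^ 2 * F x / x) * Complex.I_sq
    obtain ⟨A, hA⟩ := hh.exists_linear_bound hmem
    have hb : ∀ s : ℂ[X], Tendsto (fun x => ‖weightFun k η s x‖) atTop (𝓝 0) := fun s => by
      simpa using (tendsto_pow_mul_weightFun k hη s 0).norm
    have hb1 : Tendsto (fun x : ℝ => x * ‖weightFun k η p x‖) atTop (𝓝 0) := by
      have := (tendsto_pow_mul_weightFun k hη p 1).norm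
      rw [norm_zero] at this
      refine this.congr' ?_
      filter_upwards [eventually_ge_atTop 0] with x hx
      rw [norm_mul, pow_one, Complex.norm_real, Real.norm_of_nonneg hx]
    have t1 := (((hb p).const_mul A).add hb1).add ((hb q).mul hlim.norm)
    simp only [mul_zero, norm_zero, add_zero] at t1
    filter_upwards [t1.eventually (gt_mem_nhds hε), eventually_ge_atTop 1] with x hx hx1
    refine lt_of_le_of_lt ?_ hx
    refine (norm_sub_le _ _).trans ?_
    rw [norm_mul _ ((x : ℂ) * F' x), norm_mul _ (F x), RCLike.norm_conj, RCLike.norm_conj]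
    have := mul_le_mul_of_nonneg_left (hA x hx1) (norm_nonneg (weightFun k η p x))
    linarith

end Pairing

/-! ### Closedness of the concrete operators -/

theorem exists_subseq_tendsto_ae {u : ℕ → L2Pos} {f : L2Pos} (h : Tendsto u atTop (𝓝 f)) :
    ∃ s : ℕ → ℕ, StrictMono s ∧ ∀ᵐ x ∂posMeasure, Tendsto (fun n => u (s n) x) atTop (𝓝 (f x)) :=
  (tendstoInMeasure_of_tendsto_Lp h).exists_seq_tendsto_ae

theorem graphEp_closed {u v : ℕ → L2Pos} {f g : L2Pos} (huv : ∀ n, (u n, v n) ∈ graphEp)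
    (hu : Tendsto u atTop (𝓝 f)) (hv : Tendsto v atTop (𝓝 g)) : (f, g) ∈ graphEp := by
  obtain ⟨s, hs, hsu⟩ := exists_subseq_tendsto_ae hu
  obtain ⟨t, ht, htv⟩ := exists_subseq_tendsto_ae (hv.comp hs.tendsto_atTop)
  have h1 : ∀ᵐ x ∂posMeasure, ∀ n, v n x = Complex.I * (x * u n x) := ae_all_iff.2 huv
  change g =ᵐ[posMeasure] fun x => Complex.I * (x * f x)
  filter_upwards [hsu, htv, h1] with x hx1 hx2 hx3
  refine tendsto_nhds_unique hx2 ?_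
  have h2 := ((hx1.comp ht.tendsto_atTop).const_mul (x : ℂ)).const_mul Complex.I
  refine h2.congr fun n => ?_
  exact (hx3 _).symm

/-- The functional `f ↦ ∫ₐᵇ f(x) / (2x) dx` is continuous on `L²(ℝ⁺)`. -/
theorem exists_inner_eq_integral {a b : ℝ} (ha : 0 < a) (hb : 0 < b) :
    ∃ φ : L2Pos →L[ℂ] ℂ, ∀ f : L2Pos, φ f = ∫ x in a..b, (1 / (2 * x) : ℂ) * f x := by
  have key : ∀ a b : ℝ, 0 < a → ∃ φ : L2Pos →L[ℂ] ℂ, ∀ f : L2Pos,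
      φ f = ∫ x in Ioc a b, (1 / (2 * x) : ℂ) * f x := by
    intro a b ha
    have hsub : Ioc a b ⊆ Ioi 0 := fun x hx => ha.trans hx.1
    have hres : posMeasure.restrict (Ioc a b) = volume.restrict (Ioc a b) := by
      rw [Measure.restrict_restrict measurableSet_Ioc, inter_eq_left.2 hsub]
    have hm : MemLp (fun x : ℝ => (1 / (2 * x) : ℂ)) 2 (posMeasure.restrict (Ioc a b)) := by
      rw [hres]
      refine MemLp.of_bound (Measurable.aestronglyMeasurable (by fun_prop)) (1 / (2 * a)) ?_
      rw [ae_restrict_iff' measurableSet_Ioc]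
      refine Eventually.of_forall fun x hx => ?_
      have hx0 : 0 < x := hsub hx
      have hax : a ≤ x := hx.1.le
      rw [norm_div, norm_mul, Complex.norm_real, norm_one, Real.norm_of_nonneg hx0.le,
        Complex.norm_ofNat]
      gcongr
    have hm' := (memLp_indicator_iff_restrict measurableSet_Ioc).2 hm
    refine ⟨innerSL ℂ hm'.toLp, fun f => ?_⟩
    rw [innerSL_apply_apply, inner_eq_integral, ← hres, ← integral_indicator measurableSet_Ioc]
    refine integral_congr_ae ?_
    filter_upwards [hm'.coeFn_toLp] with x hx
    rw [hx]
    by_cases hxm : x ∈ Ioc a b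
    · rw [indicator_of_mem hxm, indicator_of_mem hxm]
      simp only [map_div₀, map_one, map_mul, map_ofNat, Complex.conj_ofReal]
    · rw [indicator_of_notMem hxm, indicator_of_notMem hxm, map_zero, zero_mul]
  obtain ⟨φ, hφ⟩ := key a b ha
  obtain ⟨ψ, hψ⟩ := key b a hb
  refine ⟨φ - ψ, fun f => ?_⟩
  rw [sub_apply, hφ, hψ, intervalIntegral]

theorem locallyIntegrableOn_inv_mul (f : L2Pos) :
    LocallyIntegrableOn (fun x : ℝ => (1 / (2 * x) : ℂ) * f x) (Ioi 0) := by
  have h1 : LocallyIntegrableOn f (Ioi 0) := by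
    refine (locallyIntegrableOn_of_locallyIntegrable_restrict ?_)
    exact (Lp.memLp f).locallyIntegrable one_le_two
  refine h1.continuousOn_mul (fun x hx => ?_) isOpen_Ioi.isLocallyClosed
  have hx' : (x : ℂ) ≠ 0 := by exact_mod_cast (ne_of_gt hx : x ≠ 0)
  refine ContinuousAt.continuousWithinAt ?_
  refine ContinuousAt.div (by fun_prop) (by fun_prop) (mul_ne_zero two_ne_zero hx')

theorem IsPrimitive.congr_deriv {F f g : ℝ → ℂ} (hF : IsPrimitive F f)
    (hg : LocallyIntegrableOn g (Ioi 0)) (hfg : f =ᵐ[posMeasure] g) : IsPrimitive F g := by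
  refine ⟨hg, fun a b ha hb => ?_⟩
  rw [hF.2 a b ha hb]
  refine intervalIntegral.integral_congr_ae ?_
  have h := (ae_restrict_iff' measurableSet_Ioi).1 hfg
  filter_upwards [h] with x hx hxm
  exact hx (uIcc_subset_Ioi_zero ha hb (uIoc_subset_uIcc hxm))

/-- A pair `(f, g)` lies in the graph of `E₀` when `f` has the derivative `(g - f) / (2x)`. -/
theorem mem_graphE0_iff {f g : L2Pos} : (f, g) ∈ graphE0 ↔
    ∃ F : ℝ → ℂ, f =ᵐ[posMeasure] F ∧
      IsPrimitive F fun x => (1 / (2 * x) : ℂ) * (g - f : L2Pos) x := by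
  constructor
  · rintro ⟨F, F', hF, hf, hg⟩
    dsimp only at hf hg
    refine ⟨F, hf, hF.congr_deriv (locallyIntegrableOn_inv_mul _) ?_⟩
    filter_upwards [hf, hg, Lp.coeFn_sub g f, ae_restrict_mem measurableSet_Ioi] with x h1 h2 h3 hx
    have hx' : (x : ℂ) ≠ 0 := by exact_mod_cast (ne_of_gt hx : x ≠ 0)
    rw [h3, Pi.sub_apply, h1, h2]
    field_simp
    linear_combination (F x + 2 * x * F' x) * Complex.I_sq
  · rintro ⟨F, hf, hF⟩
    refine ⟨F, _, hF, hf, ?_⟩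
    filter_upwards [hf, Lp.coeFn_sub g f, ae_restrict_mem measurableSet_Ioi] with x h1 h3 hx
    have hx' : (x : ℂ) ≠ 0 := by exact_mod_cast (ne_of_gt hx : x ≠ 0)
    rw [h3, Pi.sub_apply, h1]
    field_simp
    linear_combination 2 * g x * Complex.I_sq

/-- Along a subsequence converging almost everywhere, the primitives converge at one point `a`, and
their increments converge everywhere. -/
theorem graphE0_closed {u v : ℕ → L2Pos} {f g : L2Pos} (huv : ∀ n, (u n, v n) ∈ graphE0)
    (hu : Tendsto u atTop (𝓝 f)) (hv : Tendsto v atTop (𝓝 g)) : (f, g) ∈ graphE0 := by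
  choose F hF hFp using fun n => mem_graphE0_iff.1 (huv n)
  obtain ⟨s, hs, hsu⟩ := exists_subseq_tendsto_ae hu
  have hall : ∀ᵐ x ∂posMeasure, ∀ n, u n x = F n x := ae_all_iff.2 hF
  have hlim : ∀ᵐ x ∂posMeasure, Tendsto (fun n => F (s n) x) atTop (𝓝 (f x)) := by
    filter_upwards [hsu, hall] with x h1 h2
    exact h1.congr fun n => h2 _
  have : NeBot (ae posMeasure) := by
    rw [ae_neBot, Ne, Measure.restrict_eq_zero]
    simp
  obtain ⟨a, ha, ha0⟩ := (hlim.and (ae_restrict_mem measurableSet_Ioi)).exists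
  have hint : ∀ b, 0 < b → Tendsto (fun n => F (s n) b) atTop
      (𝓝 (f a + ∫ x in a..b, (1 / (2 * x) : ℂ) * (g - f : L2Pos) x)) := by
    intro b hb
    obtain ⟨φ, hφ⟩ := exists_inner_eq_integral ha0 hb
    rw [← hφ]
    have h1 := (φ.continuous.tendsto _).comp ((hv.sub hu).comp hs.tendsto_atTop)
    refine (ha.add h1).congr fun n => ?_
    simp only [Function.comp_apply]
    rw [hφ, ← (hFp (s n)).2 a b ha0 hb]
    ring
  refine mem_graphE0_iff.2 ⟨fun b => f a + ∫ x in a..b, (1 / (2 * x) : ℂ) * (g - f : L2Pos) x,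
    ?_, locallyIntegrableOn_inv_mul _, fun b c hb hc => ?_⟩
  · filter_upwards [hlim, ae_restrict_mem measurableSet_Ioi] with b h1 hb
    exact tendsto_nhds_unique h1 (hint b hb)
  · have hi : ∀ c, 0 < c → IntervalIntegrable
        (fun x : ℝ => (1 / (2 * x) : ℂ) * (g - f : L2Pos) x) volume a c := fun c hc =>
      ((locallyIntegrableOn_inv_mul _).integrableOn_compact_subset
        (uIcc_subset_Ioi_zero ha0 hc) isCompact_uIcc).intervalIntegrable
    rw [add_sub_add_left_eq_sub, intervalIntegral.integral_interval_sub_left (hi c hc) (hi b hb)]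

/-! ### Functions with exponential decay and vanishing moments -/

open ProbabilityTheory in
/-- A real function which decays exponentially, in the mean, and all of whose moments vanish is
zero: its positive and its negative part have the same moments, so the generating functions of the
two measures agree near `0`, hence on a strip around the imaginary axis. -/
theorem ae_eq_zero_of_moments {ν : Measure ℝ} [SigmaFinite ν] {g : ℝ → ℝ} {δ : ℝ} (hδ : 0 < δ)
    (hg : ∀ t : ℝ, |t| < δ → Integrable (fun x => g x * Real.exp (t * x)) ν)
    (h0 : ∀ n : ℕ, ∫ x, x ^ n * g x ∂ν = 0) : g =ᵐ[ν] 0 := by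
  have hgi : Integrable g ν := by simpa using hg 0 (by simpa using hδ)
  set μ : ℝ → Measure ℝ := fun s => ν.withDensity fun x => ENNReal.ofReal (s * g x) with hμ
  have hm : ∀ s : ℝ, AEMeasurable (fun x => ENNReal.ofReal (s * g x)) ν := fun s =>
    (hgi.1.aemeasurable.const_mul s).ennreal_ofReal
  have hlt : ∀ s : ℝ, ∀ᵐ x ∂ν, ENNReal.ofReal (s * g x) < ⊤ := fun s =>
    Eventually.of_forall fun x => ENNReal.ofReal_lt_top
  have hfin : ∀ s, IsFiniteMeasure (μ s) := fun s =>
    isFiniteMeasure_withDensity_ofReal (hgi.const_mul s).2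
  have hset : ∀ s, Ioo (-δ) δ ⊆ integrableExpSet id (μ s) := by
    intro s t ht
    rw [integrableExpSet, mem_ofPred_eq, hμ,
      integrable_withDensity_iff_integrable_smul₀' (hm s) (hlt s)]
    refine (((hg t (abs_lt.2 ht)).const_mul s).pos_part).congr (Eventually.of_forall fun x => ?_)
    simp only [ENNReal.toReal_ofReal', smul_eq_mul, id]
    rw [max_mul_of_nonneg _ _ (Real.exp_pos _).le, zero_mul, mul_assoc]
  have hint : ∀ s, Ioo (-δ) δ ⊆ interior (integrableExpSet id (μ s)) := fun s =>
    interior_maximal (hset s) isOpen_Ioo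
  have hmem0 : (0 : ℝ) ∈ Ioo (-δ) δ := ⟨neg_lt_zero.2 hδ, hδ⟩
  set U : Set ℂ := {z | z.re ∈ Ioo (-δ) δ} with hU
  have han : ∀ s, AnalyticOnNhd ℂ (complexMGF id (μ s)) U := fun s =>
    analyticOnNhd_complexMGF.mono fun z hz => hint s hz
  have hconv : IsPreconnected U := by
    have : Convex ℝ U := (convex_Ioo (-δ) δ).linear_preimage Complex.reCLM.toLinearMap
    exact this.isPreconnected
  have h0U : (0 : ℂ) ∈ U := hmem0
  have hmom : ∀ n : ℕ, ∫ x, x ^ n ∂(μ 1) = ∫ x, x ^ n ∂(μ (-1)) := by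
    intro n
    have hp : ∀ s, Integrable (fun x : ℝ => (ENNReal.ofReal (s * g x)).toReal • x ^ n) ν := by
      intro s
      have := integrable_pow_of_mem_interior_integrableExpSet (hint s hmem0) n
      simp only [id] at this
      rwa [hμ, integrable_withDensity_iff_integrable_smul₀' (hm s) (hlt s)] at this
    rw [hμ, integral_withDensity_eq_integral_toReal_smul₀ (hm 1) (hlt 1),
      integral_withDensity_eq_integral_toReal_smul₀ (hm (-1)) (hlt (-1)), ← sub_eq_zero,
      ← integral_sub (hp 1) (hp (-1)), ← h0 n]
    refine integral_congr_ae (Eventually.of_forall fun x => ?_)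
    simp only [ENNReal.toReal_ofReal', smul_eq_mul, one_mul, neg_one_mul]
    rw [← sub_mul, max_zero_sub_eq_self, mul_comm]
  have hderiv : ∀ n : ℕ, iteratedDeriv n (complexMGF id (μ 1)) 0 =
      iteratedDeriv n (complexMGF id (μ (-1))) 0 := by
    intro n
    have e : ∀ s, iteratedDeriv n (complexMGF id (μ s)) 0 = ((∫ x, x ^ n ∂(μ s) : ℝ) : ℂ) := by
      intro s
      rw [iteratedDeriv_complexMGF (hint s hmem0)]
      simp only [id, zero_mul, Complex.exp_zero, mul_one]
      rw [← integral_complex_ofReal]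
      simp only [Complex.ofReal_pow]
    rw [e, e, hmom]
  have hloc : complexMGF id (μ 1) =ᶠ[𝓝 0] complexMGF id (μ (-1)) := by
    have p1 := (han 1 0 h0U).hasFPowerSeriesAt
    have p2 := (han (-1) 0 h0U).hasFPowerSeriesAt
    simp only [hderiv] at p1
    have p3 := p1.sub p2
    rw [sub_self] at p3
    filter_upwards [p3.eventually_eq_zero] with z hz
    exact sub_eq_zero.1 hz
  have heq := (han 1).eqOn_of_preconnected_of_eventuallyEq (han (-1)) hconv h0U hloc
  have hμeq : μ 1 = μ (-1) := by
    refine Measure.ext_of_charFun (funext fun t => ?_)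
    rw [← complexMGF_id_mul_I, ← complexMGF_id_mul_I]
    exact heq (by simpa [hU] using hδ)
  have hd := (withDensity_eq_iff_of_sigmaFinite (hm 1) (hm (-1))).1 hμeq
  filter_upwards [hd] with x hx
  have h1 := congrArg ENNReal.toReal hx
  simp only [ENNReal.toReal_ofReal', one_mul, neg_one_mul] at h1
  have h2 := max_zero_sub_eq_self (g x)
  rw [h1, sub_self] at h2
  exact h2.symm

/-- The same for complex functions. -/
theorem ae_eq_zero_of_moments_complex {ν : Measure ℝ} [SigmaFinite ν] {g : ℝ → ℂ} {δ : ℝ}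
    (hδ : 0 < δ) (hg : ∀ t : ℝ, |t| < δ → Integrable (fun x : ℝ => g x * Real.exp (t * x)) ν)
    (hp : ∀ n : ℕ, Integrable (fun x : ℝ => (x : ℂ) ^ n * g x) ν)
    (h0 : ∀ n : ℕ, ∫ x : ℝ, (x : ℂ) ^ n * g x ∂ν = 0) : g =ᵐ[ν] 0 := by
  have hre : (fun x => (g x).re) =ᵐ[ν] 0 := by
    refine ae_eq_zero_of_moments hδ (fun t ht => ?_) fun n => ?_
    · refine (hg t ht).re.congr (Eventually.of_forall fun x => ?_)
      exact Complex.re_mul_ofReal _ _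
    · have h := congrArg Complex.re (h0 n)
      rw [← Complex.reCLM_apply, ← Complex.reCLM.integral_comp_comm (hp n),
        Complex.zero_re] at h
      rw [← h]
      refine integral_congr_ae (Eventually.of_forall fun x => ?_)
      simp [← Complex.ofReal_pow]
  have him : (fun x => (g x).im) =ᵐ[ν] 0 := by
    refine ae_eq_zero_of_moments hδ (fun t ht => ?_) fun n => ?_
    · refine (hg t ht).im.congr (Eventually.of_forall fun x => ?_)
      exact Complex.im_mul_ofReal _ _
    · have h := congrArg Complex.im (h0 n)
      rw [← Complex.imCLM_apply, ← Complex.imCLM.integral_comp_comm (hp n),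
        Complex.zero_im] at h
      rw [← h]
      refine integral_congr_ae (Eventually.of_forall fun x => ?_)
      simp [← Complex.ofReal_pow]
  filter_upwards [hre, him] with x h1 h2
  exact Complex.ext h1 h2

/-! ### The Laguerre basis -/

section LaguerreBasis

open Polynomial

variable {k : ℝ} {η : ℂ}

theorem weightFun_one (k : ℝ) (η : ℂ) (x : ℝ) :
    weightFun k η 1 x = ((x ^ k : ℝ) : ℂ) * Complex.exp (Complex.I * η * x) := by
  rw [weightFun, eval_one, mul_one]

theorem weightFun_X_pow (k : ℝ) (η : ℂ) (n : ℕ) (x : ℝ) :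
    weightFun k η (X ^ n) x = (x : ℂ) ^ n * weightFun k η 1 x := by
  simp only [weightFun, eval_pow, eval_X, eval_one]
  ring

theorem weightFun_sub_mul_I (k : ℝ) (η : ℂ) (t x : ℝ) :
    weightFun k (η - t * Complex.I) 1 x = weightFun k η 1 x * Real.exp (t * x) := by
  rw [weightFun_one, weightFun_one, mul_assoc ((x ^ k : ℝ) : ℂ), Complex.ofReal_exp, ← Complex.exp_add]
  congr 2
  push_cast
  linear_combination (-t * x) * Complex.I_sq

/-- Completeness: the vectors `x^k p(x) e^{iηx}` with polynomials `p` span a dense subspace. -/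
theorem eq_zero_of_inner_weightVec (hk : -(1 / 2) < k) (hη : 0 < η.im) {f : L2Pos}
    (h : ∀ p : ℂ[X], inner ℂ (weightVec hk hη p) f = 0) : f = 0 := by
  have hn : ∀ n : ℕ, (fun x => (starRingEnd ℂ) (weightVec hk hη (X ^ n) x) * f x) =ᵐ[posMeasure]
      fun x => (x : ℂ) ^ n * ((starRingEnd ℂ) (weightFun k η 1 x) * f x) := by
    intro n
    filter_upwards [coeFn_weightVec hk hη (X ^ n)] with x hx
    rw [hx, weightFun_X_pow, map_mul, map_pow, Complex.conj_ofReal, mul_assoc]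
  have hz : (fun x => (starRingEnd ℂ) (weightFun k η 1 x) * f x) =ᵐ[posMeasure] 0 := by
    refine ae_eq_zero_of_moments_complex hη (fun t ht => ?_) (fun n => ?_) fun n => ?_
    -- the exponential weight `e^{tx}` is absorbed by moving `η` to `η - i t`
    · have hη' : 0 < (η - t * Complex.I).im := by
        simp only [Complex.sub_im, Complex.mul_im, Complex.ofReal_re, Complex.ofReal_im,
          Complex.I_im, Complex.I_re, mul_one, mul_zero, add_zero, sub_pos]
        exact (le_abs_self t).trans_lt ht
      refine (integrable_conj_mul (weightVec hk hη' 1) f).congr ?_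
      filter_upwards [coeFn_weightVec hk hη' 1] with x hx
      rw [hx, weightFun_sub_mul_I, map_mul, Complex.conj_ofReal]
      ring
    · exact (integrable_conj_mul (weightVec hk hη (X ^ n)) f).congr (hn n)
    · rw [← integral_congr_ae (hn n), ← inner_eq_integral, h]
  rw [Lp.eq_zero_iff_ae_eq_zero]
  filter_upwards [hz, ae_restrict_mem measurableSet_Ioi] with x hx hx0
  have hne : weightFun k η 1 x ≠ 0 := by
    rw [weightFun_one]
    refine mul_ne_zero ?_ (Complex.exp_ne_zero _)
    exact_mod_cast (Real.rpow_pos_of_pos hx0 k).ne'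
  exact (mul_eq_zero.1 hx).resolve_left (by simpa using hne)

/-- Euler's integral for the Gamma function. -/
theorem norm_weightVec_C_sq (hk : -(1 / 2) < k) (hη : 0 < η.im) (c : ℂ) :
    ‖weightVec hk hη (C c)‖ ^ 2 =
      ‖c‖ ^ 2 * ((1 / (2 * η.im)) ^ (2 * k + 1) * Real.Gamma (2 * k + 1)) := by
  have h1 : ((‖weightVec hk hη (C c)‖ ^ 2 : ℝ) : ℂ) =
      ∫ x, ((‖c‖ ^ 2 * (x ^ (2 * k + 1 - 1) * Real.exp (-(2 * η.im * x))) : ℝ) : ℂ)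
        ∂posMeasure := by
    have h0 : inner ℂ (weightVec hk hη (C c)) (weightVec hk hη (C c)) =
        ((‖weightVec hk hη (C c)‖ ^ 2 : ℝ) : ℂ) := by
      rw [inner_self_eq_norm_sq_to_K, Complex.ofReal_pow]
      rfl
    rw [← h0, inner_eq_integral]
    refine integral_congr_ae ?_
    filter_upwards [coeFn_weightVec hk hη (C c), ae_restrict_mem measurableSet_Ioi] with x hx hx0
    have hx0' : (0 : ℝ) < x := hx0
    rw [hx, ← Complex.normSq_eq_conj_mul_self, Complex.normSq_eq_norm_sq, weightFun, eval_C,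
      norm_mul, norm_mul, norm_exp_I_mul, Complex.norm_real,
      Real.norm_of_nonneg (Real.rpow_nonneg hx0'.le k), mul_pow, mul_pow, ← Real.exp_nat_mul,
      ← Real.rpow_mul_natCast hx0'.le]
    congr 1
    have e1 : k * ((2 : ℕ) : ℝ) = 2 * k + 1 - 1 := by push_cast; ring
    have e2 : ((2 : ℕ) : ℝ) * -(η.im * x) = -(2 * η.im * x) := by push_cast; ring
    rw [e1, e2]
    ring
  rw [integral_complex_ofReal, Complex.ofReal_inj, integral_const_mul,
    Real.integral_rpow_mul_exp_neg_mul_Ioi (by linarith) (by linarith)] at h1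
  exact h1

theorem zero_lt_I_im : 0 < Complex.I.im := by simp

/-- The vector of `L²(ℝ⁺)` of the `n`-th Laguerre function. -/
def laguerreVec (hk : -(1 / 2) < k) (n : ℕ) : L2Pos :=
  weightVec hk zero_lt_I_im (weightPoly (2 * k + 1) n)

theorem eulerPoly_I (k : ℝ) (p : ℂ[X]) :
    eulerPoly k Complex.I p = X * derivative p + (C (k : ℂ) - X) * p := by
  rw [eulerPoly, Complex.I_mul_I, C_neg, C_1]
  ring

variable (hk : -(1 / 2) < k)

theorem two_mul_add_one_pos {k : ℝ} (hk : -(1 / 2) < k) : 0 < 2 * k + 1 := by linarith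

theorem ladderVec_laguerreVec (α β : ℂ) (n : ℕ) :
    ladderVec (laguerreVec hk) (2 * k + 1) α β n = weightVec hk zero_lt_I_im
      (C (α * ladderWeight (2 * k + 1) (n + 1)) * weightPoly (2 * k + 1) (n + 1) +
        C (β * ((2 * k + 1 : ℝ) + 2 * n)) * weightPoly (2 * k + 1) n -
        C ((starRingEnd ℂ) α * ladderWeight (2 * k + 1) n) * weightPoly (2 * k + 1) (n - 1)) := by
  rw [weightVec_sub, weightVec_add, weightVec_C_mul, weightVec_C_mul, weightVec_C_mul]
  rfl

theorem ladderVec_laguerreVec_zero (n : ℕ) :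
    ladderVec (laguerreVec hk) (2 * k + 1) 1 0 n = weightVec hk zero_lt_I_im
      (weightPoly (2 * k + 1) n + C 2 * eulerPoly k Complex.I (weightPoly (2 * k + 1) n)) := by
  rw [ladderVec_laguerreVec, eulerPoly_I]
  congr 1
  have h1 := weightPoly_lower (two_mul_add_one_pos hk) n
  have h2 := weightPoly_raise (two_mul_add_one_pos hk) n
  push_cast at h1 h2 ⊢
  simp only [map_add, map_mul, map_one, zero_mul, one_mul, C_0] at h1 h2 ⊢
  have e2 : (C 2 : ℂ[X]) = 2 := rfl
  rw [e2] at h2 ⊢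
  linear_combination -h1 - h2

theorem ladderVec_laguerreVec_plus (n : ℕ) :
    ladderVec (laguerreVec hk) (2 * k + 1) (-Complex.I / 2) (Complex.I / 2) n =
      weightVec hk zero_lt_I_im (C Complex.I * (X * weightPoly (2 * k + 1) n)) := by
  rw [ladderVec_laguerreVec, conj_neg_I_half, neg_div, neg_neg]
  congr 1
  have h1 := X_mul_weightPoly (two_mul_add_one_pos hk) n
  have e2 : (C 2 : ℂ[X]) = 2 := rfl
  have e3 : (C (Complex.I / 2) : ℂ[X]) * 2 = C Complex.I := by
    rw [← e2, ← C_mul, div_mul_cancel₀ _ two_ne_zero]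
  rw [← e3]
  push_cast at h1 ⊢
  simp only [map_add, map_mul, map_one] at h1 ⊢
  rw [e2] at h1 ⊢
  rw [C_neg]
  linear_combination -C (Complex.I / 2) * h1

/-- The polynomial `(λ + 2n - x) p_n`, by which `P Q P + k² Q⁻¹` acts on the Laguerre function. -/
def laguerreImage (k : ℝ) (n : ℕ) : ℂ[X] :=
  (C ((2 * k + 1 : ℝ) + 2 * n : ℂ) - X) * weightPoly (2 * k + 1) n

theorem X_mul_laguerreImage {k : ℝ} (hk : -(1 / 2) < k) (n : ℕ) :
    X * laguerreImage k n = C (k ^ 2 : ℂ) * weightPoly (2 * k + 1) n -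
      eulerPoly k Complex.I (eulerPoly k Complex.I (weightPoly (2 * k + 1) n)) := by
  have h := weightPoly_ode (two_mul_add_one_pos hk) n
  have e2 : (C 2 : ℂ[X]) = 2 := rfl
  rw [eulerPoly_I, eulerPoly_I, laguerreImage]
  simp only [derivative_mul, derivative_add, derivative_sub, derivative_X, derivative_C]
  push_cast at h ⊢
  simp only [map_add, map_mul, map_one, map_pow] at h ⊢
  rw [e2] at h ⊢
  linear_combination (X : ℂ[X]) * h

theorem ladderVec_laguerreVec_minus (n : ℕ) :
    ladderVec (laguerreVec hk) (2 * k + 1) (-Complex.I / 2) (-Complex.I / 2) n =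
      weightVec hk zero_lt_I_im (C (-Complex.I) * laguerreImage k n) := by
  rw [ladderVec_laguerreVec, conj_neg_I_half, neg_div, neg_neg, laguerreImage]
  congr 1
  have h1 := X_mul_weightPoly (two_mul_add_one_pos hk) n
  have e2 : (C 2 : ℂ[X]) = 2 := rfl
  have e3 : (C (Complex.I / 2) : ℂ[X]) * 2 = C Complex.I := by
    rw [← e2, ← C_mul, div_mul_cancel₀ _ two_ne_zero]
  rw [C_neg, ← e3]
  push_cast at h1 ⊢
  simp only [map_add, map_mul, map_one] at h1 ⊢
  rw [e2] at h1 ⊢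
  rw [C_neg]
  linear_combination -C (Complex.I / 2) * h1

theorem laguerreVec_mem_zero (n : ℕ) :
    (laguerreVec hk n, ladderVec (laguerreVec hk) (2 * k + 1) 1 0 n) ∈ graphE0 := by
  rw [ladderVec_laguerreVec_zero]
  exact weightVec_mem_graphE0 hk zero_lt_I_im _

theorem laguerreVec_mem_plus (n : ℕ) :
    (laguerreVec hk n, ladderVec (laguerreVec hk) (2 * k + 1) (-Complex.I / 2) (Complex.I / 2) n) ∈
      graphEp := by
  rw [ladderVec_laguerreVec_plus]
  exact weightVec_mem_graphEp hk zero_lt_I_im _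

theorem laguerreVec_mem_minus (n : ℕ) :
    (laguerreVec hk n,
      ladderVec (laguerreVec hk) (2 * k + 1) (-Complex.I / 2) (-Complex.I / 2) n) ∈
        graphPreEm k := by
  rw [ladderVec_laguerreVec_minus]
  exact weightVec_mem_graphPreEm hk zero_lt_I_im (X_mul_laguerreImage hk n)

theorem inner_laguerreVec_zero (n : ℕ) {f g : L2Pos} (h : (f, g) ∈ graphE0) :
    inner ℂ (ladderVec (laguerreVec hk) (2 * k + 1) 1 0 n) f = -inner ℂ (laguerreVec hk n) g := by
  rw [ladderVec_laguerreVec_zero]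
  exact inner_weightVec_graphE0 hk zero_lt_I_im _ h

theorem inner_laguerreVec_plus (n : ℕ) {f g : L2Pos} (h : (f, g) ∈ graphEp) :
    inner ℂ (ladderVec (laguerreVec hk) (2 * k + 1) (-Complex.I / 2) (Complex.I / 2) n) f =
      -inner ℂ (laguerreVec hk n) g := by
  rw [ladderVec_laguerreVec_plus]
  exact inner_weightVec_graphEp hk zero_lt_I_im _ h

theorem inner_laguerreVec_minus (n : ℕ) {f g : L2Pos} (h : (f, g) ∈ graphPreEm k) :
    inner ℂ (ladderVec (laguerreVec hk) (2 * k + 1) (-Complex.I / 2) (-Complex.I / 2) n) f =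
      -inner ℂ (laguerreVec hk n) g := by
  rw [ladderVec_laguerreVec_minus]
  exact inner_weightVec_graphPreEm hk zero_lt_I_im (X_mul_laguerreImage hk n) h

theorem orthonormal_laguerreVec : Orthonormal ℂ (laguerreVec hk) := by
  have hl := two_mul_add_one_pos hk
  refine orthonormal_of_ladder hl ?_ fun n m => ?_
  · have h1 := norm_weightVec_C_sq hk zero_lt_I_im (laguerreNorm (2 * k + 1) 0 : ℂ)
    have h2 : laguerreNorm (2 * k + 1) 0 ^ 2 = 2 ^ (2 * k + 1) / Real.Gamma (2 * k + 1) := by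
      have hG := Real.Gamma_pos_of_pos hl
      rw [laguerreNorm, Nat.cast_zero, zero_add, Nat.factorial_zero, Nat.cast_one, mul_one,
        Real.sq_sqrt (by positivity)]
    rw [Complex.norm_real, Real.norm_eq_abs, sq_abs, h2, Complex.I_im, mul_one, one_div,
      Real.inv_rpow two_pos.le, ← weightPoly_zero hl] at h1
    have hG := (Real.Gamma_pos_of_pos hl).ne'
    have h3 : (2 : ℝ) ^ (2 * k + 1) ≠ 0 := (Real.rpow_pos_of_pos two_pos _).ne'
    field_simp at h1
    exact (pow_eq_one_iff_of_nonneg (norm_nonneg _) two_ne_zero).1 h1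
  · have h0 := inner_laguerreVec_zero hk n (laguerreVec_mem_zero hk m)
    have h1 := inner_laguerreVec_plus hk n (laguerreVec_mem_plus hk m)
    have h2 := inner_laguerreVec_minus hk n (laguerreVec_mem_minus hk m)
    simp only [ladderVec, inner_add_left, inner_sub_left, inner_add_right, inner_sub_right,
      inner_smul_left, inner_smul_right, map_mul, map_add, map_one, map_zero, map_neg, map_div₀,
      Complex.conj_I, Complex.conj_ofReal, map_ofNat, map_natCast] at h0 h1 h2
    -- the pairing of `L₊ = (E₀ + i (E₊ + E₋)) / 2` with `-L₋`, where `i` is conjugated on the left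
    linear_combination (1 / 2) * h0 - Complex.I / 2 * h1 - Complex.I / 2 * h2 +
      (1 / 2) * (ladderWeight (2 * k + 1) (n + 1) *
          inner ℂ (laguerreVec hk (n + 1)) (laguerreVec hk m) -
        ladderWeight (2 * k + 1) (m + 1) * inner ℂ (laguerreVec hk n) (laguerreVec hk (m + 1)) -
        ladderWeight (2 * k + 1) m * inner ℂ (laguerreVec hk n) (laguerreVec hk (m - 1)) +
        ladderWeight (2 * k + 1) n * inner ℂ (laguerreVec hk (n - 1)) (laguerreVec hk m)) *
        Complex.I_sq

/-- The Hilbert basis of Laguerre functions. -/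
def laguerreBasis : HilbertBasis ℕ ℂ L2Pos :=
  HilbertBasis.mkOfOrthogonalEqBot (orthonormal_laguerreVec hk) (by
    rw [Submodule.eq_bot_iff]
    intro f hf
    have hf' : ∀ n, inner ℂ (laguerreVec hk n) f = 0 := fun n =>
      (Submodule.mem_orthogonal _ _).1 hf _ (Submodule.subset_span ⟨n, rfl⟩)
    refine eq_zero_of_inner_weightVec hk zero_lt_I_im fun p => ?_
    have hp : p ∈ Submodule.span ℂ (range (weightPoly (2 * k + 1))) := by
      rw [span_weightPoly (two_mul_add_one_pos hk)]
      trivial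
    induction hp using Submodule.span_induction with
    | mem p hp =>
      obtain ⟨n, rfl⟩ := hp
      exact hf' n
    | zero =>
      have := weightVec_C_mul hk zero_lt_I_im 0 0
      rw [C_0, zero_mul, zero_smul] at this
      rw [this, inner_zero_left]
    | add p q _ _ hp hq => rw [weightVec_add, inner_add_left, hp, hq, add_zero]
    | smul c p _ hp => rw [← C_mul', weightVec_C_mul, inner_smul_left, hp, mul_zero])

theorem coe_laguerreBasis : (laguerreBasis hk : ℕ → L2Pos) = laguerreVec hk :=
  HilbertBasis.coe_mkOfOrthogonalEqBot _ _

end LaguerreBasis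

/-! ### The representation on `L²(ℝ⁺)` -/

section Concrete

open Polynomial

variable {k : ℝ} (hk : -(1 / 2) < k)

/-- The operator with the tridiagonal matrix of `E₋` in the Laguerre basis. -/
def laguerreEm : L2Pos →ₗ.[ℂ] L2Pos :=
  ladderOp (laguerreBasis hk) (2 * k + 1) (-Complex.I / 2) (-Complex.I / 2)

theorem preEm_le_laguerreEm : preEm k ≤ laguerreEm hk := by
  rw [← LinearPMap.le_graph_iff, preEm_graph, laguerreEm, ladderOp_graph]
  rintro ⟨f, g⟩ h m
  have h1 := inner_laguerreVec_minus hk m h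
  rw [← coe_laguerreBasis, inner_ladderVec_left _ _ conj_neg_I_half] at h1
  exact (neg_injective h1).symm

theorem isLadderTriple_laguerre :
    IsLadderTriple (laguerreBasis hk) (2 * k + 1) concreteE0 concreteEp (laguerreEm hk) where
  zero := by
    rw [concreteE0_graph]
    refine graph_eq_ladderGraph _ (two_mul_add_one_pos hk) (by simp) (fun n => ?_)
      (fun n x y h => ?_) fun u v x y huv hu hv => graphE0_closed huv hu hv
    · rw [coe_laguerreBasis]
      exact laguerreVec_mem_zero hk n
    · rw [coe_laguerreBasis]
      exact inner_laguerreVec_zero hk n h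
  plus := by
    rw [concreteEp_graph]
    refine graph_eq_ladderGraph _ (two_mul_add_one_pos hk) conj_I_half (fun n => ?_)
      (fun n x y h => ?_) fun u v x y huv hu hv => graphEp_closed huv hu hv
    · rw [coe_laguerreBasis]
      exact laguerreVec_mem_plus hk n
    · rw [coe_laguerreBasis]
      exact inner_laguerreVec_plus hk n h
  minus := ladderOp_graph _ _ _ _

/-- A skew-adjoint extension of the initial operator is skew-symmetric against the Laguerre
functions and closed, which determines its graph. -/
theorem eq_laguerreEm_of_isSkewAdjoint {T : L2Pos →ₗ.[ℂ] L2Pos} (hT : IsSkewAdjoint T)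
    (hle : preEm k ≤ T) : T = laguerreEm hk := by
  have hmem : ∀ n, (laguerreVec hk n,
      ladderVec (laguerreVec hk) (2 * k + 1) (-Complex.I / 2) (-Complex.I / 2) n) ∈ T.graph :=
    fun n => LinearPMap.le_graph_of_le hle (by
      rw [preEm_graph]
      exact laguerreVec_mem_minus hk n)
  refine LinearPMap.eq_of_eq_graph ?_
  rw [laguerreEm, ladderOp_graph]
  refine graph_eq_ladderGraph _ (two_mul_add_one_pos hk) conj_neg_I_half (fun n => ?_)
    (fun n x y h => ?_) fun u v x y huv hu hv => hT.graph_closed huv hu hv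
  · rw [coe_laguerreBasis]
    exact hmem n
  · rw [coe_laguerreBasis]
    exact hT.inner_skew (hmem n) h

theorem isFriedrichsExtension_laguerreEm :
    IsFriedrichsExtension (Complex.I • preEm k) (Complex.I • laguerreEm hk) := by
  refine (isLadderTriple_laguerre hk).isFriedrichsExtension (two_mul_add_one_pos hk)
    (preEm_le_laguerreEm hk) fun n => ?_
  rw [preEm_graph, coe_laguerreBasis]
  exact laguerreVec_mem_minus hk n

/-- The rescaled Sonine polynomial in terms of binomial coefficients. -/
theorem sonine_eq (k : ℝ) (n : ℕ) (x : ℝ) :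
    sonine n (2 * k) (2 * x) =
      ∑ m ∈ Finset.range (n + 1), laguerreCoeff (2 * k + 1) n m * x ^ m := by
  refine Finset.sum_congr rfl fun m hm => ?_
  have hmn : m ≤ n := Nat.lt_succ_iff.1 (Finset.mem_range.1 hm)
  rw [laguerreCoeff, Nat.cast_choose ℝ hmn, ← add_assoc, ← add_assoc, mul_pow]
  have h1 : (n.factorial : ℝ) ≠ 0 := by positivity
  field_simp

theorem weightFun_weightPoly (k : ℝ) (n : ℕ) (x : ℝ) :
    weightFun k Complex.I (weightPoly (2 * k + 1) n) x = (laguerreFun k n x : ℂ) := by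
  have h1 : (laguerrePoly (2 * k + 1) n).eval (x : ℂ) = (sonine n (2 * k) (2 * x) : ℂ) := by
    rw [sonine_eq, laguerrePoly, eval_finsetSum]
    push_cast
    simp only [eval_mul, eval_C, eval_pow, eval_X]
  have h2 : Complex.exp (Complex.I * Complex.I * x) = (Real.exp (-x) : ℂ) := by
    rw [Complex.I_mul_I, Complex.ofReal_exp]
    congr 1
    push_cast
    ring
  rw [weightFun, weightPoly, eval_mul, eval_C, h1, h2, laguerreFun, laguerreNorm, ← add_assoc]
  push_cast
  ring

theorem coeFn_laguerreBasis (n : ℕ) :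
    laguerreBasis hk n =ᵐ[posMeasure] fun x : ℝ => (laguerreFun k n x : ℂ) := by
  rw [coe_laguerreBasis]
  filter_upwards [coeFn_weightVec hk zero_lt_I_im (weightPoly (2 * k + 1) n)] with x hx
  rw [laguerreVec, hx, weightFun_weightPoly]

/-! ### The affine coherent states -/

variable {η : ℂ} (hη : 0 < η.im)

/-- The affine coherent state as a vector of `L²(ℝ⁺)`. -/
def coherentVec : L2Pos := weightVec hk hη
  (C (Real.sqrt ((2 * η.im) ^ (2 * k + 1) / Real.Gamma (2 * k + 1)) : ℂ))

theorem coeFn_coherentVec : coherentVec hk hη =ᵐ[posMeasure] affineCoherentState k η := by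
  refine (coeFn_weightVec hk hη _).trans (Eventually.of_forall fun x => ?_)
  rw [weightFun, eval_C, affineCoherentState]
  ring

theorem norm_coherentVec : ‖coherentVec hk hη‖ = 1 := by
  have hl := two_mul_add_one_pos hk
  have hG := Real.Gamma_pos_of_pos hl
  have h2 : 0 < (2 * η.im) ^ (2 * k + 1) := Real.rpow_pos_of_pos (by positivity) _
  refine (pow_eq_one_iff_of_nonneg (norm_nonneg _) two_ne_zero).1 ?_
  rw [coherentVec, norm_weightVec_C_sq, Complex.norm_real, Real.norm_eq_abs, sq_abs,
    Real.sq_sqrt (by positivity), one_div, Real.inv_rpow (by positivity)]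
  field_simp

/-- For a constant `c`, the vector `c x^k e^{iηx}` satisfies `(L₀ - λ) / 2 = (η - i) / (η + i) L₊`;
both sides are `x^k e^{iηx}` times a polynomial of degree one. -/
theorem exists_coherent_images (c : ℂ) : ∃ G P : L2Pos,
    (weightVec hk hη (C c), G) ∈ (opL0 concreteEp (laguerreEm hk)).graph ∧
    (weightVec hk hη (C c), P) ∈ (opLp concreteE0 concreteEp (laguerreEm hk)).graph ∧
    (1 / 2 : ℂ) • (G - ((2 * k + 1 : ℝ) : ℂ) • weightVec hk hη (C c)) =
      ((η - Complex.I) / (η + Complex.I)) • P := by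
  have hne : η + Complex.I ≠ 0 := fun h => by
    have := congrArg Complex.im h
    simp only [Complex.add_im, Complex.I_im, Complex.zero_im] at this
    linarith
  set p : ℂ[X] := C c with hp
  set r : ℂ[X] := C c * (C (η ^ 2) * X - C (Complex.I * η * (2 * k + 1))) with hr
  have hI : (C Complex.I : ℂ[X]) * C Complex.I = -1 := by
    rw [← C_mul, Complex.I_mul_I, C_neg, C_1]
  have e2 : (C 2 : ℂ[X]) = 2 := rfl
  have hXr : X * r = C (k ^ 2 : ℂ) * p - eulerPoly k η (eulerPoly k η p) := by
    rw [hr, hp, eulerPoly, eulerPoly]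
    simp only [derivative_mul, derivative_X, derivative_C, map_mul, map_add, map_pow, map_one,
      map_zero, e2]
    linear_combination (C c * C η ^ 2 * X ^ 2) * hI
  have h0 : (weightVec hk hη p, weightVec hk hη (p + C 2 * eulerPoly k η p)) ∈
      concreteE0.graph := by
    rw [concreteE0_graph]
    exact weightVec_mem_graphE0 hk hη p
  have h1 : (weightVec hk hη p, weightVec hk hη (C Complex.I * (X * p))) ∈ concreteEp.graph := by
    rw [concreteEp_graph]
    exact weightVec_mem_graphEp hk hη p
  have h2 : (weightVec hk hη p, weightVec hk hη (C (-Complex.I) * r)) ∈ (laguerreEm hk).graph := by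
    refine LinearPMap.le_graph_of_le (preEm_le_laguerreEm hk) ?_
    rw [preEm_graph]
    exact weightVec_mem_graphPreEm hk hη hXr
  refine ⟨_, _, mem_graph_smul.2 ⟨_, mem_graph_sub.2 ⟨_, _, h2, h1, rfl⟩, rfl⟩,
    mem_graph_smul.2 ⟨_, mem_graph_add.2 ⟨_, _, h0, mem_graph_smul.2
      ⟨_, mem_graph_add.2 ⟨_, _, h1, h2, rfl⟩, rfl⟩, rfl⟩, rfl⟩, ?_⟩
  simp only [← weightVec_C_mul, ← weightVec_add, ← weightVec_sub]
  congr 1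
  have e3 : C ((η - Complex.I) / (η + Complex.I)) * (C η + C Complex.I) = C η - C Complex.I := by
    rw [← C_add, ← C_sub, ← C_mul, div_mul_cancel₀ _ hne]
  rw [hr, hp, eulerPoly]
  push_cast
  simp only [derivative_C, map_mul, map_add, map_pow, map_one, map_neg, e2]
  linear_combination (-C (1 / 2) * C c * ((C η + C Complex.I) * X -
      C Complex.I * (2 * C (k : ℂ) + 1))) * e3 + (C (1 / 2) * C c * ((X - (2 * C (k : ℂ) + 1)) *
      (1 + C ((η - Complex.I) / (η + Complex.I))) -
      (C η ^ 2 * X - C Complex.I * C η * (2 * C (k : ℂ) + 1)) *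
        (1 - C ((η - Complex.I) / (η + Complex.I))) -
      X * (1 + C ((η - Complex.I) / (η + Complex.I))))) * hI

/-- As `L₊` is injective, `L₊ a ψ = (L₀ - λ) ψ / 2 = z L₊ ψ` gives `a ψ = z ψ`. -/
theorem annihilation_coherentVec {a : L2Pos →L[ℂ] L2Pos}
    (ha : IsAnnihilationOperator concreteE0 concreteEp (laguerreEm hk) (2 * k + 1) a) :
    a (coherentVec hk hη) = ((η - Complex.I) / (η + Complex.I)) • coherentVec hk hη := by
  have hT := isLadderTriple_laguerre hk
  obtain ⟨G, P, hG, hP, hGP⟩ := exists_coherent_images hk hη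
    (Real.sqrt ((2 * η.im) ^ (2 * k + 1) / Real.Gamma (2 * k + 1)) : ℂ)
  have h1 := ha _ _ hG
  rw [hGP] at h1
  have h2 := Submodule.smul_mem _ ((η - Complex.I) / (η + Complex.I)) hP
  refine ext_basis (laguerreBasis hk) fun m => ?_
  have h3 := hT.opLp_coeff h1 (m + 1)
  have h4 := hT.opLp_coeff h2 (m + 1)
  have hw : (ladderWeight (2 * k + 1) (m + 1) : ℂ) ≠ 0 := by
    exact_mod_cast (ladderWeight_succ_pos (two_mul_add_one_pos hk) m).ne'
  exact mul_left_cancel₀ hw (h3.symm.trans h4)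

end Concrete

end SU11

end

theorem theorem720p3 :
    -- the concrete representation with parameter k, for each k > -1/2
    (∀ k : ℝ, -(1 / 2) < k → ∃ Em : SU11.L2Pos →ₗ.[ℂ] SU11.L2Pos,
      -- Em is the unique skew-adjoint extension, and it is given by the Friedrichs extension
      SU11.IsSkewAdjoint Em ∧ SU11.preEm k ≤ Em ∧
      (∀ T : SU11.L2Pos →ₗ.[ℂ] SU11.L2Pos, SU11.IsSkewAdjoint T → SU11.preEm k ≤ T → T = Em) ∧
      SU11.IsFriedrichsExtension (Complex.I • SU11.preEm k) (Complex.I • Em) ∧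
      -- it gives an irreducible unitary representation with lowest weight 2k+1
      SU11.IsLowestWeightIrrep SU11.concreteE0 SU11.concreteEp Em ∧
      SU11.HasLowestWeight SU11.concreteE0 SU11.concreteEp Em (2 * k + 1) ∧
      -- each representation with this lowest weight is unitarily equivalent to it
      (∀ (H : Type u) [NormedAddCommGroup H] [InnerProductSpace ℂ H] [CompleteSpace H]
        (E0 Ep Em' : H →ₗ.[ℂ] H), SU11.IsLowestWeightIrrep E0 Ep Em' →
        SU11.HasLowestWeight E0 Ep Em' (2 * k + 1) →
        ∃ U : H ≃ₗᵢ[ℂ] SU11.L2Pos, SU11.Intertwines U E0 SU11.concreteE0 ∧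
          SU11.Intertwines U Ep SU11.concreteEp ∧ SU11.Intertwines U Em' Em) ∧
      -- the weight basis consists of Laguerre functions
      ∃ b : HilbertBasis ℕ ℂ SU11.L2Pos,
        (∀ n : ℕ, b n =ᵐ[SU11.posMeasure] fun x : ℝ => (SU11.laguerreFun k n x : ℂ)) ∧
        SU11.IsWeightBasis SU11.concreteE0 SU11.concreteEp Em (2 * k + 1) b ∧
        -- the eigenvectors of A are, up to scalars, the affine coherent states
        ∃ (a : SU11.L2Pos →L[ℂ] SU11.L2Pos) (A : SU11.L2Pos →ₗ.[ℂ] SU11.L2Pos),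
          SU11.IsAnnihilationOperator SU11.concreteE0 SU11.concreteEp Em (2 * k + 1) a ∧
          SU11.IsOperatorA b a A ∧
          (∀ η : ℂ, 0 < η.im → ∃ f : SU11.L2Pos, ‖f‖ = 1 ∧
            f =ᵐ[SU11.posMeasure] SU11.affineCoherentState k η ∧ (f, η • f) ∈ A.graph) ∧
          (∀ (η : ℂ) (f : SU11.L2Pos), f ≠ 0 → (f, η • f) ∈ A.graph →
            0 < η.im ∧ ∃ c : ℂ, f =ᵐ[SU11.posMeasure]
              fun x => c * SU11.affineCoherentState k η x)) ∧
    -- each representation of lowest-weight-type has the lowest weight 2k+1 for one k > -1/2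
    (∀ (H : Type u) [NormedAddCommGroup H] [InnerProductSpace ℂ H] [CompleteSpace H]
      (E0 Ep Em : H →ₗ.[ℂ] H), SU11.IsLowestWeightIrrep E0 Ep Em →
      ∃! k : ℝ, -(1 / 2) < k ∧ SU11.HasLowestWeight E0 Ep Em (2 * k + 1)) := by
  refine ⟨fun k hk => ?_, fun H _ _ _ E0 Ep Em h => ?_⟩
  · have hl := SU11.two_mul_add_one_pos hk
    have hT := SU11.isLadderTriple_laguerre hk
    refine ⟨SU11.laguerreEm hk, hT.skew_minus hl, SU11.preEm_le_laguerreEm hk,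
      fun T hT hle => SU11.eq_laguerreEm_of_isSkewAdjoint hk hT hle,
      SU11.isFriedrichsExtension_laguerreEm hk, hT.isLowestWeightIrrep hl, hT.hasLowestWeight hl,
      fun H _ _ _ E0 Ep Em' h hlam => ?_, SU11.laguerreBasis hk, SU11.coeFn_laguerreBasis hk,
      hT.isWeightBasis hl, ?_⟩
    · obtain ⟨-, b, hb⟩ := h.exists_ladderTriple hlam
      exact hb.exists_intertwines hT
    · obtain ⟨a, ha⟩ := SU11.exists_annihilation (SU11.laguerreBasis hk) hl
      obtain ⟨A, hA, hAg⟩ := SU11.exists_isOperatorA hl ha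
      have han := hT.isAnnihilationOperator hl ha
      refine ⟨a, A, han, hA, fun η hη => ?_, fun η f hf hfA => ?_⟩
      · have h0 : SU11.coherentVec hk hη ≠ 0 := by
          rw [← norm_pos_iff, SU11.norm_coherentVec]
          exact one_pos
        refine ⟨SU11.coherentVec hk hη, SU11.norm_coherentVec hk hη,
          SU11.coeFn_coherentVec hk hη, (hAg _ _).2 ((SU11.cayley_eigenvector_iff h0).2
            ⟨fun h => ?_, SU11.annihilation_coherentVec hk hη han⟩)⟩
        have := congrArg Complex.im h
        simp only [Complex.add_im, Complex.I_im, Complex.zero_im] at this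
        linarith
      · obtain ⟨hne, hz⟩ := (SU11.cayley_eigenvector_iff hf).1 ((hAg _ _).1 hfA)
        have hη := SU11.im_pos_of_norm_lt_one hne (SU11.norm_lt_one_of_eigenvector hl ha hz hf)
        have h0 : SU11.coherentVec hk hη ≠ 0 := by
          rw [← norm_pos_iff, SU11.norm_coherentVec]
          exact one_pos
        obtain ⟨c, rfl⟩ := SU11.eigenvector_unique hl ha
          (SU11.annihilation_coherentVec hk hη han) hz h0
        refine ⟨hη, c, ?_⟩
        filter_upwards [MeasureTheory.Lp.coeFn_smul c (SU11.coherentVec hk hη),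
          SU11.coeFn_coherentVec hk hη] with x h1 h2
        rw [h1, Pi.smul_apply, h2, smul_eq_mul]
  · obtain ⟨lam, hlam⟩ := h.exists_lowestWeight
    obtain ⟨hl, -⟩ := h.exists_ladderTriple hlam
    refine ⟨(lam - 1) / 2, ⟨by linarith, ?_⟩, fun k hk => ?_⟩
    · have e : 2 * ((lam - 1) / 2) + 1 = lam := by ring
      rwa [e]
    · have e := h.lowestWeight_unique hk.2 hlam
      linarith
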